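/- Let $k$ be a field, $\Gamma$ a Hopf algebra over $k$ with bijective antipode $S$, counit $\epsilon$ and coproduct $\gamma\mapsto\gamma_1\otimes\gamma_2$, and let $A$ be a $\Gamma$-module algebra, i.e. a $k$-algebra with a left $\Gamma$-module structure such that $\gamma(ab)=(\gamma_1a)(\gamma_2b)$ and $\gamma 1=\epsilon(\gamma)1$. Let $A\#\Gamma$ be the smash product, i.e. $A\otimes\Gamma$ with multiplication $(a\otimes\gamma)(b\otimes\delta)=a(\gamma_1b)\otimes\gamma_2\delta$, and let $B$ be an algebra extension of $A\#\Gamma$, i.e. a $k$-algebra with an algebra map $A\#\Gamma\to B$. For an algebra $R$ write $R^e$ for its enveloping algebra. Hochschild cohomology. Let $R$ be an algebra and $R\to B$ an algebra map. Let $\varphi:P\to R$ be a projective $R$-bimodule resolution, and let $\Delta:P\to P\otimes_RP$, $\Delta(x)=\sum x_1\otimes x_2$, be a chain map of complexes of bimodules with $(\varphi\otimes_R\varphi)\Delta=\varphi$. Then $\mathrm{Hom}_{R^e}(P,B)$ is a (not necessarily associative) dg algebra with differential $df=-(-1)^{|f|}f\,d_P$ and product $(fg)(x)=\sum(-1)^{|g||x_1|}f(x_1)g(x_2)$.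 Its cohomology is the Hochschild cohomology $\mathrm{HH}(R,B)$ with the cup product; its unit is the class of $P\xrightarrow{\varphi}R\to B$. The derived invariant algebra. Let $\tau:K\to A$ be a projective $A$-bimodule resolution such that (I) $K$ is a complex of $\Gamma$-equivariant $A$-bimodules, i.e. each $K^i$ is a left $\Gamma$-module with $\gamma(axb)=(\gamma_1a)(\gamma_2x)(\gamma_3b)$ and the differentials are $\Gamma$-linear, and $\tau$ is $\Gamma$-linear; (II) each $K^i$ is free over $A^e$ on a $\Gamma$-stable subspace, i.e. it has a $\Gamma$-stable subspace $\bar K^i$ for which the action map $A^e\otimes\bar K^i\to K^i$ is bijective; (III) there is given a $\Gamma$-linear chain map $\omega:K\to K\otimes_AK$ of complexes of $A$-bimodules with $(\tau\otimes_A\tau)\omega=\tau$, where $\Gamma$ acts on $K\otimes_AK$ by $\gamma(x\otimes y)=\gamma_1x\otimes\gamma_2y$. Let $\xi:L\to k$ be a projective resolution of the trivial right $\Gamma$-module $k$, with a right $\Gamma$-linear chain map $\sigma:L\to L\otimes L$ such that $(\xi\otimes\xi)\sigma=\xi$, where $\Gamma$ acts on $L\otimes L$ by $(l\otimes l')\gamma=l\gamma_1\otimes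 l'\gamma_2$. Then $\mathrm{Hom}_{A^e}(K,B)$, with the differential and the product defined as above by means of $\omega$, and with the right action $(f\cdot\gamma)(x)=S(\gamma_1)f(\gamma_2x)\gamma_3$, is a right $\Gamma$-module dg algebra, and $\mathrm{Hom}_\Gamma(L,\mathrm{Hom}_{A^e}(K,B))$ is a (not necessarily associative) dg algebra with differential $DF=d\circ F-(-1)^{|F|}F\circ d_L$ and product $(FG)(l)=\sum(-1)^{|G||l_1|}F(l_1)G(l_2)$, where $\sigma(l)=\sum l_1\otimes l_2$. Corollary. For all such $A$, $\Gamma$, $B$, $K$, $\omega$, $L$, $\sigma$ there is an isomorphism of graded $k$-algebras $$\mathrm{HH}(A\#\Gamma,B)\;\cong\;\mathrm{H}\bigl(\mathrm{Hom}_\Gamma(L,\mathrm{Hom}_{A^e}(K,B))\bigr),$$ where the left side carries the cup product, computed from any projective $A\#\Gamma$-bimodule resolution $P$ of $A\#\Gamma$ with a map $\Delta$ as above. The isomorphism is $k$-linear in each degree, multiplicative, and it takes the unit class on the left to the class of $l\mapsto(x\mapsto\xi(l)\tau(x))$ on the right. -/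

import Mathlib

open TensorProduct MulOpposite Coalgebra

universe u

noncomputable section

namespace SmashHH

/-! ## Sweedler notation -/

section Sweedler

variable {k Γ U V W U' V' W' : Type u} [Field k] [AddCommGroup Γ] [Module k Γ] [Coalgebra k Γ]
  [AddCommGroup U] [Module k U] [AddCommGroup V] [Module k V] [AddCommGroup W] [Module k W]
  [AddCommGroup U'] [Module k U'] [AddCommGroup V'] [Module k V'] [AddCommGroup W'] [Module k W']

/-- The linear map `γ ↦ ∑ β (f γ₁) (g γ₂)`, where `Δ γ = ∑ γ₁ ⊗ γ₂`. -/
def sweedler (β : U →ₗ[k] V →ₗ[k] W) (f : Γ →ₗ[k] U) (g : Γ →ₗ[k] V) : Γ →ₗ[k] W :=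
  TensorProduct.lift (β.compl₁₂ f g) ∘ₗ comul

theorem sweedler_apply (β : U →ₗ[k] V →ₗ[k] W) (f : Γ →ₗ[k] U) (g : Γ →ₗ[k] V) {γ : Γ}
    {ι : Type*} (r : Repr k γ ι) :
    sweedler β f g γ = ∑ i ∈ r.index, β (f (r.left i)) (g (r.right i)) := by
  simp [sweedler, ← r.eq, map_sum]

theorem sweedler_assoc (β : U →ₗ[k] V →ₗ[k] U') (β' : U' →ₗ[k] W →ₗ[k] W')
    (δ : V →ₗ[k] W →ₗ[k] V') (δ' : U →ₗ[k] V' →ₗ[k] W')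
    (h : ∀ a b c, β' (β a b) c = δ' a (δ b c))
    (f : Γ →ₗ[k] U) (g : Γ →ₗ[k] V) (e : Γ →ₗ[k] W) :
    sweedler β' (sweedler β f g) e = sweedler δ' f (sweedler δ g e) := by
  have h1 : sweedler β' (sweedler β f g) e =
      TensorProduct.lift (TensorProduct.lift
        ((β.compl₁₂ f g).compr₂ (β'.compl₁₂ LinearMap.id e))) ∘ₗ
        (comul (R := k) (A := Γ)).rTensor Γ ∘ₗ comul := by
    rw [sweedler, ← LinearMap.comp_assoc]
    congr 1
    ext a b
    simp only [sweedler, AlgebraTensorModule.curry_apply, LinearMap.restrictScalars_self,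
      curry_apply, lift.tmul, LinearMap.compl₁₂_apply, LinearMap.coe_comp, Function.comp_apply,
      LinearMap.rTensor_tmul]
    induction comul (R := k) a with
    | zero => simp
    | tmul x y => simp
    | add x y hx hy => simp only [map_add, LinearMap.add_apply, hx, hy]
  have h2 : sweedler δ' f (sweedler δ g e) =
      TensorProduct.lift (TensorProduct.lift
        ((β.compl₁₂ f g).compr₂ (β'.compl₁₂ LinearMap.id e))) ∘ₗ
        (TensorProduct.assoc k Γ Γ Γ).symm.toLinearMap ∘ₗ
        (comul (R := k) (A := Γ)).lTensor Γ ∘ₗ comul := by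
    rw [sweedler, ← LinearMap.comp_assoc, ← LinearMap.comp_assoc]
    congr 1
    ext a b
    simp only [sweedler, AlgebraTensorModule.curry_apply, LinearMap.restrictScalars_self,
      curry_apply, lift.tmul, LinearMap.compl₁₂_apply, LinearMap.coe_comp, Function.comp_apply,
      LinearMap.lTensor_tmul, LinearEquiv.coe_coe]
    induction comul (R := k) b with
    | zero => simp
    | tmul x y => simp [h]
    | add x y hx hy => simp only [map_add, TensorProduct.tmul_add, hx, hy]
  rw [h1, h2]
  congr 1
  exact Coalgebra.coassoc_symm.symm

theorem sweedler_comp (β : U →ₗ[k] V →ₗ[k] W) (φ : W →ₗ[k] W') (f : Γ →ₗ[k] U)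
    (g : Γ →ₗ[k] V) (γ : Γ) :
    φ (sweedler β f g γ) = sweedler (β.compr₂ φ) f g γ := by
  rw [sweedler_apply _ _ _ (ℛ k γ), sweedler_apply _ _ _ (ℛ k γ), map_sum]
  rfl

theorem sweedler_counit_left (β : U →ₗ[k] V →ₗ[k] W) (f : Γ →ₗ[k] U) (g : Γ →ₗ[k] V)
    (a : U) (h : ∀ γ, f γ = counit (R := k) γ • a) (γ : Γ) :
    sweedler β f g γ = β a (g γ) := by
  rw [sweedler_apply _ _ _ (ℛ k γ)]
  conv_rhs => rw [← sum_counit_smul (ℛ k γ)]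
  simp [h, map_sum]

end Sweedler

/-! ## Module algebras and the smash product -/

section Smash

variable (k : Type u) {Γ : Type u} [Field k] [Ring Γ]

/-- The linear map `γ ↦ γ • m`. -/
def orbit [Algebra k Γ] {M : Type u} [AddCommGroup M] [Module k M] [Module Γ M]
    [IsScalarTower k Γ M] (m : M) : Γ →ₗ[k] M :=
  (LinearMap.toSpanSingleton Γ M m).restrictScalars k

@[simp] theorem orbit_apply [Algebra k Γ] {M : Type u} [AddCommGroup M] [Module k M] [Module Γ M]
    [IsScalarTower k Γ M] (m : M) (γ : Γ) : orbit k m γ = γ • m := rfl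

/-- `A` is a `Γ`-module algebra: `γ • (a b) = ∑ (γ₁ • a) (γ₂ • b)` and `γ • 1 = ε(γ) 1`. -/
class IsModuleAlgebra (Γ A : Type u) [Ring Γ] [Bialgebra k Γ] [Ring A] [Algebra k A]
    [Module Γ A] [IsScalarTower k Γ A] : Prop where
  smul_mul' : ∀ (γ : Γ) (a b : A),
    γ • (a * b) = sweedler (LinearMap.mul k A) (orbit k a) (orbit k b) γ
  smul_one' : ∀ γ : Γ, γ • (1 : A) = counit (R := k) γ • (1 : A)

variable [Bialgebra k Γ]

/-- The diagonal action of a bialgebra on a tensor product, `γ (m ⊗ n) = ∑ γ₁ m ⊗ γ₂ n`. -/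
def diagAct (M N : Type u) [AddCommGroup M] [Module k M] [Module Γ M] [IsScalarTower k Γ M]
    [AddCommGroup N] [Module k N] [Module Γ N] [IsScalarTower k Γ N] :
    Γ →ₐ[k] Module.End k (M ⊗[k] N) :=
  (Module.endTensorEndAlgHom (R := k) (S := k) (A := k) (M := M) (N := N)).comp
    ((Algebra.TensorProduct.map (Algebra.lsmul k k M) (Algebra.lsmul k k N)).comp
      (Bialgebra.comulAlgHom k Γ))

theorem diagAct_tmul {M N : Type u} [AddCommGroup M] [Module k M] [Module Γ M]
    [IsScalarTower k Γ M] [AddCommGroup N] [Module k N] [Module Γ N] [IsScalarTower k Γ N]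
    (γ : Γ) (m : M) (n : N) :
    diagAct k M N γ (m ⊗ₜ n) = sweedler (TensorProduct.mk k M N) (orbit k m) (orbit k n) γ := by
  rw [sweedler_apply _ _ _ (ℛ k γ)]
  simp only [diagAct, AlgHom.comp_apply, Bialgebra.comulAlgHom_apply]
  rw [← (ℛ k γ).eq, map_sum, map_sum, LinearMap.sum_apply]
  rfl

/-- The smash product `A # Γ`: the vector space `A ⊗ Γ` with the multiplication
`(a ⊗ γ) (b ⊗ δ) = ∑ a (γ₁ • b) ⊗ γ₂ δ`. -/
def SmashProduct (Γ A : Type u) [Ring Γ] [Bialgebra k Γ] [Ring A] [Algebra k A] : Type u :=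
  A ⊗[k] Γ

variable (Γ) (A : Type u) [Ring A] [Algebra k A]

namespace SmashProduct

instance : AddCommGroup (SmashProduct k Γ A) := inferInstanceAs (AddCommGroup (A ⊗[k] Γ))

instance : Module k (SmashProduct k Γ A) := inferInstanceAs (Module k (A ⊗[k] Γ))

variable [Module Γ A] [IsScalarTower k Γ A]

/-- The multiplication of the smash product as a bilinear map. -/
def mulHom : A ⊗[k] Γ →ₗ[k] Module.End k (A ⊗[k] Γ) :=
  TensorProduct.lift
    ((LinearMap.mul k (Module.End k (A ⊗[k] Γ))).compl₁₂
      ((LinearMap.rTensorHom Γ).comp (LinearMap.mul k A)) (diagAct k A Γ).toLinearMap)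

variable {A} {Γ}

theorem mulHom_tmul (a : A) (γ : Γ) (y : A ⊗[k] Γ) :
    mulHom k Γ A (a ⊗ₜ γ) y = (LinearMap.mul k A a).rTensor Γ (diagAct k A Γ γ y) := rfl

theorem mulHom_tmul_tmul (a b : A) (γ δ : Γ) {ι : Type*} (r : Repr k γ ι) :
    mulHom k Γ A (a ⊗ₜ γ) (b ⊗ₜ δ) =
      ∑ i ∈ r.index, (a * (r.left i • b)) ⊗ₜ[k] (r.right i * δ) := by
  rw [mulHom_tmul, diagAct_tmul, sweedler_apply _ _ _ r, map_sum]
  rfl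

theorem diagAct_mul [IsModuleAlgebra k Γ A] (γ : Γ) (b : A) (z : A ⊗[k] Γ) :
    diagAct k A Γ γ ((LinearMap.mul k A b).rTensor Γ z) =
      mulHom k Γ A (sweedler (TensorProduct.mk k A Γ) (orbit k b) LinearMap.id γ) z := by
  induction z with
  | zero => simp
  | add x y hx hy => simp only [map_add, hx, hy]
  | tmul c ε =>
    rw [LinearMap.rTensor_tmul, diagAct_tmul]
    have e1 : orbit k (LinearMap.mul k A b c) =
        sweedler (LinearMap.mul k A) (orbit k b) (orbit (Γ := Γ) k c) := by
      ext x
      exact IsModuleAlgebra.smul_mul' x b c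
    rw [e1]
    rw [sweedler_assoc (LinearMap.mul k A) (TensorProduct.mk k A Γ) (TensorProduct.mk k A Γ)
      ((LinearMap.rTensorHom Γ).comp (LinearMap.mul k A)) (fun _ _ _ => rfl)]
    rw [sweedler_apply _ _ _ (ℛ k γ), sweedler_apply _ _ _ (ℛ k γ), map_sum, LinearMap.sum_apply]
    refine Finset.sum_congr rfl fun i _ => ?_
    rw [TensorProduct.mk_apply, mulHom_tmul, LinearMap.id_apply, diagAct_tmul]
    rfl

theorem mulHom_assoc [IsModuleAlgebra k Γ A] (x y z : A ⊗[k] Γ) :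
    mulHom k Γ A (mulHom k Γ A x y) z = mulHom k Γ A x (mulHom k Γ A y z) := by
  induction x with
  | zero => simp
  | add x x' hx hx' => simp only [map_add, LinearMap.add_apply, hx, hx']
  | tmul a γ =>
    induction y with
    | zero => simp
    | add x x' hx hx' => simp only [map_add, LinearMap.add_apply, hx, hx']
    | tmul b δ =>
      rw [mulHom_tmul k b δ, mulHom_tmul, mulHom_tmul, diagAct_mul, diagAct_tmul,
        sweedler_apply _ _ _ (ℛ k γ), sweedler_apply _ _ _ (ℛ k γ)]
      simp only [map_sum, LinearMap.sum_apply]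
      refine Finset.sum_congr rfl fun i _ => ?_
      simp only [TensorProduct.mk_apply, LinearMap.rTensor_tmul, mulHom_tmul, orbit_apply,
        LinearMap.id_apply, smul_eq_mul, map_mul, Module.End.mul_apply, LinearMap.mul_apply']
      rw [← LinearMap.rTensor_comp_apply]
      congr 2
      ext c
      simp [mul_assoc]

theorem mulHom_inl_left (a b : A) (δ : Γ) :
    mulHom k Γ A (a ⊗ₜ[k] (1 : Γ)) (b ⊗ₜ[k] δ) = (a * b) ⊗ₜ[k] δ := by
  rw [mulHom_tmul, map_one (diagAct k A Γ)]
  simp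

theorem mulHom_inr_right [IsModuleAlgebra k Γ A] (a : A) (γ δ : Γ) :
    mulHom k Γ A (a ⊗ₜ[k] γ) ((1 : A) ⊗ₜ[k] δ) = a ⊗ₜ[k] (γ * δ) := by
  rw [mulHom_tmul, diagAct_tmul, sweedler_counit_left _ _ _ (1 : A)
    (fun γ => IsModuleAlgebra.smul_one' γ)]
  simp

theorem one_mulHom (x : A ⊗[k] Γ) : mulHom k Γ A ((1 : A) ⊗ₜ[k] (1 : Γ)) x = x := by
  induction x with
  | zero => simp
  | add x x' hx hx' => rw [map_add, hx, hx']
  | tmul a γ => rw [mulHom_inl_left, one_mul]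

theorem mulHom_one [IsModuleAlgebra k Γ A] (x : A ⊗[k] Γ) :
    mulHom k Γ A x ((1 : A) ⊗ₜ[k] (1 : Γ)) = x := by
  induction x with
  | zero => simp
  | add x x' hx hx' => rw [map_add, LinearMap.add_apply, hx, hx']
  | tmul a γ => rw [mulHom_inr_right, mul_one]

instance [IsModuleAlgebra k Γ A] : Ring (SmashProduct k Γ A) :=
  { (inferInstance : AddCommGroup (SmashProduct k Γ A)) with
    mul := fun x y => mulHom k Γ A x y
    one := (1 : A) ⊗ₜ[k] (1 : Γ)
    left_distrib := fun x y z => map_add (mulHom k Γ A x) y z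
    right_distrib := fun x y z => LinearMap.congr_fun (map_add (mulHom k Γ A) x y) z
    zero_mul := fun x => LinearMap.congr_fun (map_zero (mulHom k Γ A)) x
    mul_zero := fun x => map_zero (mulHom k Γ A x)
    mul_assoc := mulHom_assoc k
    one_mul := one_mulHom k
    mul_one := mulHom_one k }

variable [IsModuleAlgebra k Γ A]

instance : Algebra k (SmashProduct k Γ A) :=
  Algebra.ofModule (fun r x y => LinearMap.congr_fun (map_smul (mulHom k Γ A) r x) y)
    (fun r x y => map_smul (mulHom k Γ A x) r y)

/-- The inclusion `A → A # Γ`, `a ↦ a ⊗ 1`. -/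
def inl : A →ₐ[k] SmashProduct k Γ A :=
  AlgHom.ofLinearMap ((TensorProduct.mk k A Γ).flip 1) rfl
    fun a b => (mulHom_inl_left k a b 1).symm

/-- The inclusion `Γ → A # Γ`, `γ ↦ 1 ⊗ γ`. -/
def inr : Γ →ₐ[k] SmashProduct k Γ A :=
  AlgHom.ofLinearMap (TensorProduct.mk k A Γ 1) rfl
    fun γ δ => (mulHom_inr_right k 1 γ δ).symm

theorem inr_mul_inl (γ : Γ) (a : A) :
    inr k γ * inl k a =
      sweedler (LinearMap.mul k (SmashProduct k Γ A)) ((inl k).toLinearMap ∘ₗ orbit k a)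
        (inr k).toLinearMap γ := by
  change mulHom k Γ A ((1 : A) ⊗ₜ[k] γ) (a ⊗ₜ[k] (1 : Γ)) = _
  rw [mulHom_tmul_tmul k _ _ _ _ (ℛ k γ), sweedler_apply _ _ _ (ℛ k γ)]
  refine Finset.sum_congr rfl fun i _ => ?_
  change _ = mulHom k Γ A (((ℛ k γ).left i • a) ⊗ₜ[k] (1 : Γ)) ((1 : A) ⊗ₜ[k] (ℛ k γ).right i)
  rw [mulHom_inl_left, one_mul, mul_one, mul_one]

end SmashProduct

end Smash

/-! ## Bimodules and tensor products over a noncommutative algebra -/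

section Bimodules

/-- The enveloping algebra of `R`. An `R`-bimodule is a module over it, with
`(r ⊗ op s) • m = r m s`. -/
abbrev Env (k R : Type u) [Field k] [Ring R] [Algebra k R] : Type u := R ⊗[k] Rᵐᵒᵖ

variable (k R : Type u) [Field k] [Ring R] [Algebra k R]
  (M N M' N' : Type u) [AddCommGroup M] [Module k M] [Module (Env k R) M]
  [IsScalarTower k (Env k R) M]
  [AddCommGroup N] [Module k N] [Module (Env k R) N] [IsScalarTower k (Env k R) N]
  [AddCommGroup M'] [Module k M'] [Module (Env k R) M'] [IsScalarTower k (Env k R) M']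
  [AddCommGroup N'] [Module k N'] [Module (Env k R) N'] [IsScalarTower k (Env k R) N']

/-- The left action `r m` on a bimodule. -/
def leftAct : R →ₗ[k] M →ₗ[k] M :=
  (Algebra.lsmul k k M).toLinearMap ∘ₗ (TensorProduct.mk k R Rᵐᵒᵖ).flip 1

/-- The right action `m r` on a bimodule. -/
def rightAct : M →ₗ[k] R →ₗ[k] M :=
  ((Algebra.lsmul k k M).toLinearMap ∘ₗ TensorProduct.mk k R Rᵐᵒᵖ 1 ∘ₗ
    (opLinearEquiv k).toLinearMap).flip

variable {k R M N M' N'}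

theorem leftAct_apply (r : R) (m : M) : leftAct k R M r m = (r ⊗ₜ[k] (1 : Rᵐᵒᵖ)) • m := rfl

theorem rightAct_apply (r : R) (m : M) : rightAct k R M m r = ((1 : R) ⊗ₜ[k] op r) • m := rfl

theorem left_right_act (r s : R) (m : M) :
    (r ⊗ₜ[k] op s) • m = leftAct k R M r (rightAct k R M m s) := by
  rw [leftAct_apply, rightAct_apply, smul_smul]
  simp

theorem leftAct_rightAct (r s : R) (m : M) :
    leftAct k R M r (rightAct k R M m s) = rightAct k R M (leftAct k R M r m) s := by
  rw [leftAct_apply, rightAct_apply, leftAct_apply, rightAct_apply, smul_smul, smul_smul]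
  simp

variable (k R M N)

/-- The relations `(m r) ⊗ n = m ⊗ (r n)`. -/
def relSub : Submodule k (M ⊗[k] N) :=
  Submodule.span k {t | ∃ (m : M) (r : R) (n : N),
    t = rightAct k R M m r ⊗ₜ[k] n - m ⊗ₜ[k] leftAct k R N r n}

/-- The tensor product `M ⊗_R N` of two `R`-bimodules. -/
def RelTensor : Type u := (M ⊗[k] N) ⧸ relSub k R M N

namespace RelTensor

instance : AddCommGroup (RelTensor k R M N) :=
  inferInstanceAs (AddCommGroup ((M ⊗[k] N) ⧸ relSub k R M N))

instance : Module k (RelTensor k R M N) :=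
  inferInstanceAs (Module k ((M ⊗[k] N) ⧸ relSub k R M N))

/-- The projection `M ⊗ N → M ⊗_R N`. -/
def proj : M ⊗[k] N →ₗ[k] RelTensor k R M N := (relSub k R M N).mkQ

variable {k R M N}

theorem proj_surjective : Function.Surjective (proj k R M N) := Submodule.mkQ_surjective _

theorem proj_balanced (m : M) (r : R) (n : N) :
    proj k R M N (rightAct k R M m r ⊗ₜ n) = proj k R M N (m ⊗ₜ leftAct k R N r n) := by
  rw [← sub_eq_zero, ← map_sub]
  exact (Submodule.Quotient.mk_eq_zero _).2 (Submodule.subset_span ⟨m, r, n, rfl⟩)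

theorem ext {V : Type u} [AddCommGroup V] [Module k V] {f g : RelTensor k R M N →ₗ[k] V}
    (h : ∀ m n, f (proj k R M N (m ⊗ₜ n)) = g (proj k R M N (m ⊗ₜ n))) : f = g := by
  refine LinearMap.ext fun z => ?_
  obtain ⟨t, rfl⟩ := proj_surjective z
  exact LinearMap.congr_fun (TensorProduct.ext' (g := f ∘ₗ proj k R M N)
    (h := g ∘ₗ proj k R M N) h) t

/-- A bilinear map `β` with `β (m r) n = β m (r n)` induces a linear map on `M ⊗_R N`. -/
def lift {V : Type u} [AddCommGroup V] [Module k V] (β : M →ₗ[k] N →ₗ[k] V)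
    (h : ∀ m r n, β (rightAct k R M m r) n = β m (leftAct k R N r n)) :
    RelTensor k R M N →ₗ[k] V :=
  (relSub k R M N).liftQ (TensorProduct.lift β) (by
    rw [relSub, Submodule.span_le]
    rintro _ ⟨m, r, n, rfl⟩
    simp [h])

@[simp] theorem lift_proj {V : Type u} [AddCommGroup V] [Module k V] (β : M →ₗ[k] N →ₗ[k] V)
    (h : ∀ m r n, β (rightAct k R M m r) n = β m (leftAct k R N r n)) (m : M) (n : N) :
    lift β h (proj k R M N (m ⊗ₜ n)) = β m n := rfl

/-- The map `f ⊗_R g`. -/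
def map (f : M →ₗ[Env k R] M') (g : N →ₗ[Env k R] N') :
    RelTensor k R M N →ₗ[k] RelTensor k R M' N' :=
  lift (((TensorProduct.mk k M' N').compr₂ (proj k R M' N')).compl₁₂
    (f.restrictScalars k) (g.restrictScalars k)) (fun m r n => by
      have h := proj_balanced (k := k) (R := R) (f m) r (g n)
      rw [rightAct_apply, leftAct_apply, ← map_smul, ← map_smul] at h
      exact h)

@[simp] theorem map_proj (f : M →ₗ[Env k R] M') (g : N →ₗ[Env k R] N') (m : M) (n : N) :
    map f g (proj k R M N (m ⊗ₜ n)) = proj k R M' N' (f m ⊗ₜ g n) := rfl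

end RelTensor

/-- An action on `V` that preserves a subspace `W` induces an action on `V ⧸ W`. -/
def quotAct {S V : Type u} [Ring S] [Algebra k S] [AddCommGroup V] [Module k V]
    (W : Submodule k V) (ρ : S →ₐ[k] Module.End k V) (h : ∀ s, W ≤ W.comap (ρ s)) :
    S →ₐ[k] Module.End k (V ⧸ W) :=
  AlgHom.ofLinearMap
    { toFun := fun s => W.mapQ W (ρ s) (h s)
      map_add' := fun s t => by ext x; simp
      map_smul' := fun c s => by ext x; simp }
    (by ext x; simp)
    (fun s t => by ext x; simp)

/-- The action of `R^e` on `M ⊗ N` through the left action on `M` and the right action on `N`. -/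
def outerAct : Env k R →ₐ[k] Module.End k (M ⊗[k] N) :=
  (Module.endTensorEndAlgHom (R := k) (S := k) (A := k) (M := M) (N := N)).comp
    (Algebra.TensorProduct.map
      ((Algebra.lsmul k k M : Env k R →ₐ[k] Module.End k M).comp
        Algebra.TensorProduct.includeLeft)
      ((Algebra.lsmul k k N : Env k R →ₐ[k] Module.End k N).comp
        Algebra.TensorProduct.includeRight))

theorem outerAct_tmul (r : R) (s : Rᵐᵒᵖ) (m : M) (n : N) :
    outerAct k R M N (r ⊗ₜ s) (m ⊗ₜ n) = leftAct k R M r m ⊗ₜ rightAct k R N n s.unop := rfl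

theorem outerAct_relSub (e : Env k R) :
    relSub k R M N ≤ (relSub k R M N).comap (outerAct k R M N e) := by
  induction e using TensorProduct.induction_on with
  | zero => intro x _; simp
  | add a b ha hb =>
    intro x hx
    rw [Submodule.mem_comap, map_add, LinearMap.add_apply]
    exact add_mem (ha hx) (hb hx)
  | tmul r s =>
    conv_lhs => rw [relSub]
    rw [Submodule.span_le]
    rintro _ ⟨m, t, n, rfl⟩
    refine Submodule.subset_span ⟨leftAct k R M r m, t, rightAct k R N n s.unop, ?_⟩
    rw [map_sub, outerAct_tmul, outerAct_tmul, leftAct_rightAct, leftAct_rightAct]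

namespace RelTensor

/-- The bimodule structure `r (m ⊗ n) s = (r m) ⊗ (n s)` on `M ⊗_R N`. -/
instance : Module (Env k R) (RelTensor k R M N) :=
  Module.compHom (M ⊗[k] N ⧸ relSub k R M N)
    (quotAct k (relSub k R M N) (outerAct k R M N) (outerAct_relSub k R M N)).toRingHom

theorem env_smul_proj (e : Env k R) (t : M ⊗[k] N) :
    e • proj k R M N t = proj k R M N (outerAct k R M N e t) := rfl

instance : IsScalarTower k (Env k R) (RelTensor k R M N) where
  smul_assoc c e z := by
    obtain ⟨t, rfl⟩ := proj_surjective z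
    rw [env_smul_proj, env_smul_proj, map_smul, LinearMap.smul_apply, map_smul]

end RelTensor

end Bimodules

section Equivariant

variable (k Γ A : Type u) [Field k] [Ring Γ] [Bialgebra k Γ] [Ring A] [Algebra k A]
  [Module Γ A] [IsScalarTower k Γ A]

/-- `M` is a `Γ`-equivariant `A`-bimodule: the actions `A ⊗ M → M` and `M ⊗ A → M` are
`Γ`-linear, that is `γ (a m) = ∑ (γ₁ a) (γ₂ m)` and `γ (m a) = ∑ (γ₁ m) (γ₂ a)`. -/
class IsEquivariant (M : Type u) [AddCommGroup M] [Module k M] [Module (Env k A) M]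
    [IsScalarTower k (Env k A) M] [Module Γ M] [IsScalarTower k Γ M] : Prop where
  smul_left : ∀ (γ : Γ) (a : A) (m : M),
    γ • leftAct k A M a m = sweedler (leftAct k A M) (orbit k a) (orbit k m) γ
  smul_right : ∀ (γ : Γ) (a : A) (m : M),
    γ • rightAct k A M m a = sweedler (rightAct k A M) (orbit k m) (orbit k a) γ

variable (M N : Type u) [AddCommGroup M] [Module k M] [Module (Env k A) M]
  [IsScalarTower k (Env k A) M] [Module Γ M] [IsScalarTower k Γ M]
  [AddCommGroup N] [Module k N] [Module (Env k A) N]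
  [IsScalarTower k (Env k A) N] [Module Γ N] [IsScalarTower k Γ N]

theorem diagAct_relSub [IsEquivariant k Γ A M] [IsEquivariant k Γ A N] (γ : Γ) :
    relSub k A M N ≤ (relSub k A M N).comap (diagAct k M N γ) := by
  conv_lhs => rw [relSub]
  rw [Submodule.span_le]
  rintro _ ⟨m, a, n, rfl⟩
  change diagAct k M N γ _ ∈ relSub k A M N
  have e1 : orbit k (rightAct k A M m a) =
      sweedler (rightAct k A M) (orbit k m) (orbit (Γ := Γ) k a) :=
    LinearMap.ext fun x => IsEquivariant.smul_right x a m
  have e2 : orbit k (leftAct k A N a n) =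
      sweedler (leftAct k A N) (orbit k a) (orbit (Γ := Γ) k n) :=
    LinearMap.ext fun x => IsEquivariant.smul_left x a n
  refine (Submodule.Quotient.mk_eq_zero _).1 ?_
  change RelTensor.proj k A M N _ = 0
  rw [map_sub, map_sub, diagAct_tmul, diagAct_tmul, sweedler_comp, sweedler_comp, e1, e2,
    sweedler_assoc _ _ (leftAct k A N)
      ((TensorProduct.mk k M N).compr₂ (RelTensor.proj k A M N))
      (fun m a n => RelTensor.proj_balanced m a n), sub_self]

/-- The diagonal action `γ (m ⊗ n) = ∑ (γ₁ m) ⊗ (γ₂ n)` on `M ⊗_A N`. -/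
instance [IsEquivariant k Γ A M] [IsEquivariant k Γ A N] : Module Γ (RelTensor k A M N) :=
  Module.compHom (M ⊗[k] N ⧸ relSub k A M N)
    (quotAct k (relSub k A M N) (diagAct k M N) (diagAct_relSub k Γ A M N)).toRingHom

variable {M N} in
theorem RelTensor.diag_smul_proj [IsEquivariant k Γ A M] [IsEquivariant k Γ A N] (γ : Γ)
    (t : M ⊗[k] N) :
    γ • RelTensor.proj k A M N t = RelTensor.proj k A M N (diagAct k M N γ t) := rfl

end Equivariant

/-! ## Homomorphisms of bimodules into an algebra extension -/

section BimodHom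

variable {k R B : Type u} [Field k] [Ring R] [Algebra k R] [Ring B] [Algebra k B]

/-- For an algebra map `j : R → B`, the space `Hom_{R^e}(M, B)` of bimodule maps `M → B`. -/
def BimodHom (j : R →ₐ[k] B) (M : Type u) [AddCommGroup M] [Module k M] [Module (Env k R) M] :
    Submodule k (M →ₗ[k] B) where
  carrier := {f | ∀ (r s : R) (m : M), f ((r ⊗ₜ[k] op s) • m) = j r * f m * j s}
  add_mem' := fun hf hg r s m => by simp [hf r s m, hg r s m, mul_add, add_mul]
  zero_mem' := fun r s m => by simp
  smul_mem' := fun c f hf r s m => by simp [hf r s m]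

variable (j : R →ₐ[k] B) {M N M' N' P : Type u}
  [AddCommGroup M] [Module k M] [Module (Env k R) M] [IsScalarTower k (Env k R) M]
  [AddCommGroup N] [Module k N] [Module (Env k R) N] [IsScalarTower k (Env k R) N]
  [AddCommGroup M'] [Module k M'] [Module (Env k R) M'] [IsScalarTower k (Env k R) M']
  [AddCommGroup N'] [Module k N'] [Module (Env k R) N'] [IsScalarTower k (Env k R) N']
  [AddCommGroup P] [Module k P] [Module (Env k R) P] [IsScalarTower k (Env k R) P]

namespace BimodHom

variable {j}

theorem map_leftAct (f : BimodHom j M) (r : R) (m : M) :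
    f.1 (leftAct k R M r m) = j r * f.1 m := by
  have := f.2 r 1 m
  rw [map_one, mul_one] at this
  exact this

theorem map_rightAct (f : BimodHom j M) (r : R) (m : M) :
    f.1 (rightAct k R M m r) = f.1 m * j r := by
  have := f.2 1 r m
  rw [map_one, one_mul] at this
  exact this

/-- Precomposition with a bimodule map. -/
def precomp (h : M →ₗ[Env k R] N) : BimodHom j N →ₗ[k] BimodHom j M where
  toFun f := ⟨f.1 ∘ₗ h.restrictScalars k, fun r s m => by
    have := f.2 r s (h m)
    rw [← map_smul] at this
    exact this⟩
  map_add' _ _ := rfl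
  map_smul' _ _ := rfl

@[simp] theorem precomp_apply (h : M →ₗ[Env k R] N) (f : BimodHom j N) (m : M) :
    (precomp h f).1 m = f.1 (h m) := rfl

/-- The map `μ_B (f ⊗_R g) : M ⊗_R N → B`, `m ⊗ n ↦ f(m) g(n)`, without sign. -/
def pair : BimodHom j M →ₗ[k] BimodHom j N →ₗ[k] (RelTensor k R M N →ₗ[k] B) :=
  LinearMap.mk₂ k
    (fun f g => RelTensor.lift ((LinearMap.mul k B).compl₁₂ f.1 g.1) (fun m r n => by
      simp [map_leftAct, map_rightAct, mul_assoc]))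
    (fun f f' g => RelTensor.ext fun m n => by simp)
    (fun c f g => RelTensor.ext fun m n => by simp)
    (fun f g g' => RelTensor.ext fun m n => by simp [mul_add])
    (fun c f g => RelTensor.ext fun m n => by simp)

@[simp] theorem pair_proj (f : BimodHom j M) (g : BimodHom j N) (m : M) (n : N) :
    pair f g (RelTensor.proj k R M N (m ⊗ₜ n)) = f.1 m * g.1 n := rfl

theorem pair_smul (f : BimodHom j M) (g : BimodHom j N) (r s : R) (z : RelTensor k R M N) :
    pair f g ((r ⊗ₜ[k] op s) • z) = j r * pair f g z * j s := by
  obtain ⟨t, rfl⟩ := RelTensor.proj_surjective z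
  rw [RelTensor.env_smul_proj]
  induction t with
  | zero => simp
  | add x y hx hy => simp only [map_add, hx, hy, mul_add, add_mul]
  | tmul m n =>
    rw [outerAct_tmul, pair_proj, pair_proj, map_leftAct, map_rightAct]
    simp [mul_assoc]

theorem pair_map (f : BimodHom j M') (g : BimodHom j N') (a : M →ₗ[Env k R] M')
    (b : N →ₗ[Env k R] N') (z : RelTensor k R M N) :
    pair f g (RelTensor.map a b z) = pair (precomp a f) (precomp b g) z := by
  have : pair f g ∘ₗ RelTensor.map a b = pair (precomp a f) (precomp b g) :=
    RelTensor.ext fun m n => rfl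
  exact LinearMap.congr_fun this z

theorem precomp_id (f : BimodHom j M) : precomp LinearMap.id f = f := rfl

/-- The product `μ_B (f ⊗_R g) ω` along a bimodule map `ω : P → M ⊗_R N`, without sign. -/
def cup (ω : P →ₗ[Env k R] RelTensor k R M N) :
    BimodHom j M →ₗ[k] BimodHom j N →ₗ[k] BimodHom j P :=
  LinearMap.mk₂ k
    (fun f g => ⟨pair f g ∘ₗ ω.restrictScalars k, fun r s m => by
      have := pair_smul f g r s (ω m)
      rw [← map_smul] at this
      exact this⟩)
    (fun f f' g => Subtype.ext (LinearMap.ext fun x => by simp))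
    (fun c f g => Subtype.ext (LinearMap.ext fun x => by simp))
    (fun f g g' => Subtype.ext (LinearMap.ext fun x => by simp))
    (fun c f g => Subtype.ext (LinearMap.ext fun x => by simp))

@[simp] theorem cup_apply (ω : P →ₗ[Env k R] RelTensor k R M N) (f : BimodHom j M)
    (g : BimodHom j N) (x : P) : (cup ω f g).1 x = pair f g (ω x) := rfl

end BimodHom

end BimodHom

/-! ## Resolutions and diagonal maps -/

/-- A projective resolution `⋯ → X 1 → X 0 → T → 0` of the `S`-module given by the
representation `act` of `S` on the vector space `T`. -/
structure ProjRes (k S T : Type u) [Field k] [Ring S] [Algebra k S] [AddCommGroup T] [Module k T]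
    (act : S →ₐ[k] Module.End k T) where
  X : ℕ → Type u
  [acg : ∀ n, AddCommGroup (X n)]
  [modk : ∀ n, Module k (X n)]
  [modS : ∀ n, Module S (X n)]
  [tower : ∀ n, IsScalarTower k S (X n)]
  d : ∀ n, X (n + 1) →ₗ[S] X n
  ε : X 0 →ₗ[k] T
  ε_smul : ∀ (s : S) (x : X 0), ε (s • x) = act s (ε x)
  projective : ∀ n, Module.Projective S (X n)
  ε_surjective : Function.Surjective ε
  exact_zero : Function.Exact (d 0) ε
  exact_succ : ∀ n, Function.Exact (d (n + 1)) (d n)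

attribute [instance] ProjRes.acg ProjRes.modk ProjRes.modS ProjRes.tower

/-- A projective bimodule resolution `X → R`. -/
abbrev BimodRes (k R : Type u) [Field k] [Ring R] [Algebra k R] :=
  ProjRes k (Env k R) R (AlgHom.mulLeftRight k R)

section BimodRes

variable {k R B : Type u} [Field k] [Ring R] [Algebra k R] [Ring B] [Algebra k B]

/-- The composite of the augmentation `X 0 → R` with an algebra map `j : R → B`. -/
def BimodRes.aug (P : BimodRes k R) (j : R →ₐ[k] B) : BimodHom j (P.X 0) :=
  ⟨j.toLinearMap ∘ₗ P.ε, fun r s m => by simp [P.ε_smul]⟩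

/-- A diagonal map on a bimodule resolution `X → R`: a chain map `ω : X → X ⊗_R X` of complexes
of bimodules that is compatible with the augmentations. `ω n p q` is the component
`X n → X p ⊗_R X q`, which is zero unless `p + q = n`. -/
structure BimodDiagonal (P : BimodRes k R) where
  ω : ∀ n p q, P.X n →ₗ[Env k R] RelTensor k R (P.X p) (P.X q)
  shape : ∀ n p q, p + q ≠ n → ω n p q = 0
  comm : ∀ n p q (x : P.X (n + 1)),
    ω n p q (P.d n x) = RelTensor.map (P.d p) LinearMap.id (ω (n + 1) (p + 1) q x) +
      (-1 : k) ^ p • RelTensor.map LinearMap.id (P.d q) (ω (n + 1) p (q + 1) x)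
  aug : ∀ x : P.X 0,
    BimodHom.pair (P.aug (AlgHom.id k R)) (P.aug (AlgHom.id k R)) (ω 0 0 0 x) = P.ε x

end BimodRes

section Trivial

variable (k Γ : Type u) [Field k] [Ring Γ] [Bialgebra k Γ]

/-- The trivial right `Γ`-module `k`. -/
def trivialAct : Γᵐᵒᵖ →ₐ[k] Module.End k k :=
  AlgHom.ofLinearMap
    ((LinearMap.mul k k) ∘ₗ (counit (R := k) (A := Γ)) ∘ₗ (opLinearEquiv k).symm.toLinearMap)
    (by ext; simp) (fun a b => by ext; simp [mul_comm])

/-- A projective resolution of the trivial right `Γ`-module. -/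
abbrev TrivRes := ProjRes k Γᵐᵒᵖ k (trivialAct k Γ)

variable {Γ}

/-- The linear map `γ ↦ m · γ` for an element `m` of a right `Γ`-module. -/
def rightOrbit {M : Type u} [AddCommGroup M] [Module k M] [Module Γᵐᵒᵖ M]
    [IsScalarTower k Γᵐᵒᵖ M] (m : M) : Γ →ₗ[k] M :=
  orbit k m ∘ₗ (opLinearEquiv k).toLinearMap

/-- The diagonal action `(m ⊗ n) · γ = ∑ (m · γ₁) ⊗ (n · γ₂)` on a tensor product of right
`Γ`-modules. -/
def rightDiag (M N : Type u) [AddCommGroup M] [Module k M] [Module Γᵐᵒᵖ M]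
    [IsScalarTower k Γᵐᵒᵖ M] [AddCommGroup N] [Module k N] [Module Γᵐᵒᵖ N]
    [IsScalarTower k Γᵐᵒᵖ N] : Γ →ₗ[k] Module.End k (M ⊗[k] N) :=
  sweedler (TensorProduct.mapBilinear (RingHom.id k) M N M N)
    ((Algebra.lsmul k k M).toLinearMap ∘ₗ (opLinearEquiv k : Γ ≃ₗ[k] Γᵐᵒᵖ).toLinearMap)
    ((Algebra.lsmul k k N).toLinearMap ∘ₗ (opLinearEquiv k : Γ ≃ₗ[k] Γᵐᵒᵖ).toLinearMap)

theorem rightDiag_tmul {M N : Type u} [AddCommGroup M] [Module k M] [Module Γᵐᵒᵖ M]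
    [IsScalarTower k Γᵐᵒᵖ M] [AddCommGroup N] [Module k N] [Module Γᵐᵒᵖ N]
    [IsScalarTower k Γᵐᵒᵖ N] (γ : Γ) (m : M) (n : N) :
    rightDiag k M N γ (m ⊗ₜ n) =
      sweedler (TensorProduct.mk k M N) (rightOrbit k m) (rightOrbit k n) γ := by
  rw [rightDiag, sweedler_apply _ _ _ (ℛ k γ), sweedler_apply _ _ _ (ℛ k γ), LinearMap.sum_apply]
  rfl

variable {k}

/-- A diagonal map on a resolution `L → k`: a chain map `σ : L → L ⊗ L` of complexes of right
`Γ`-modules that is compatible with the augmentations. `σ n p q` is the component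
`L n → L p ⊗ L q`, which is zero unless `p + q = n`. -/
structure TrivDiagonal (L : TrivRes k Γ) where
  σ : ∀ n p q, L.X n →ₗ[k] L.X p ⊗[k] L.X q
  equivariant : ∀ n p q (γ : Γ) (l : L.X n),
    σ n p q (op γ • l) = rightDiag k (L.X p) (L.X q) γ (σ n p q l)
  shape : ∀ n p q, p + q ≠ n → σ n p q = 0
  comm : ∀ n p q (l : L.X (n + 1)),
    σ n p q (L.d n l) =
      ((L.d p).restrictScalars k).rTensor (L.X q) (σ (n + 1) (p + 1) q l) +
      (-1 : k) ^ p • ((L.d q).restrictScalars k).lTensor (L.X p) (σ (n + 1) p (q + 1) l)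
  aug : ∀ l : L.X 0, LinearMap.mul' k k (TensorProduct.map L.ε L.ε (σ 0 0 0 l)) = L.ε l

end Trivial

/-- A projective bimodule resolution of a module algebra `A` which is a complex of
`Γ`-equivariant bimodules, with `Γ`-linear augmentation, and which is in each degree free over
`A^e` on a subspace that is stable under `Γ`. -/
structure EquivRes (k Γ A : Type u) [Field k] [Ring Γ] [Bialgebra k Γ] [Ring A] [Algebra k A]
    [Module Γ A] [IsScalarTower k Γ A] extends BimodRes k A where
  [modΓ : ∀ n, Module Γ (X n)]
  [towerΓ : ∀ n, IsScalarTower k Γ (X n)]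
  [equivariant : ∀ n, IsEquivariant k Γ A (X n)]
  d_smul : ∀ n (γ : Γ) (x : X (n + 1)), d n (γ • x) = γ • d n x
  ε_smul' : ∀ (γ : Γ) (x : X 0), ε (γ • x) = γ • ε x
  free : ∀ n, ∃ V : Submodule k (X n), (∀ (γ : Γ), ∀ v ∈ V, γ • v ∈ V) ∧
    Function.Bijective (TensorProduct.lift
      ((Algebra.lsmul k k (X n)).toLinearMap.compl₂ V.subtype) : Env k A ⊗[k] V →ₗ[k] X n)

attribute [instance] EquivRes.modΓ EquivRes.towerΓ EquivRes.equivariant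

/-- A `Γ`-linear diagonal map on an equivariant bimodule resolution. -/
structure EquivDiagonal {k Γ A : Type u} [Field k] [Ring Γ] [Bialgebra k Γ] [Ring A]
    [Algebra k A] [Module Γ A] [IsScalarTower k Γ A] (K : EquivRes k Γ A) extends
    BimodDiagonal K.toProjRes where
  ω_smul : ∀ n p q (γ : Γ) (x : K.X n), ω n p q (γ • x) = γ • ω n p q x

/-! ## Differential graded algebras and their cohomology -/

/-- A not necessarily associative differential graded algebra over `k`, in nonnegative degrees,
with a distinguished cocycle `one` of degree zero. -/
structure DGAlg (k : Type u) [Field k] where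
  C : ℕ → Type u
  [acg : ∀ n, AddCommGroup (C n)]
  [mod : ∀ n, Module k (C n)]
  d : ∀ n, C n →ₗ[k] C (n + 1)
  mul : ∀ m n r, m + n = r → (C m →ₗ[k] C n →ₗ[k] C r)
  one : C 0
  d_d : ∀ n x, d (n + 1) (d n x) = 0
  d_one : d 0 one = 0
  leibniz : ∀ m n r (h : m + n = r) (x : C m) (y : C n),
    d r (mul m n r h x y) = mul (m + 1) n (r + 1) (by omega) (d m x) y +
      (-1 : k) ^ m • mul m (n + 1) (r + 1) (by omega) x (d n y)

namespace DGAlg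

attribute [instance] DGAlg.acg DGAlg.mod

variable {k : Type u} [Field k] (D : DGAlg k)

/-- Cocycles of degree `n`. -/
def cocycles (n : ℕ) : Submodule k (D.C n) := LinearMap.ker (D.d n)

/-- Coboundaries of degree `n`. -/
def coboundaries : ∀ n : ℕ, Submodule k (D.C n)
  | 0 => ⊥
  | n + 1 => LinearMap.range (D.d n)

/-- The cohomology in degree `n`. -/
abbrev H (n : ℕ) : Type u := D.cocycles n ⧸ (D.coboundaries n).submoduleOf (D.cocycles n)

/-- The product of two cocycles. -/
def cocycleMul (m n r : ℕ) (h : m + n = r) :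
    D.cocycles m →ₗ[k] D.cocycles n →ₗ[k] D.cocycles r :=
  LinearMap.mk₂ k
    (fun x y => ⟨D.mul m n r h x.1 y.1, by
      have hx : D.d m x.1 = 0 := x.2
      have hy : D.d n y.1 = 0 := y.2
      change D.d r _ = 0
      rw [D.leibniz, hx, hy]
      simp⟩)
    (fun x x' y => Subtype.ext (by simp))
    (fun c x y => Subtype.ext (by simp))
    (fun x y y' => Subtype.ext (by simp))
    (fun c x y => Subtype.ext (by simp))

theorem mul_coboundary_left (m n r : ℕ) (h : m + n = r) (x : D.C m) (y : D.C n)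
    (hx : x ∈ D.coboundaries m) (hy : D.d n y = 0) :
    D.mul m n r h x y ∈ D.coboundaries r := by
  cases m with
  | zero =>
    have : x = 0 := hx
    subst this
    simp
  | succ m =>
    obtain ⟨w, rfl⟩ := hx
    obtain ⟨r, rfl⟩ : ∃ s, r = s + 1 := ⟨m + n, by omega⟩
    refine ⟨D.mul m n r (by omega) w y, ?_⟩
    rw [D.leibniz, hy]
    simp

theorem mul_coboundary_right (m n r : ℕ) (h : m + n = r) (x : D.C m) (y : D.C n)
    (hx : D.d m x = 0) (hy : y ∈ D.coboundaries n) :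
    D.mul m n r h x y ∈ D.coboundaries r := by
  cases n with
  | zero =>
    have : y = 0 := hy
    subst this
    simp
  | succ n =>
    obtain ⟨w, rfl⟩ := hy
    obtain ⟨r, rfl⟩ : ∃ s, r = s + 1 := ⟨m + n, by omega⟩
    refine ⟨(-1 : k) ^ m • D.mul m n r (by omega) x w, ?_⟩
    rw [map_smul, D.leibniz, hx, map_zero, LinearMap.zero_apply, zero_add, smul_smul,
      ← mul_pow]
    simp

/-- The product induced on cohomology. -/
def HMul (m n r : ℕ) (h : m + n = r) : D.H m →ₗ[k] D.H n →ₗ[k] D.H r :=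
  Submodule.liftQ _
    { toFun := fun x => Submodule.mapQ _ _ (D.cocycleMul m n r h x)
        (fun y hy => D.mul_coboundary_right m n r h x.1 y.1 x.2 hy)
      map_add' := fun x x' => by ext y; simp; rfl
      map_smul' := fun c x => by ext y; simp; rfl }
    (fun x hx => by
      ext y
      exact (Submodule.Quotient.mk_eq_zero _).2
        (D.mul_coboundary_left m n r h x.1 y.1 hx y.2))

/-- The class of the distinguished cocycle. -/
def HOne : D.H 0 := Submodule.Quotient.mk ⟨D.one, D.d_one⟩

end DGAlg

/-! ## The two differential graded algebras -/

/-- The dg algebra `Hom_{R^e}(X, B)` of a bimodule resolution `X → R` with a diagonal map `ω`.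
With Koszul signs, `d f = -(-1)^|f| f d` and `(f g)(x) = ∑ (-1)^(|g| |x₁|) f(x₁) g(x₂)` where
`ω x = ∑ x₁ ⊗ x₂`. -/
def hochschild {k R B : Type u} [Field k] [Ring R] [Algebra k R] [Ring B] [Algebra k B]
    (j : R →ₐ[k] B) (P : BimodRes k R) (Δ : BimodDiagonal P) : DGAlg k where
  C n := BimodHom j (P.X n)
  d n := (-(-1 : k) ^ n) • BimodHom.precomp (P.d n)
  mul m n r _ := (-1 : k) ^ (m * n) • BimodHom.cup (Δ.ω r m n)
  one := P.aug j
  d_d n f := by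
    refine Subtype.ext (LinearMap.ext fun x => ?_)
    have h : P.d n (P.d (n + 1) x) = 0 := (P.exact_succ n).apply_apply_eq_zero x
    simp [h]
  d_one := by
    refine Subtype.ext (LinearMap.ext fun x => ?_)
    have h : P.ε (P.d 0 x) = 0 := P.exact_zero.apply_apply_eq_zero x
    simp [BimodRes.aug, h]
  leibniz m n r h f g := by
    subst h
    refine Subtype.ext (LinearMap.ext fun x => ?_)
    simp only [LinearMap.smul_apply, map_smul, Submodule.coe_smul, Submodule.coe_add,
      LinearMap.add_apply, BimodHom.precomp_apply, BimodHom.cup_apply, Δ.comm, map_add,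
      BimodHom.pair_map, BimodHom.precomp_id]
    match_scalars
    · simp only [pow_add, add_mul, one_mul]; ring
    · simp only [pow_add, mul_add, mul_one]
      ring

set_option linter.unusedSectionVars false

section Derived

variable {k Γ A B : Type u} [Field k] [Ring Γ] [HopfAlgebra k Γ] [Ring A] [Algebra k A]
  [Module Γ A] [IsScalarTower k Γ A] [IsModuleAlgebra k Γ A] [Ring B] [Algebra k B]

instance (M N : Type u) [AddCommGroup M] [Module k M] [Module (Env k A) M]
    [IsScalarTower k (Env k A) M] [Module Γ M] [IsScalarTower k Γ M] [IsEquivariant k Γ A M]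
    [AddCommGroup N] [Module k N] [Module (Env k A) N]
    [IsScalarTower k (Env k A) N] [Module Γ N] [IsScalarTower k Γ N] [IsEquivariant k Γ A N] :
    IsScalarTower k Γ (RelTensor k A M N) where
  smul_assoc c γ z := by
    obtain ⟨t, rfl⟩ := RelTensor.proj_surjective z
    rw [RelTensor.diag_smul_proj, RelTensor.diag_smul_proj, map_smul, LinearMap.smul_apply,
      map_smul]

variable (j : SmashProduct k Γ A →ₐ[k] B)

section Action

variable {M : Type u} [AddCommGroup M] [Module k M] [Module Γ M] [IsScalarTower k Γ M]

/-- The linear map `γ ↦ ∑ f(γ₁ x) γ₂`. -/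
def twist (f : M →ₗ[k] B) (x : M) : Γ →ₗ[k] B :=
  sweedler (LinearMap.mul k B) (f ∘ₗ orbit k x) (j.comp (SmashProduct.inr k)).toLinearMap

/-- The right action of `Γ` on linear maps into `B`, evaluated at `x`, as a linear map in `γ`:
`γ ↦ (f · γ)(x) = ∑ S(γ₁) f(γ₂ x) γ₃`. -/
def rightHomAct (f : M →ₗ[k] B) (x : M) : Γ →ₗ[k] B :=
  sweedler (LinearMap.mul k B)
    ((j.comp (SmashProduct.inr k)).toLinearMap ∘ₗ HopfAlgebra.antipode k) (twist j f x)

theorem rightHomAct_add (f g : M →ₗ[k] B) (x : M) :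
    rightHomAct j (f + g) x = rightHomAct j f x + rightHomAct j g x := by
  ext γ
  simp only [rightHomAct, twist, LinearMap.add_apply, sweedler_apply _ _ _ (ℛ k _),
    LinearMap.coe_comp, Function.comp_apply, map_add, Finset.sum_add_distrib]

theorem rightHomAct_smul (c : k) (f : M →ₗ[k] B) (x : M) :
    rightHomAct j (c • f) x = c • rightHomAct j f x := by
  ext γ
  simp only [rightHomAct, twist, LinearMap.smul_apply, sweedler_apply _ _ _ (ℛ k _),
    LinearMap.coe_comp, Function.comp_apply, map_smul, ← Finset.smul_sum]

theorem rightHomAct_add_right (f : M →ₗ[k] B) (x y : M) :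
    rightHomAct j f (x + y) = rightHomAct j f x + rightHomAct j f y := by
  ext γ
  simp only [rightHomAct, twist, LinearMap.add_apply, sweedler_apply _ _ _ (ℛ k _),
    LinearMap.coe_comp, Function.comp_apply, map_add, Finset.sum_add_distrib,
    orbit_apply, smul_add]

theorem rightHomAct_zero (x : M) : rightHomAct j (0 : M →ₗ[k] B) x = 0 := by
  have := rightHomAct_smul j 0 (0 : M →ₗ[k] B) x
  simpa using this

theorem rightHomAct_zero_right (f : M →ₗ[k] B) : rightHomAct j f (0 : M) = 0 := by
  have := rightHomAct_add_right j f 0 0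
  simpa using this

theorem rightHomAct_comp {N : Type u} [AddCommGroup N] [Module k N] [Module Γ N]
    [IsScalarTower k Γ N] (f : N →ₗ[k] B) (h : M →ₗ[k] N) (hh : ∀ (γ : Γ) x, h (γ • x) = γ • h x)
    (x : M) : rightHomAct j (f ∘ₗ h) x = rightHomAct j f (h x) := by
  have : (f ∘ₗ h) ∘ₗ orbit (Γ := Γ) k x = f ∘ₗ orbit k (h x) := by
    ext γ
    simp [hh]
  rw [rightHomAct, twist, this]
  rfl

theorem sweedler_rightHomAct (f : M →ₗ[k] B) (x : M) :
    sweedler (LinearMap.mul k B) (j.comp (SmashProduct.inr k)).toLinearMap (rightHomAct j f x) =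
      twist j f x := by
  ext γ
  rw [rightHomAct, ← sweedler_assoc (LinearMap.mul k B) (LinearMap.mul k B) (LinearMap.mul k B)
    (LinearMap.mul k B) (fun a b c => mul_assoc a b c),
    sweedler_counit_left _ _ _ (1 : B)]
  · simp
  · intro γ
    rw [sweedler_apply _ _ _ (ℛ k γ)]
    have h := congrArg (j.comp (SmashProduct.inr k))
      (HopfAlgebra.sum_mul_antipode_eq_smul (ℛ k γ))
    rw [map_sum, map_smul, map_one] at h
    rw [← h]
    exact Finset.sum_congr rfl fun i _ =>
      (map_mul (j.comp (SmashProduct.inr k)) _ _).symm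

end Action

section Maps

variable {M M₁ M₂ : Type u}
  [AddCommGroup M] [Module k M] [Module (Env k A) M] [IsScalarTower k (Env k A) M]
  [Module Γ M] [IsScalarTower k Γ M]
  [AddCommGroup M₁] [Module k M₁] [Module (Env k A) M₁] [IsScalarTower k (Env k A) M₁]
  [Module Γ M₁] [IsScalarTower k Γ M₁] [IsEquivariant k Γ A M₁]
  [AddCommGroup M₂] [Module k M₂] [Module (Env k A) M₂] [IsScalarTower k (Env k A) M₂]
  [Module Γ M₂] [IsScalarTower k Γ M₂] [IsEquivariant k Γ A M₂]
  {N N₁ N₂ : Type u}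
  [AddCommGroup N] [Module k N] [Module Γᵐᵒᵖ N] [IsScalarTower k Γᵐᵒᵖ N]
  [AddCommGroup N₁] [Module k N₁] [Module Γᵐᵒᵖ N₁] [IsScalarTower k Γᵐᵒᵖ N₁]
  [AddCommGroup N₂] [Module k N₂] [Module Γᵐᵒᵖ N₂] [IsScalarTower k Γᵐᵒᵖ N₂]

theorem rightHomAct_pair (f : BimodHom (j.comp (SmashProduct.inl k)) M₁)
    (g : BimodHom (j.comp (SmashProduct.inl k)) M₂) (x : M₁) (y : M₂) :
    rightHomAct j (BimodHom.pair f g) (RelTensor.proj k A M₁ M₂ (x ⊗ₜ y)) =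
      sweedler (LinearMap.mul k B) (rightHomAct j f.1 x) (rightHomAct j g.1 y) := by
  have e : (BimodHom.pair f g) ∘ₗ orbit (Γ := Γ) k (RelTensor.proj k A M₁ M₂ (x ⊗ₜ y)) =
      sweedler (LinearMap.mul k B) (f.1 ∘ₗ orbit k x) (g.1 ∘ₗ orbit k y) := by
    ext γ
    rw [LinearMap.comp_apply, orbit_apply, RelTensor.diag_smul_proj, diagAct_tmul,
      sweedler_apply _ _ _ (ℛ k γ), sweedler_apply _ _ _ (ℛ k γ), map_sum, map_sum]
    rfl
  have ma : ∀ a b c : B, LinearMap.mul k B (LinearMap.mul k B a b) c =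
    LinearMap.mul k B a (LinearMap.mul k B b c) := fun a b c => mul_assoc a b c
  rw [rightHomAct, twist, e, sweedler_assoc _ _ _ _ ma]
  change sweedler _ _ (sweedler _ _ (twist j g.1 y)) = _
  rw [← sweedler_rightHomAct j g.1 y, ← sweedler_assoc _ _ _ _ ma,
    ← sweedler_assoc _ _ _ _ ma,
    sweedler_assoc _ _ _ _ ma ((j.comp (SmashProduct.inr k)).toLinearMap ∘ₗ
      HopfAlgebra.antipode k) (f.1 ∘ₗ orbit k x)]
  rfl

/-- The subspace of right `Γ`-linear maps in `Hom_k(N, Hom_{A^e}(M, B))`. -/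
def DHomSub (N M : Type u)
    [AddCommGroup N] [Module k N] [Module Γᵐᵒᵖ N]
    [AddCommGroup M] [Module k M] [Module (Env k A) M] [Module Γ M] [IsScalarTower k Γ M] :
    Submodule k (N →ₗ[k] BimodHom (j.comp (SmashProduct.inl k)) M) where
  carrier := {F | ∀ (γ : Γ) (l : N) (x : M), (F (op γ • l)).1 x = rightHomAct j (F l).1 x γ}
  add_mem' := fun hF hG γ l x => by
    simp only [LinearMap.add_apply, Submodule.coe_add, hF γ l x, hG γ l x, rightHomAct_add]
  zero_mem' := fun γ l x => by simp [rightHomAct_zero]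
  smul_mem' := fun c F hF γ l x => by
    simp only [LinearMap.smul_apply, Submodule.coe_smul, hF γ l x, rightHomAct_smul]

/-- The space `Hom_Γ(N, Hom_{A^e}(M, B))` of right `Γ`-linear maps. -/
def DHom (N M : Type u)
    [AddCommGroup N] [Module k N] [Module Γᵐᵒᵖ N]
    [AddCommGroup M] [Module k M] [Module (Env k A) M] [Module Γ M] [IsScalarTower k Γ M] :
    Type u := DHomSub j N M

namespace DHom

instance : AddCommGroup (DHom j N M) :=
  Module.addCommMonoidToAddCommGroup (M := DHomSub j N M) k

instance : Module k (DHom j N M) := inferInstanceAs (Module k (DHomSub j N M))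

variable {j}

theorem ext {F G : DHom j N M} (h : ∀ l x, (F.1 l).1 x = (G.1 l).1 x) : F = G :=
  Subtype.ext (LinearMap.ext fun l => Subtype.ext (LinearMap.ext fun x => h l x))

theorem val_add (F G : DHom j N M) : (F + G).1 = F.1 + G.1 := rfl

theorem val_smul (c : k) (F : DHom j N M) : (c • F).1 = c • F.1 := rfl

theorem val_zero : (0 : DHom j N M).1 = 0 := rfl

/-- Precomposition in the first variable. -/
def precompL (h : N₁ →ₗ[Γᵐᵒᵖ] N) : DHom j N M →ₗ[k] DHom j N₁ M where
  toFun F := ⟨F.1 ∘ₗ h.restrictScalars k, fun γ l x => by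
    have := F.2 γ (h l) x
    rw [← map_smul] at this
    exact this⟩
  map_add' _ _ := rfl
  map_smul' _ _ := rfl

/-- Precomposition in the second variable. -/
def precompK (h : M₁ →ₗ[Env k A] M) (hh : ∀ (γ : Γ) x, h (γ • x) = γ • h x) :
    DHom j N M →ₗ[k] DHom j N M₁ where
  toFun F := ⟨BimodHom.precomp h ∘ₗ F.1, fun γ l x => by
    have e := rightHomAct_comp j (F.1 l).1 (h.restrictScalars k) hh x
    exact (F.2 γ l (h x)).trans (LinearMap.congr_fun e γ).symm⟩
  map_add' F G := ext fun l x => rfl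
  map_smul' c F := ext fun l x => rfl

@[simp] theorem precompL_apply (h : N₁ →ₗ[Γᵐᵒᵖ] N) (F : DHom j N M) (l : N₁) (x : M) :
    ((precompL h F).1 l).1 x = (F.1 (h l)).1 x := rfl

@[simp] theorem precompK_apply (h : M₁ →ₗ[Env k A] M) (hh : ∀ (γ : Γ) x, h (γ • x) = γ • h x)
    (F : DHom j N M) (l : N) (x : M₁) :
    ((precompK h hh F).1 l).1 x = (F.1 l).1 (h x) := rfl

/-- The linear map `l ⊗ l' ↦ F(l) G(l')`, the product being taken along `ω`, without sign. -/
def pair (ω : M →ₗ[Env k A] RelTensor k A M₁ M₂) (F : DHom j N₁ M₁) (G : DHom j N₂ M₂) :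
    N₁ ⊗[k] N₂ →ₗ[k] BimodHom (j.comp (SmashProduct.inl k)) M :=
  TensorProduct.lift ((BimodHom.cup ω).compl₁₂ F.1 G.1)

theorem pair_rightDiag (ω : M →ₗ[Env k A] RelTensor k A M₁ M₂)
    (hω : ∀ (γ : Γ) x, ω (γ • x) = γ • ω x) (F : DHom j N₁ M₁) (G : DHom j N₂ M₂)
    (t : N₁ ⊗[k] N₂) (γ : Γ) (x : M) :
    (pair ω F G (rightDiag k N₁ N₂ γ t)).1 x = rightHomAct j (pair ω F G t).1 x γ := by
  induction t with
  | zero => simp [rightHomAct_zero]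
  | add t t' ht ht' =>
    simp only [map_add, Submodule.coe_add, LinearMap.add_apply, ht, ht', rightHomAct_add]
  | tmul l l' =>
    have e : rightHomAct j (pair ω F G (l ⊗ₜ l')).1 x =
        rightHomAct j (BimodHom.pair (F.1 l) (G.1 l')) (ω x) :=
      rightHomAct_comp j (BimodHom.pair (F.1 l) (G.1 l')) (ω.restrictScalars k) hω x
    have e' : (pair ω F G (rightDiag k N₁ N₂ γ (l ⊗ₜ l'))).1 x =
        ∑ i ∈ (ℛ k γ).index, BimodHom.pair (F.1 (op ((ℛ k γ).left i) • l))
          (G.1 (op ((ℛ k γ).right i) • l')) (ω x) := by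
      rw [rightDiag_tmul, sweedler_apply _ _ _ (ℛ k γ), map_sum, Submodule.coe_sum,
        LinearMap.sum_apply]
      rfl
    rw [e, e']
    generalize ω x = z
    obtain ⟨s, rfl⟩ := RelTensor.proj_surjective z
    induction s with
    | zero => simp [rightHomAct_zero_right]
    | add s s' hs hs' =>
      simp only [map_add, Finset.sum_add_distrib, hs, hs', rightHomAct_add_right,
        LinearMap.add_apply]
    | tmul x y =>
      rw [rightHomAct_pair, sweedler_apply _ _ _ (ℛ k γ)]
      refine Finset.sum_congr rfl fun i _ => ?_
      rw [BimodHom.pair_proj, F.2, G.2]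
      rfl

/-- The product `μ (F ⊗ G) σ` of `Hom_Γ(-, Hom_{A^e}(-, B))` along maps `σ` and `ω`,
without sign. -/
def cup (σ : N →ₗ[k] N₁ ⊗[k] N₂) (hσ : ∀ (γ : Γ) l, σ (op γ • l) = rightDiag k N₁ N₂ γ (σ l))
    (ω : M →ₗ[Env k A] RelTensor k A M₁ M₂) (hω : ∀ (γ : Γ) x, ω (γ • x) = γ • ω x) :
    DHom j N₁ M₁ →ₗ[k] DHom j N₂ M₂ →ₗ[k] DHom j N M :=
  LinearMap.mk₂ k
    (fun F G => ⟨pair ω F G ∘ₗ σ, fun γ l x => by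
      rw [LinearMap.comp_apply, hσ, pair_rightDiag ω hω]
      rfl⟩)
    (fun F F' G => by
      have : pair ω (F + F') G = pair ω F G + pair ω F' G :=
        TensorProduct.ext' fun l l' => by simp [pair, val_add]
      exact Subtype.ext ((congrArg (· ∘ₗ σ) this).trans (LinearMap.add_comp _ _ _)))
    (fun c F G => by
      have : pair ω (c • F) G = c • pair ω F G :=
        TensorProduct.ext' fun l l' => by simp [pair, val_smul]
      exact Subtype.ext ((congrArg (· ∘ₗ σ) this).trans (LinearMap.smul_comp _ _ _)))
    (fun F G G' => by
      have : pair ω F (G + G') = pair ω F G + pair ω F G' :=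
        TensorProduct.ext' fun l l' => by simp [pair, val_add]
      exact Subtype.ext ((congrArg (· ∘ₗ σ) this).trans (LinearMap.add_comp _ _ _)))
    (fun c F G => by
      have : pair ω F (c • G) = c • pair ω F G :=
        TensorProduct.ext' fun l l' => by simp [pair, val_smul]
      exact Subtype.ext ((congrArg (· ∘ₗ σ) this).trans (LinearMap.smul_comp _ _ _)))

theorem cup_apply (σ : N →ₗ[k] N₁ ⊗[k] N₂)
    (hσ : ∀ (γ : Γ) l, σ (op γ • l) = rightDiag k N₁ N₂ γ (σ l))
    (ω : M →ₗ[Env k A] RelTensor k A M₁ M₂) (hω : ∀ (γ : Γ) x, ω (γ • x) = γ • ω x)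
    (F : DHom j N₁ M₁) (G : DHom j N₂ M₂) (l : N) :
    (cup σ hσ ω hω F G).1 l = pair ω F G (σ l) := rfl

end DHom

end Maps

variable (K : EquivRes k Γ A) (L : TrivRes k Γ)

/-- The double complex with entries `Hom_Γ(L p, Hom_{A^e}(K q, B))`. -/
def Double : Type u := ∀ p q : ℕ, DHom j (L.X p) (K.X q)

namespace Double

instance : AddCommGroup (Double j K L) :=
  inferInstanceAs (AddCommGroup (∀ p q : ℕ, DHom j (L.X p) (K.X q)))

instance : Module k (Double j K L) :=
  inferInstanceAs (Module k (∀ p q : ℕ, DHom j (L.X p) (K.X q)))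

/-- The families that are concentrated in total degree `n`. -/
def homog (n : ℕ) : Submodule k (Double j K L) where
  carrier := {F | ∀ p q, p + q ≠ n → F p q = 0}
  add_mem' := fun {F G} hF hG p q h => by
    change F p q + G p q = 0
    rw [hF p q h, hG p q h, add_zero]
  zero_mem' := fun p q _ => rfl
  smul_mem' := fun c F hF p q h => by
    change c • F p q = 0
    rw [hF p q h, smul_zero]

/-- The map `F ↦ d ∘ F` on entries, where `d f = -(-1)^|f| f d_K` is the differential of the
complex `Hom_{A^e}(K, B)`. -/
def eK (p q : ℕ) : DHom j (L.X p) (K.X q) →ₗ[k] DHom j (L.X p) (K.X (q + 1)) :=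
  (-(-1 : k) ^ q) • DHom.precompK (K.d q) (K.d_smul q)

/-- The map `F ↦ -(-1)^|F| F d_L` on entries. -/
def eL (p q : ℕ) : DHom j (L.X p) (K.X q) →ₗ[k] DHom j (L.X (p + 1)) (K.X q) :=
  (-(-1 : k) ^ (p + q)) • DHom.precompL (L.d p)

theorem eK_eK (p q : ℕ) (F : DHom j (L.X p) (K.X q)) :
    eK j K L p (q + 1) (eK j K L p q F) = 0 := by
  have h : ∀ x, K.d q (K.d (q + 1) x) = 0 := fun x => (K.exact_succ q).apply_apply_eq_zero x
  refine DHom.ext fun l x => ?_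
  simp [eK, h, DHom.val_smul, DHom.val_zero]

theorem eL_eL (p q : ℕ) (F : DHom j (L.X p) (K.X q)) :
    eL j K L (p + 1) q (eL j K L p q F) = 0 := by
  have h : ∀ l, L.d p (L.d (p + 1) l) = 0 := fun l => (L.exact_succ p).apply_apply_eq_zero l
  refine DHom.ext fun l x => ?_
  simp [eL, h, DHom.val_smul, DHom.val_zero]

theorem eK_eL (p q : ℕ) (F : DHom j (L.X p) (K.X q)) :
    eK j K L (p + 1) q (eL j K L p q F) + eL j K L p (q + 1) (eK j K L p q F) = 0 := by
  refine DHom.ext fun l x => ?_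
  simp only [eK, eL, map_smul, DHom.val_add, DHom.val_smul, DHom.val_zero, Submodule.coe_add, Submodule.coe_smul,
    LinearMap.add_apply, LinearMap.smul_apply, DHom.precompK_apply, DHom.precompL_apply,
    Submodule.coe_zero, LinearMap.zero_apply]
  match_scalars
  ring

/-- The part of the differential that comes from `K`. -/
def dK : Double j K L →ₗ[k] Double j K L where
  toFun F := fun p q => match q with
    | 0 => 0
    | q + 1 => eK j K L p q (F p q)
  map_add' F G := by
    funext p q
    cases q with
    | zero => exact (add_zero _).symm
    | succ q => exact map_add (eK j K L p q) (F p q) (G p q)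
  map_smul' c F := by
    funext p q
    cases q with
    | zero => exact (smul_zero c).symm
    | succ q => exact map_smul (eK j K L p q) c (F p q)

/-- The part of the differential that comes from `L`. -/
def dL : Double j K L →ₗ[k] Double j K L where
  toFun F := fun p q => match p with
    | 0 => 0
    | p + 1 => eL j K L p q (F p q)
  map_add' F G := by
    funext p q
    cases p with
    | zero => exact (add_zero _).symm
    | succ p => exact map_add (eL j K L p q) (F p q) (G p q)
  map_smul' c F := by
    funext p q
    cases p with
    | zero => exact (smul_zero c).symm
    | succ p => exact map_smul (eL j K L p q) c (F p q)

theorem dK_zero (F : Double j K L) (p : ℕ) : dK j K L F p 0 = 0 := rfl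

theorem dK_succ (F : Double j K L) (p q : ℕ) :
    dK j K L F p (q + 1) = eK j K L p q (F p q) := rfl

theorem dL_zero (F : Double j K L) (q : ℕ) : dL j K L F 0 q = 0 := rfl

theorem dL_succ (F : Double j K L) (p q : ℕ) :
    dL j K L F (p + 1) q = eL j K L p q (F p q) := rfl

theorem dK_homog {n : ℕ} {F : Double j K L} (hF : F ∈ homog j K L n) :
    dK j K L F ∈ homog j K L (n + 1) := by
  intro p q h
  cases q with
  | zero => rfl
  | succ q => rw [dK_succ, hF p q (by omega), map_zero]

theorem dL_homog {n : ℕ} {F : Double j K L} (hF : F ∈ homog j K L n) :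
    dL j K L F ∈ homog j K L (n + 1) := by
  intro p q h
  cases p with
  | zero => rfl
  | succ p => rw [dL_succ, hF p q (by omega), map_zero]

/-- The total differential. -/
def dTot : Double j K L →ₗ[k] Double j K L := dK j K L + dL j K L

theorem dTot_dTot (F : Double j K L) : dTot j K L (dTot j K L F) = 0 := by
  have h1 : dK j K L (dK j K L F) = 0 := by
    funext p q
    rcases q with _ | _ | q
    · rfl
    · exact map_zero (eK j K L p 0)
    · exact eK_eK j K L p q (F p q)
  have h2 : dL j K L (dL j K L F) = 0 := by
    funext p q
    rcases p with _ | _ | p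
    · rfl
    · exact map_zero (eL j K L 0 q)
    · exact eL_eL j K L p q (F p q)
  have h3 : dK j K L (dL j K L F) + dL j K L (dK j K L F) = 0 := by
    funext p q
    rcases p with _ | p <;> rcases q with _ | q
    · exact add_zero _
    · exact (add_zero _).trans (map_zero (eK j K L 0 q))
    · exact (zero_add _).trans (map_zero (eL j K L p 0))
    · exact eK_eL j K L p q (F p q)
  change dK j K L (dK j K L F + dL j K L F) + dL j K L (dK j K L F + dL j K L F) = 0
  rw [map_add, map_add, h1, h2, zero_add, add_zero, h3]

variable {K L} (ω : EquivDiagonal K) (σ : TrivDiagonal L)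

/-- The component of the product `μ (F ⊗ G) σ` on `F ∈ Hom_Γ(L p₁, Hom_{A^e}(K q₁, B))` and
`G ∈ Hom_Γ(L p₂, Hom_{A^e}(K q₂, B))`, with values in `Hom_Γ(L p, Hom_{A^e}(K q, B))`. The sign
is the product of the Koszul signs `(-1)^(|G| |l₁|)` and `(-1)^(|G(l₂)| |x₁|)`. -/
def term (p q p₁ p₂ q₁ q₂ : ℕ) (F : DHom j (L.X p₁) (K.X q₁)) (G : DHom j (L.X p₂) (K.X q₂)) :
    DHom j (L.X p) (K.X q) :=
  (-1 : k) ^ ((p₂ + q₂) * p₁ + q₂ * q₁) •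
    DHom.cup (σ.σ p p₁ p₂) (σ.equivariant p p₁ p₂) (ω.ω q q₁ q₂) (ω.ω_smul q q₁ q₂) F G

theorem term_add_left (p q p₁ p₂ q₁ q₂ : ℕ) (F F' : DHom j (L.X p₁) (K.X q₁))
    (G : DHom j (L.X p₂) (K.X q₂)) : term j ω σ p q p₁ p₂ q₁ q₂ (F + F') G =
      term j ω σ p q p₁ p₂ q₁ q₂ F G + term j ω σ p q p₁ p₂ q₁ q₂ F' G := by
  rw [term, LinearMap.map_add₂, smul_add]
  rfl

theorem term_add_right (p q p₁ p₂ q₁ q₂ : ℕ) (F : DHom j (L.X p₁) (K.X q₁))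
    (G G' : DHom j (L.X p₂) (K.X q₂)) : term j ω σ p q p₁ p₂ q₁ q₂ F (G + G') =
      term j ω σ p q p₁ p₂ q₁ q₂ F G + term j ω σ p q p₁ p₂ q₁ q₂ F G' := by
  rw [term, map_add, smul_add]
  rfl

theorem term_smul_left (p q p₁ p₂ q₁ q₂ : ℕ) (c : k) (F : DHom j (L.X p₁) (K.X q₁))
    (G : DHom j (L.X p₂) (K.X q₂)) : term j ω σ p q p₁ p₂ q₁ q₂ (c • F) G =
      c • term j ω σ p q p₁ p₂ q₁ q₂ F G := by
  rw [term, LinearMap.map_smul₂, smul_comm]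
  rfl

theorem term_smul_right (p q p₁ p₂ q₁ q₂ : ℕ) (c : k) (F : DHom j (L.X p₁) (K.X q₁))
    (G : DHom j (L.X p₂) (K.X q₂)) : term j ω σ p q p₁ p₂ q₁ q₂ F (c • G) =
      c • term j ω σ p q p₁ p₂ q₁ q₂ F G := by
  rw [term, map_smul, smul_comm]
  rfl

theorem term_zero_left (p q p₁ p₂ q₁ q₂ : ℕ) (G : DHom j (L.X p₂) (K.X q₂)) :
    term j ω σ p q p₁ p₂ q₁ q₂ 0 G = 0 := by
  rw [← zero_smul k (0 : DHom j (L.X p₁) (K.X q₁)), term_smul_left, zero_smul]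

theorem term_zero_right (p q p₁ p₂ q₁ q₂ : ℕ) (F : DHom j (L.X p₁) (K.X q₁)) :
    term j ω σ p q p₁ p₂ q₁ q₂ F 0 = 0 := by
  rw [← zero_smul k (0 : DHom j (L.X p₂) (K.X q₂)), term_smul_right, zero_smul]

/-- The component of degree `(p, q)` of the product of two families. -/
def mulEntry (F G : Double j K L) (p q : ℕ) : DHom j (L.X p) (K.X q) :=
  ∑ a ∈ Finset.HasAntidiagonal.antidiagonal p, ∑ b ∈ Finset.HasAntidiagonal.antidiagonal q,
    term j ω σ p q a.1 a.2 b.1 b.2 (F a.1 b.1) (G a.2 b.2)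

/-- The product of the double complex. -/
def mul : Double j K L →ₗ[k] Double j K L →ₗ[k] Double j K L :=
  LinearMap.mk₂ k (mulEntry j ω σ)
    (fun F F' G => by
      funext p q
      change mulEntry j ω σ (F + F') G p q = mulEntry j ω σ F G p q + mulEntry j ω σ F' G p q
      simp only [mulEntry, ← Finset.sum_add_distrib]
      exact Finset.sum_congr rfl fun a _ => Finset.sum_congr rfl fun b _ =>
        term_add_left j ω σ _ _ _ _ _ _ _ _ _)
    (fun c F G => by
      funext p q
      change mulEntry j ω σ (c • F) G p q = c • mulEntry j ω σ F G p q
      simp only [mulEntry, Finset.smul_sum]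
      exact Finset.sum_congr rfl fun a _ => Finset.sum_congr rfl fun b _ =>
        term_smul_left j ω σ _ _ _ _ _ _ _ _ _)
    (fun F G G' => by
      funext p q
      change mulEntry j ω σ F (G + G') p q = mulEntry j ω σ F G p q + mulEntry j ω σ F G' p q
      simp only [mulEntry, ← Finset.sum_add_distrib]
      exact Finset.sum_congr rfl fun a _ => Finset.sum_congr rfl fun b _ =>
        term_add_right j ω σ _ _ _ _ _ _ _ _ _)
    (fun c F G => by
      funext p q
      change mulEntry j ω σ F (c • G) p q = c • mulEntry j ω σ F G p q
      simp only [mulEntry, Finset.smul_sum]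
      exact Finset.sum_congr rfl fun a _ => Finset.sum_congr rfl fun b _ =>
        term_smul_right j ω σ _ _ _ _ _ _ _ _ _)

theorem mul_apply (F G : Double j K L) (p q : ℕ) :
    mul j ω σ F G p q = ∑ a ∈ Finset.HasAntidiagonal.antidiagonal p,
      ∑ b ∈ Finset.HasAntidiagonal.antidiagonal q,
        term j ω σ p q a.1 a.2 b.1 b.2 (F a.1 b.1) (G a.2 b.2) := rfl

theorem mul_homog {m n : ℕ} {F G : Double j K L} (hF : F ∈ homog j K L m)
    (hG : G ∈ homog j K L n) : mul j ω σ F G ∈ homog j K L (m + n) := by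
  intro p q h
  rw [mul_apply]
  refine Finset.sum_eq_zero fun a ha => Finset.sum_eq_zero fun b hb => ?_
  rw [Finset.HasAntidiagonal.mem_antidiagonal] at ha hb
  by_cases h1 : a.1 + b.1 = m
  · rw [hG a.2 b.2 (by omega), term_zero_right]
  · rw [hF a.1 b.1 h1, term_zero_left]

theorem term_eK {m p q p₁ p₂ q₁ q₂ : ℕ} (hm : p₁ + q₁ = m) (hq : q₁ + q₂ = q)
    (F : DHom j (L.X p₁) (K.X q₁)) (G : DHom j (L.X p₂) (K.X q₂)) :
    eK j K L p q (term j ω σ p q p₁ p₂ q₁ q₂ F G) =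
      term j ω σ p (q + 1) p₁ p₂ (q₁ + 1) q₂ (eK j K L p₁ q₁ F) G +
      (-1 : k) ^ m • term j ω σ p (q + 1) p₁ p₂ q₁ (q₂ + 1) F (eK j K L p₂ q₂ G) := by
  subst hm hq
  have key : ∀ t : L.X p₁ ⊗[k] L.X p₂, ∀ x,
      (DHom.pair (ω.ω (q₁ + q₂) q₁ q₂) F G t).1 (K.d (q₁ + q₂) x) =
      (DHom.pair (ω.ω (q₁ + q₂ + 1) (q₁ + 1) q₂)
        (DHom.precompK (K.d q₁) (K.d_smul q₁) F) G t).1 x +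
      (-1 : k) ^ q₁ • (DHom.pair (ω.ω (q₁ + q₂ + 1) q₁ (q₂ + 1)) F
        (DHom.precompK (K.d q₂) (K.d_smul q₂) G) t).1 x := by
    intro t x
    induction t with
    | zero => simp
    | add t t' ht ht' =>
      simp only [map_add, Submodule.coe_add, LinearMap.add_apply, ht, ht', smul_add]
      abel
    | tmul l l' =>
      have h := congrArg (BimodHom.pair (F.1 l) (G.1 l')) (ω.comm (q₁ + q₂) q₁ q₂ x)
      rw [map_add, map_smul, BimodHom.pair_map, BimodHom.pair_map] at h
      exact h
  refine DHom.ext fun l x => ?_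
  simp only [eK, term, LinearMap.smul_apply, map_smul, DHom.val_add, DHom.val_smul, Submodule.coe_smul, Submodule.coe_add,
    LinearMap.add_apply, DHom.precompK_apply, DHom.cup_apply, key]
  have e : (-1 : k) ^ (p₁ * 2) = 1 := by rw [mul_comm, pow_mul]; simp
  match_scalars
  · ring
  · ring_nf
    simp only [e, mul_one]

theorem term_eL {m p q p₁ p₂ q₁ q₂ : ℕ} (hm : p₁ + q₁ = m) (hp : p₁ + p₂ = p)
    (hq : q₁ + q₂ = q)
    (F : DHom j (L.X p₁) (K.X q₁)) (G : DHom j (L.X p₂) (K.X q₂)) :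
    eL j K L p q (term j ω σ p q p₁ p₂ q₁ q₂ F G) =
      term j ω σ (p + 1) q (p₁ + 1) p₂ q₁ q₂ (eL j K L p₁ q₁ F) G +
      (-1 : k) ^ m • term j ω σ (p + 1) q p₁ (p₂ + 1) q₁ q₂ F (eL j K L p₂ q₂ G) := by
  subst hm hp hq
  have e1 : ∀ t : L.X (p₁ + 1) ⊗[k] L.X p₂,
      DHom.pair (ω.ω (q₁ + q₂) q₁ q₂) F G
        (((L.d p₁).restrictScalars k).rTensor (L.X p₂) t) =
      DHom.pair (ω.ω (q₁ + q₂) q₁ q₂) (DHom.precompL (L.d p₁) F) G t := by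
    intro t
    induction t with
    | zero => simp
    | add t t' ht ht' => simp only [map_add, ht, ht']
    | tmul l l' => rfl
  have e2 : ∀ t : L.X p₁ ⊗[k] L.X (p₂ + 1),
      DHom.pair (ω.ω (q₁ + q₂) q₁ q₂) F G
        (((L.d p₂).restrictScalars k).lTensor (L.X p₁) t) =
      DHom.pair (ω.ω (q₁ + q₂) q₁ q₂) F (DHom.precompL (L.d p₂) G) t := by
    intro t
    induction t with
    | zero => simp
    | add t t' ht ht' => simp only [map_add, ht, ht']
    | tmul l l' => rfl
  refine DHom.ext fun l x => ?_
  simp only [eL, term, LinearMap.smul_apply, map_smul, DHom.val_add, DHom.val_smul, Submodule.coe_smul, Submodule.coe_add,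
    LinearMap.add_apply, DHom.precompL_apply, DHom.cup_apply, σ.comm, map_add, e1, e2]
  match_scalars <;> ring

theorem term_eK_zero (c : k) (p q p₁ p₂ q₁ q₂ : ℕ) (G : DHom j (L.X p₂) (K.X q₂)) :
    eK j K L p q (term j ω σ p q p₁ p₂ q₁ q₂ 0 G) =
      term j ω σ p (q + 1) p₁ p₂ (q₁ + 1) q₂ (eK j K L p₁ q₁ 0) G +
      c • term j ω σ p (q + 1) p₁ p₂ q₁ (q₂ + 1) 0 (eK j K L p₂ q₂ G) := by
  rw [term_zero_left, term_zero_left, LinearMap.map_zero (eK j K L p q),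
    LinearMap.map_zero (eK j K L p₁ q₁), term_zero_left, smul_zero, add_zero]

theorem term_eL_zero (c : k) (p q p₁ p₂ q₁ q₂ : ℕ) (G : DHom j (L.X p₂) (K.X q₂)) :
    eL j K L p q (term j ω σ p q p₁ p₂ q₁ q₂ 0 G) =
      term j ω σ (p + 1) q (p₁ + 1) p₂ q₁ q₂ (eL j K L p₁ q₁ 0) G +
      c • term j ω σ (p + 1) q p₁ (p₂ + 1) q₁ q₂ 0 (eL j K L p₂ q₂ G) := by
  rw [term_zero_left, term_zero_left, LinearMap.map_zero (eL j K L p q),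
    LinearMap.map_zero (eL j K L p₁ q₁), term_zero_left, smul_zero, add_zero]

theorem leibniz_dK {m : ℕ} {F : Double j K L} (hF : F ∈ homog j K L m) (G : Double j K L) :
    dK j K L (mul j ω σ F G) =
      mul j ω σ (dK j K L F) G + (-1 : k) ^ m • mul j ω σ F (dK j K L G) := by
  funext p q
  cases q with
  | zero =>
    change 0 = mul j ω σ (dK j K L F) G p 0 + (-1 : k) ^ m • mul j ω σ F (dK j K L G) p 0
    have h1 : mul j ω σ (dK j K L F) G p 0 = 0 := by
      rw [mul_apply]
      refine Finset.sum_eq_zero fun a ha => Finset.sum_eq_zero fun b hb => ?_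
      rw [Finset.HasAntidiagonal.mem_antidiagonal] at ha hb
      obtain ⟨a1, a2⟩ := a
      obtain ⟨b1, b2⟩ := b
      obtain ⟨rfl, rfl⟩ : b1 = 0 ∧ b2 = 0 := by simpa using hb
      rw [dK_zero, term_zero_left]
    have h2 : mul j ω σ F (dK j K L G) p 0 = 0 := by
      rw [mul_apply]
      refine Finset.sum_eq_zero fun a ha => Finset.sum_eq_zero fun b hb => ?_
      rw [Finset.HasAntidiagonal.mem_antidiagonal] at ha hb
      obtain ⟨a1, a2⟩ := a
      obtain ⟨b1, b2⟩ := b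
      obtain ⟨rfl, rfl⟩ : b1 = 0 ∧ b2 = 0 := by simpa using hb
      rw [dK_zero, term_zero_right]
    rw [h1, h2, smul_zero, add_zero]
  | succ q =>
    have h0 : dK j K L (mul j ω σ F G) p (q + 1) =
        ∑ a ∈ Finset.HasAntidiagonal.antidiagonal p, ∑ b ∈ Finset.HasAntidiagonal.antidiagonal q,
          eK j K L p q (term j ω σ p q a.1 a.2 b.1 b.2 (F a.1 b.1) (G a.2 b.2)) := by
      rw [dK_succ]
      change eK j K L p q (mulEntry j ω σ F G p q) = _
      rw [mulEntry]
      refine (map_sum (eK j K L p q) _ _).trans ?_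
      exact Finset.sum_congr rfl fun a _ => map_sum (eK j K L p q) _ _
    have h1 : mul j ω σ (dK j K L F) G p (q + 1) =
        ∑ a ∈ Finset.HasAntidiagonal.antidiagonal p, ∑ b ∈ Finset.HasAntidiagonal.antidiagonal q,
          term j ω σ p (q + 1) a.1 a.2 (b.1 + 1) b.2 (eK j K L a.1 b.1 (F a.1 b.1))
            (G a.2 b.2) := by
      rw [mul_apply]
      refine Finset.sum_congr rfl fun a _ => ?_
      rw [Finset.Nat.sum_antidiagonal_succ, dK_zero, term_zero_left, zero_add]
      rfl
    have h2 : mul j ω σ F (dK j K L G) p (q + 1) =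
        ∑ a ∈ Finset.HasAntidiagonal.antidiagonal p, ∑ b ∈ Finset.HasAntidiagonal.antidiagonal q,
          term j ω σ p (q + 1) a.1 a.2 b.1 (b.2 + 1) (F a.1 b.1)
            (eK j K L a.2 b.2 (G a.2 b.2)) := by
      rw [mul_apply]
      refine Finset.sum_congr rfl fun a _ => ?_
      rw [Finset.Nat.sum_antidiagonal_succ', dK_zero, term_zero_right, zero_add]
      rfl
    change _ = mul j ω σ (dK j K L F) G p (q + 1) +
      (-1 : k) ^ m • mul j ω σ F (dK j K L G) p (q + 1)
    rw [h0, h1, h2, Finset.smul_sum, ← Finset.sum_add_distrib]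
    refine Finset.sum_congr rfl fun a _ => ?_
    rw [Finset.smul_sum, ← Finset.sum_add_distrib]
    refine Finset.sum_congr rfl fun b hb => ?_
    by_cases h : a.1 + b.1 = m
    · exact term_eK j ω σ h (Finset.HasAntidiagonal.mem_antidiagonal.1 hb) _ _
    · rw [hF a.1 b.1 h]
      exact term_eK_zero j ω σ _ _ _ _ _ _ _ _

theorem leibniz_dL {m : ℕ} {F : Double j K L} (hF : F ∈ homog j K L m) (G : Double j K L) :
    dL j K L (mul j ω σ F G) =
      mul j ω σ (dL j K L F) G + (-1 : k) ^ m • mul j ω σ F (dL j K L G) := by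
  funext p q
  cases p with
  | zero =>
    change 0 = mul j ω σ (dL j K L F) G 0 q + (-1 : k) ^ m • mul j ω σ F (dL j K L G) 0 q
    have h1 : mul j ω σ (dL j K L F) G 0 q = 0 := by
      rw [mul_apply]
      refine Finset.sum_eq_zero fun a ha => Finset.sum_eq_zero fun b hb => ?_
      rw [Finset.HasAntidiagonal.mem_antidiagonal] at ha hb
      obtain ⟨a1, a2⟩ := a
      obtain ⟨b1, b2⟩ := b
      obtain ⟨rfl, rfl⟩ : a1 = 0 ∧ a2 = 0 := by simpa using ha
      rw [dL_zero, term_zero_left]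
    have h2 : mul j ω σ F (dL j K L G) 0 q = 0 := by
      rw [mul_apply]
      refine Finset.sum_eq_zero fun a ha => Finset.sum_eq_zero fun b hb => ?_
      rw [Finset.HasAntidiagonal.mem_antidiagonal] at ha hb
      obtain ⟨a1, a2⟩ := a
      obtain ⟨b1, b2⟩ := b
      obtain ⟨rfl, rfl⟩ : a1 = 0 ∧ a2 = 0 := by simpa using ha
      rw [dL_zero, term_zero_right]
    rw [h1, h2, smul_zero, add_zero]
  | succ p =>
    have h0 : dL j K L (mul j ω σ F G) (p + 1) q =
        ∑ a ∈ Finset.HasAntidiagonal.antidiagonal p, ∑ b ∈ Finset.HasAntidiagonal.antidiagonal q,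
          eL j K L p q (term j ω σ p q a.1 a.2 b.1 b.2 (F a.1 b.1) (G a.2 b.2)) := by
      rw [dL_succ]
      change eL j K L p q (mulEntry j ω σ F G p q) = _
      rw [mulEntry]
      refine (map_sum (eL j K L p q) _ _).trans ?_
      exact Finset.sum_congr rfl fun a _ => map_sum (eL j K L p q) _ _
    have h1 : mul j ω σ (dL j K L F) G (p + 1) q =
        ∑ a ∈ Finset.HasAntidiagonal.antidiagonal p, ∑ b ∈ Finset.HasAntidiagonal.antidiagonal q,
          term j ω σ (p + 1) q (a.1 + 1) a.2 b.1 b.2 (eL j K L a.1 b.1 (F a.1 b.1))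
            (G a.2 b.2) := by
      rw [mul_apply, Finset.Nat.sum_antidiagonal_succ]
      refine (congrArg (· + _) (Finset.sum_eq_zero fun b _ => ?_)).trans (zero_add _)
      rw [dL_zero, term_zero_left]
    have h2 : mul j ω σ F (dL j K L G) (p + 1) q =
        ∑ a ∈ Finset.HasAntidiagonal.antidiagonal p, ∑ b ∈ Finset.HasAntidiagonal.antidiagonal q,
          term j ω σ (p + 1) q a.1 (a.2 + 1) b.1 b.2 (F a.1 b.1)
            (eL j K L a.2 b.2 (G a.2 b.2)) := by
      rw [mul_apply, Finset.Nat.sum_antidiagonal_succ']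
      refine (congrArg (· + _) (Finset.sum_eq_zero fun b _ => ?_)).trans (zero_add _)
      rw [dL_zero, term_zero_right]
    change _ = mul j ω σ (dL j K L F) G (p + 1) q +
      (-1 : k) ^ m • mul j ω σ F (dL j K L G) (p + 1) q
    rw [h0, h1, h2, Finset.smul_sum, ← Finset.sum_add_distrib]
    refine Finset.sum_congr rfl fun a ha => ?_
    rw [Finset.smul_sum, ← Finset.sum_add_distrib]
    refine Finset.sum_congr rfl fun b hb => ?_
    by_cases h : a.1 + b.1 = m
    · exact term_eL j ω σ h (Finset.HasAntidiagonal.mem_antidiagonal.1 ha)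
        (Finset.HasAntidiagonal.mem_antidiagonal.1 hb) _ _
    · rw [hF a.1 b.1 h]
      exact term_eL_zero j ω σ _ _ _ _ _ _ _ _

variable (K L)

/-- The element `l ↦ (x ↦ ξ(l) τ(x))` of degree `(0, 0)`, where `ξ : L → k` and `τ : K → A` are
the augmentations. -/
def oneEntry : DHom j (L.X 0) (K.X 0) :=
  ⟨L.ε.smulRight (BimodRes.aug K.toProjRes (j.comp (SmashProduct.inl k))), fun γ l x => by
    have e : twist j (BimodRes.aug K.toProjRes (j.comp (SmashProduct.inl k))).1 x =
        (LinearMap.mul k B).flip (j (SmashProduct.inl k (K.ε x))) ∘ₗ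
          (j.comp (SmashProduct.inr k)).toLinearMap := by
      ext γ
      have h := congrArg j (SmashProduct.inr_mul_inl k γ (K.ε x))
      rw [map_mul, sweedler_apply _ _ _ (ℛ k γ), map_sum] at h
      rw [twist, sweedler_apply _ _ _ (ℛ k γ)]
      refine Eq.trans (Finset.sum_congr rfl fun i _ => ?_) h.symm
      rw [LinearMap.mul_apply', LinearMap.mul_apply', map_mul]
      change j (SmashProduct.inl k (K.ε _)) * _ = _
      rw [orbit_apply, K.ε_smul']
      rfl
    have h2 : rightHomAct j (BimodRes.aug K.toProjRes (j.comp (SmashProduct.inl k))).1 x γ =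
        counit (R := k) γ • j (SmashProduct.inl k (K.ε x)) := by
      rw [rightHomAct, e, sweedler_apply _ _ _ (ℛ k γ)]
      have h := congrArg (fun y => j (SmashProduct.inr k y) * j (SmashProduct.inl k (K.ε x)))
        (HopfAlgebra.sum_antipode_mul_eq_smul (ℛ k γ))
      simp only [map_sum, map_mul, map_smul, map_one, Finset.sum_mul, smul_mul_assoc,
        one_mul] at h
      rw [← h]
      exact Finset.sum_congr rfl fun i _ => (mul_assoc _ _ _).symm
    change L.ε (op γ • l) • j (SmashProduct.inl k (K.ε x)) = _
    rw [L.ε_smul]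
    change _ = rightHomAct j (L.ε l • (BimodRes.aug K.toProjRes _).1) x γ
    rw [rightHomAct_smul, LinearMap.smul_apply, h2, smul_smul]
    congr 1
    exact mul_comm (counit (R := k) γ) (L.ε l)⟩

/-- The family with the single nonzero entry `oneEntry` in degree `(0, 0)`. -/
def oneFamily : Double j K L := fun p q => match p, q with
  | 0, 0 => oneEntry j K L
  | _, _ => 0

theorem oneFamily_homog : oneFamily j K L ∈ homog j K L 0 := by
  intro p q h
  rcases p with _ | p
  · rcases q with _ | q
    · exact absurd rfl h
    · rfl
  · rfl

theorem dTot_oneFamily : dTot j K L (oneFamily j K L) = 0 := by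
  funext p q
  change dK j K L (oneFamily j K L) p q + dL j K L (oneFamily j K L) p q = 0
  have hK : dK j K L (oneFamily j K L) p q = 0 := by
    rcases q with _ | _ | q
    · rfl
    · rcases p with _ | p
      · refine DHom.ext fun l x => ?_
        have h : K.ε (K.d 0 x) = 0 := K.exact_zero.apply_apply_eq_zero x
        change -(-1 : k) ^ 0 • L.ε l • j (SmashProduct.inl k (K.ε (K.d 0 x))) = 0
        rw [h]
        simp
      · exact map_zero (eK j K L (p + 1) 0)
    · rcases p with _ | p
      · exact map_zero (eK j K L 0 (q + 1))
      · exact map_zero (eK j K L (p + 1) (q + 1))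
  have hL : dL j K L (oneFamily j K L) p q = 0 := by
    rcases p with _ | _ | p
    · rfl
    · rcases q with _ | q
      · refine DHom.ext fun l x => ?_
        have h : L.ε (L.d 0 l) = 0 := L.exact_zero.apply_apply_eq_zero l
        change -(-1 : k) ^ (0 + 0) • L.ε (L.d 0 l) • j (SmashProduct.inl k (K.ε x)) = 0
        rw [h]
        simp
      · exact map_zero (eL j K L 0 (q + 1))
    · exact map_zero (eL j K L (p + 1) q)
  rw [hK, hL, add_zero]

end Double

variable {K L} in
/-- The dg algebra `Hom_Γ(L, Hom_{A^e}(K, B))`, with the product defined by `σ` and `ω`. -/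
def derivedInvariants (ω : EquivDiagonal K) (σ : TrivDiagonal L) : DGAlg k where
  C n := Double.homog j K L n
  d n := (Double.dTot j K L).restrict (fun _ h =>
    add_mem (Double.dK_homog j K L h) (Double.dL_homog j K L h))
  mul m n r h := LinearMap.mk₂ k
    (fun F G => ⟨Double.mul j ω σ F.1 G.1, h ▸ Double.mul_homog j ω σ F.2 G.2⟩)
    (fun F F' G => Subtype.ext (LinearMap.map_add₂ (Double.mul j ω σ) F.1 F'.1 G.1))
    (fun c F G => Subtype.ext (LinearMap.map_smul₂ (Double.mul j ω σ) c F.1 G.1))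
    (fun F G G' => Subtype.ext (map_add (Double.mul j ω σ F.1) G.1 G'.1))
    (fun c F G => Subtype.ext (map_smul (Double.mul j ω σ F.1) c G.1))
  one := ⟨Double.oneFamily j K L, Double.oneFamily_homog j K L⟩
  d_d n F := Subtype.ext (Double.dTot_dTot j K L F.1)
  d_one := Subtype.ext (Double.dTot_oneFamily j K L)
  leibniz m n r h F G := Subtype.ext (by
    have h1 := Double.leibniz_dK j ω σ F.2 G.1
    have h2 := Double.leibniz_dL j ω σ F.2 G.1
    change Double.dK j K L (Double.mul j ω σ F.1 G.1) + Double.dL j K L (Double.mul j ω σ F.1 G.1) =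
      Double.mul j ω σ (Double.dK j K L F.1 + Double.dL j K L F.1) G.1 +
        (-1 : k) ^ m • Double.mul j ω σ F.1 (Double.dK j K L G.1 + Double.dL j K L G.1)
    rw [h1, h2, map_add, map_add, LinearMap.add_apply, smul_add]
    abel)

end Derived

end SmashHH

end

set_option linter.unusedSectionVars false

noncomputable section

namespace SmashHH


/-! The right-hand complex is, already before cohomology, a complex of bimodule maps out of one
particular resolution of A#Γ. For a right Γ-module L and an equivariant A-bimodule K, the space K ⊗
Γ ⊗ L is made an A#Γ-bimodule `Ind`: on the left a acts through K and γ sends x ⊗ δ ⊗ l to ∑ γ₁x ⊗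
γ₂δ ⊗ l·S⁻¹(γ₃); on the right K ⊗ Γ is treated as K ⊗_A (A#Γ). The inverse antipode turns L into a
left module, which is where bijectivity of S enters.

Bimodule maps from `Ind` to M amount to bilinear maps F : L × K → M that are A-bilinear in K and
satisfy ∑ γ₁F(lγ₂, x) = ∑ F(l, γ₁x)γ₂ (`IsGen`, `Ind.lift`). Convolution with S converts this
relation into F(lγ)(x) = ∑ S(γ₁)F(l)(γ₂x)γ₃ (`IsGen.conj_eq`). For M = B this is membership in
Hom_Γ(L, Hom_{A^e}(K, B)).

The total complex of the `Ind` of L_p and K_q is a projective resolution (`indRes`). It is exact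
because L → k splits over k, so the rows contract onto K ⊗ Γ, which resolves A ⊗ Γ as k is a field
(`mem_range_indD`). It is projective because families F lift along surjections: first lift over A^e,
then spread the lift over a free Γ-module by conjugation (`IsGen.exists_lift`, `Ind.projective`).

The maps ω and σ multiply families of generators. The product of the tautological family with itself
is a diagonal map of the resolution (`indDiagonal`), and for this choice the comparison of cochains
is bijective, multiplicative and unital (`cohIso_derivedInvariants`).

It remains to pass to an arbitrary P and Δ (`hochschild_cohIso`). Two chain maps P → Q ⊗_R Q over
the identity of R are homotopic, because Q ⊗_R Q is again a resolution: Q is contractible as a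
complex of right modules. Cocycles paired along homotopic maps have cohomologous products, so no
coassociativity of diagonals is needed. -/

instance Env.instSMul {k R M : Type u} [Field k] [Ring R] [Algebra k R] [AddCommGroup M]
    [Module (Env k R) M] : SMul (Env k R) M :=
  Module.toDistribMulAction.toSMul

instance Env.instSemiring (k R : Type u) [Field k] [Ring R] [Algebra k R] :
    Semiring (Env k R) :=
  Algebra.TensorProduct.instSemiring

/-! ## Lifting along exact sequences -/

section Lifting

variable {S : Type u} [Ring S]

/-- Projectivity is applied to d corestricted to its range, so d itself need not be surjective.
Exactness enters later only as a way to verify the range condition. -/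
theorem exists_lift_of_range {P M N : Type u} [AddCommGroup P] [Module S P]
    [Module.Projective S P] [AddCommGroup M] [Module S M] [AddCommGroup N] [Module S N]
    (d : M →ₗ[S] N) (f : P →ₗ[S] N) (h : ∀ x, f x ∈ LinearMap.range d) :
    ∃ g : P →ₗ[S] M, ∀ x, d (g x) = f x := by
  obtain ⟨g, hg⟩ := Module.projective_lifting_property d.rangeRestrict
    (f.codRestrict (LinearMap.range d) h) d.surjective_rangeRestrict
  exact ⟨g, fun x => congrArg Subtype.val (LinearMap.congr_fun hg x)⟩

variable {P Q : ℕ → Type u} [∀ n, AddCommGroup (P n)] [∀ n, Module S (P n)]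
  [∀ n, AddCommGroup (Q n)] [∀ n, Module S (Q n)] [∀ n, Module.Projective S (P n)]
  (dP : ∀ n, P (n + 1) →ₗ[S] P n) (dQ : ∀ n, Q (n + 1) →ₗ[S] Q n)

/-- The comparison theorem with the augmentations stripped off: `h₀` is all that they contribute. -/
theorem exists_chainMap (hP : ∀ n x, dP n (dP (n + 1) x) = 0)
    (hQ : ∀ n, Function.Exact (dQ (n + 1)) (dQ n)) (f₀ : P 0 →ₗ[S] Q 0)
    (h₀ : ∀ x, f₀ (dP 0 x) ∈ LinearMap.range (dQ 0)) :
    ∃ f : ∀ n, P n →ₗ[S] Q n, f 0 = f₀ ∧ ∀ n x, dQ n (f (n + 1) x) = f n (dP n x) := by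
  obtain ⟨f₁, hf₁⟩ := exists_lift_of_range (dQ 0) (f₀ ∘ₗ dP 0) h₀
  have step : ∀ n (p : {p : (P n →ₗ[S] Q n) × (P (n + 1) →ₗ[S] Q (n + 1)) //
      ∀ x, dQ n (p.2 x) = p.1 (dP n x)}), ∃ g : P (n + 2) →ₗ[S] Q (n + 2),
      ∀ x, dQ (n + 1) (g x) = p.1.2 (dP (n + 1) x) := by
    rintro n ⟨⟨a, b⟩, h⟩
    refine exists_lift_of_range (dQ (n + 1)) (b ∘ₗ dP (n + 1)) fun x => (hQ n _).1 ?_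
    rw [LinearMap.comp_apply, h, hP, map_zero]
  choose g hg using step
  -- The recursion carries two consecutive components with the square between them, since the next
  -- lift needs that square to see that its target consists of cycles.
  let F : ∀ n, {p : (P n →ₗ[S] Q n) × (P (n + 1) →ₗ[S] Q (n + 1)) //
      ∀ x, dQ n (p.2 x) = p.1 (dP n x)} := fun n =>
    Nat.rec ⟨(f₀, f₁), hf₁⟩ (fun n p => ⟨(p.1.2, g n p), hg n p⟩) n
  exact ⟨fun n => (F n).1.1, rfl, fun n x => (F n).2 x⟩

/-- Here g plays the role of a difference of two lifts of the same map; `h₀` records that they agree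
after augmentation. -/
theorem exists_homotopy (hP : ∀ n x, dP n (dP (n + 1) x) = 0)
    (hQ : ∀ n, Function.Exact (dQ (n + 1)) (dQ n)) (g : ∀ n, P n →ₗ[S] Q n)
    (hg : ∀ n x, dQ n (g (n + 1) x) = g n (dP n x))
    (h₀ : ∀ x, g 0 x ∈ LinearMap.range (dQ 0)) :
    ∃ h : ∀ n, P n →ₗ[S] Q (n + 1), (∀ x, dQ 0 (h 0 x) = g 0 x) ∧
      ∀ n x, dQ (n + 1) (h (n + 1) x) + h n (dP n x) = g (n + 1) x := by
  obtain ⟨h₁, hh₁⟩ := exists_lift_of_range (dQ 0) (g 0) h₀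
  have first : ∃ b : P 1 →ₗ[S] Q 2, ∀ x, dQ 1 (b x) + h₁ (dP 0 x) = g 1 x := by
    obtain ⟨b, hb⟩ := exists_lift_of_range (dQ 1) (g 1 - h₁ ∘ₗ dP 0) fun x => (hQ 0 _).1 (by
      rw [LinearMap.sub_apply, map_sub, hg, LinearMap.comp_apply, hh₁, sub_self])
    exact ⟨b, fun x => by rw [hb, LinearMap.sub_apply, LinearMap.comp_apply, sub_add_cancel]⟩
  obtain ⟨h₂, hh₂⟩ := first
  have step : ∀ n (p : {p : (P n →ₗ[S] Q (n + 1)) × (P (n + 1) →ₗ[S] Q (n + 2)) //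
      ∀ x, dQ (n + 1) (p.2 x) + p.1 (dP n x) = g (n + 1) x}),
      ∃ b : P (n + 2) →ₗ[S] Q (n + 3),
      ∀ x, dQ (n + 2) (b x) + p.1.2 (dP (n + 1) x) = g (n + 2) x := by
    rintro n ⟨⟨a, b⟩, h⟩
    obtain ⟨c, hc⟩ := exists_lift_of_range (dQ (n + 2)) (g (n + 2) - b ∘ₗ dP (n + 1))
      fun x => (hQ (n + 1) _).1 (by
        have := h (dP (n + 1) x)
        rw [hP, map_zero, add_zero] at this
        rw [LinearMap.sub_apply, map_sub, hg, LinearMap.comp_apply, this, sub_self])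
    exact ⟨c, fun x => by rw [hc, LinearMap.sub_apply, LinearMap.comp_apply, sub_add_cancel]⟩
  choose b hb using step
  let F : ∀ n, {p : (P n →ₗ[S] Q (n + 1)) × (P (n + 1) →ₗ[S] Q (n + 2)) //
      ∀ x, dQ (n + 1) (p.2 x) + p.1 (dP n x) = g (n + 1) x} := fun n =>
    Nat.rec ⟨(h₁, h₂), hh₂⟩ (fun n p => ⟨(p.1.2, b n p), hb n p⟩) n
  exact ⟨fun n => (F n).1.1, hh₁, fun n x => (F n).2 x⟩

/-- A resolution by projectives of a projective module is contractible. -/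
theorem exists_contraction {T : Type u} [AddCommGroup T] [Module S T] [Module.Projective S T]
    (ε : P 0 →ₗ[S] T) (hε : Function.Surjective ε) (h0 : Function.Exact (dP 0) ε)
    (hP : ∀ n, Function.Exact (dP (n + 1)) (dP n)) :
    ∃ (ι : T →ₗ[S] P 0) (s : ∀ n, P n →ₗ[S] P (n + 1)), (∀ t, ε (ι t) = t) ∧
      (∀ x, dP 0 (s 0 x) + ι (ε x) = x) ∧ ∀ n x, dP (n + 1) (s (n + 1) x) + s n (dP n x) = x := by
  obtain ⟨ι, hι⟩ := Module.projective_lifting_property ε LinearMap.id hε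
  have hι' : ∀ t, ε (ι t) = t := LinearMap.congr_fun hι
  obtain ⟨s, hs, hs'⟩ := exists_homotopy dP dP (fun n x => (hP n).apply_apply_eq_zero x) hP
    -- The chain map id − ι ε, with ι ε living in degree 0 only. A null homotopy of it is the
    -- contraction sought.
    (fun n => Nat.casesOn n (LinearMap.id - ι ∘ₗ ε) fun _ => LinearMap.id)
    (fun n x => by
      cases n with
      | zero => simp [h0.apply_apply_eq_zero]
      | succ n => rfl)
    (fun x => (h0 _).1 (by simp [hι']))
  exact ⟨ι, s, hι', fun x => by rw [hs]; simp, hs'⟩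

end Lifting

/-! ## Total complexes -/

section Total

variable {S : Type u} [Ring S] (T : ℕ → ℕ → Type u) [∀ p q, AddCommGroup (T p q)]
  [∀ p q, Module S (T p q)]

variable (S) in
/-- The families concentrated in total degree `n`. -/
def Tot (n : ℕ) : Submodule S (∀ p q, T p q) where
  carrier := {z | ∀ p q, p + q ≠ n → z p q = 0}
  add_mem' := fun {z w} hz hw p q h => by simp [hz p q h, hw p q h]
  zero_mem' := fun p q _ => rfl
  smul_mem' := fun c z hz p q h => by simp [hz p q h]

namespace Tot

variable {T}

/-- The component of degree `(p, q)`. -/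
def comp (n p q : ℕ) : Tot S T n →ₗ[S] T p q :=
  (LinearMap.proj q).comp ((LinearMap.proj p).comp (Tot S T n).subtype)

@[simp] theorem comp_apply (n p q : ℕ) (z : Tot S T n) : comp n p q z = z.1 p q := rfl

/-- The inclusion of the entry of degree `(p, q)`, which is zero unless `p + q = n`. -/
def single (n p q : ℕ) : T p q →ₗ[S] Tot S T n :=
  if h : p + q = n then
    ((LinearMap.single S (fun p => ∀ q, T p q) p).comp
      (LinearMap.single S (fun q => T p q) q)).codRestrict (Tot S T n) (fun x a b hab => by
        rcases eq_or_ne a p with rfl | ha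
        · rcases eq_or_ne b q with rfl | hb
          · exact absurd h hab
          · simp [hb]
        · simp [ha])
  else 0

theorem single_of_ne {n p q : ℕ} (h : p + q ≠ n) : (single n p q : T p q →ₗ[S] Tot S T n) = 0 :=
  dif_neg h

theorem single_val {n p q : ℕ} (h : p + q = n) (x : T p q) :
    (single (S := S) n p q x).1 = Pi.single p (Pi.single q x) := by
  rw [single, dif_pos h]
  rfl

theorem single_val_same {n p q : ℕ} (h : p + q = n) (x : T p q) :
    (single (S := S) n p q x).1 p q = x := by
  rw [single_val h]
  simp

theorem single_val_ne {n p q a b : ℕ} (h : a ≠ p ∨ b ≠ q) (x : T p q) :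
    (single (S := S) n p q x).1 a b = 0 := by
  by_cases hn : p + q = n
  · rcases eq_or_ne a p with rfl | ha
    · rw [single_val hn, Pi.single_eq_same, Pi.single_eq_of_ne (h.resolve_left (not_not.2 rfl))]
    · rw [single_val hn, Pi.single_eq_of_ne ha]
      rfl
  · rw [single_of_ne hn]
    rfl

theorem sum_single {n : ℕ} (z : Tot S T n) :
    ∑ a ∈ Finset.HasAntidiagonal.antidiagonal n, single (S := S) n a.1 a.2 (z.1 a.1 a.2) = z := by
  refine Subtype.ext ?_
  funext p q
  rw [Submodule.coe_sum, Finset.sum_apply, Finset.sum_apply]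
  by_cases h : p + q = n
  · rw [Finset.sum_eq_single (p, q)]
    · exact single_val_same h _
    · rintro ⟨a, b⟩ _ hne
      refine single_val_ne ?_ _
      by_contra! hc
      exact hne (Prod.ext hc.1.symm hc.2.symm)
    · intro hne
      exact absurd (Finset.HasAntidiagonal.mem_antidiagonal.2 h) hne
  · rw [z.2 p q h]
    refine Finset.sum_eq_zero fun a ha => single_val_ne ?_ _
    by_contra! hc
    rw [Finset.HasAntidiagonal.mem_antidiagonal, ← hc.1, ← hc.2] at ha
    exact h ha

theorem hom_ext {M : Type*} [AddCommGroup M] {F : Type*} [FunLike F (Tot S T n) M]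
    [AddMonoidHomClass F (Tot S T n) M] {f g : F}
    (h : ∀ p q, p + q = n → ∀ x, f (single n p q x) = g (single n p q x)) (z : Tot S T n) :
    f z = g z := by
  rw [← sum_single z, map_sum, map_sum]
  exact Finset.sum_congr rfl fun a ha => h _ _ (Finset.HasAntidiagonal.mem_antidiagonal.1 ha) _

/-- The map on the total complex given by maps on the entries. -/
def desc {M : Type u} [AddCommGroup M] [Module S M] (n : ℕ) (f : ∀ p q, T p q →ₗ[S] M) :
    Tot S T n →ₗ[S] M :=
  ∑ a ∈ Finset.HasAntidiagonal.antidiagonal n, f a.1 a.2 ∘ₗ comp n a.1 a.2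

theorem desc_single {M : Type u} [AddCommGroup M] [Module S M] {n p q : ℕ} (h : p + q = n)
    (f : ∀ p q, T p q →ₗ[S] M) (x : T p q) : desc n f (single n p q x) = f p q x := by
  rw [desc, LinearMap.sum_apply, Finset.sum_eq_single (p, q)]
  · simp [single_val_same h]
  · rintro ⟨a, b⟩ _ hne
    have : (single (S := S) n p q x).1 a b = 0 := by
      refine single_val_ne ?_ _
      by_contra! hc
      exact hne (Prod.ext hc.1 hc.2)
    simp [this]
  · intro hne
    exact absurd (Finset.HasAntidiagonal.mem_antidiagonal.2 h) hne

/-- Each total degree is a finite direct sum: a section of a surjection is assembled from lifts of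
the inclusions of the entries. -/
theorem projective [∀ p q, Module.Projective S (T p q)] (n : ℕ) :
    Module.Projective S (Tot S T n) := by
  refine Module.Projective.of_lifting_property'' fun f hf => ?_
  have := fun p q => Module.projective_lifting_property f (single n p q) hf
  choose h hh using this
  refine ⟨desc n h, LinearMap.ext fun z => hom_ext (fun p q hpq x => ?_) z⟩
  rw [LinearMap.comp_apply, desc_single hpq]
  exact LinearMap.congr_fun (hh p q) x

variable (dh : ∀ p q, T (p + 1) q →ₗ[S] T p q) (dv : ∀ p q, T p (q + 1) →ₗ[S] T p q)

/-- The total differential. -/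
def d (n : ℕ) : Tot S T (n + 1) →ₗ[S] Tot S T n where
  toFun z := ⟨fun p q => dh p q (z.1 (p + 1) q) + (-1 : ℤ) ^ p • dv p q (z.1 p (q + 1)),
    fun p q h => by
      beta_reduce
      rw [z.2 (p + 1) q (by omega), z.2 p (q + 1) (by omega)]
      simp⟩
  map_add' z w := Subtype.ext (by
    funext p q
    simp only [Submodule.coe_add, Pi.add_apply, map_add, smul_add]
    abel)
  map_smul' c z := Subtype.ext (by
    funext p q
    simp [smul_comm c])

theorem d_val (n p q : ℕ) (z : Tot S T (n + 1)) :
    (d dh dv n z).1 p q = dh p q (z.1 (p + 1) q) + (-1 : ℤ) ^ p • dv p q (z.1 p (q + 1)) := rfl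

/-- The horizontal part of the total differential on an entry. -/
def singleH (n : ℕ) : ∀ p q, T p q →ₗ[S] Tot S T n
  | 0, _ => 0
  | p + 1, q => single n p q ∘ₗ dh p q

/-- The vertical part of the total differential on an entry. -/
def singleV (n : ℕ) : ∀ p q, T p q →ₗ[S] Tot S T n
  | _, 0 => 0
  | p, q + 1 => single n p q ∘ₗ dv p q

/-- There is no restriction on degrees: on the edges p = 0 or q = 0 the missing part is zero by the
definition of `singleH` and `singleV`, and off the diagonal p + q = n + 1 both sides vanish. -/
theorem d_single (n p q : ℕ) (x : T p q) :
    d dh dv n (single (n + 1) p q x) =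
      singleH dh n p q x + (-1 : ℤ) ^ p • singleV dv n p q x := by
  by_cases h : p + q = n + 1
  · refine Subtype.ext ?_
    funext a b
    rw [d_val]
    have e1 : dh a b ((single (S := S) (n + 1) p q x).1 (a + 1) b) =
        (singleH dh n p q x).1 a b := by
      cases p with
      | zero =>
        rw [single_val_ne (by omega), map_zero]
        rfl
      | succ p =>
        change _ = (single (S := S) n p q (dh p q x)).1 a b
        by_cases hab : a = p ∧ b = q
        · obtain ⟨rfl, rfl⟩ := hab
          rw [single_val_same h, single_val_same (by omega)]
        · rw [single_val_ne (by omega), single_val_ne (by omega), map_zero]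
    have e2 : (-1 : ℤ) ^ a • dv a b ((single (S := S) (n + 1) p q x).1 a (b + 1)) =
        (-1 : ℤ) ^ p • (singleV dv n p q x).1 a b := by
      cases q with
      | zero =>
        rw [single_val_ne (by omega), map_zero, smul_zero]
        exact (smul_zero _).symm
      | succ q =>
        change _ = _ • (single (S := S) n p q (dv p q x)).1 a b
        by_cases hab : a = p ∧ b = q
        · obtain ⟨rfl, rfl⟩ := hab
          rw [single_val_same h, single_val_same (by omega)]
        · rw [single_val_ne (by omega), single_val_ne (by omega), map_zero, smul_zero, smul_zero]
    rw [e1, e2]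
    rfl
  · have e1 : singleH dh n p q x = 0 := by
      cases p with
      | zero => rfl
      | succ p => rw [singleH, single_of_ne (by omega), LinearMap.zero_comp, LinearMap.zero_apply]
    have e2 : singleV dv n p q x = 0 := by
      cases q with
      | zero => rfl
      | succ q => rw [singleV, single_of_ne (by omega), LinearMap.zero_comp, LinearMap.zero_apply]
    rw [single_of_ne h, e1, e2]
    simp

/-- The squares commute; the sign (-1)^p in the total differential changes between columns p and p +
1 and makes the mixed terms cancel. -/
theorem d_d (hh : ∀ p q x, dh p q (dh (p + 1) q x) = 0) (hv : ∀ p q x, dv p q (dv p (q + 1) x) = 0)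
    (hc : ∀ p q x, dh p q (dv (p + 1) q x) = dv p q (dh p (q + 1) x)) (n : ℕ)
    (z : Tot S T (n + 2)) : d dh dv n (d dh dv (n + 1) z) = 0 := by
  refine Subtype.ext ?_
  funext p q
  simp only [d_val, map_add, map_zsmul, hh, hv, hc, smul_zero, add_zero, zero_add, pow_succ]
  simp

/-- A double complex with horizontal contraction onto an exact column has exact total complex. -/
theorem exact_of_contraction {C : ℕ → Type u} [∀ q, AddCommGroup (C q)]
    (dC : ∀ q, C (q + 1) → C q) (e : ∀ q, T 0 q →+ C q) (ι : ∀ q, C q → T 0 q)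
    (s : ∀ p q, T p q →+ T (p + 1) q)
    (hs0 : ∀ q x, dh 0 q (s 0 q x) + ι q (e q x) = x)
    (hs : ∀ p q x, dh (p + 1) q (s (p + 1) q x) + s p q (dh p q x) = x)
    (hsv : ∀ p q x, dv (p + 1) q (s p (q + 1) x) = s p q (dv p q x))
    (hι : ∀ q v, dv 0 q (ι (q + 1) v) = ι q (dC q v))
    (n : ℕ) (z : Tot S T n) (hz : ∀ p q, p + q + 1 = n →
      dh p q (z.1 (p + 1) q) + (-1 : ℤ) ^ p • dv p q (z.1 p (q + 1)) = 0)
    (hC : ∃ v, dC n v = e n (z.1 0 n)) : z ∈ LinearMap.range (d dh dv n) := by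
  obtain ⟨v, hv⟩ := hC
  -- The contraction s moves every entry of z one column to the right. Its differential recovers z
  -- except for ι e(z) in column 0, and that defect is the differential of ι v. The cycle condition
  -- is asked only for p + q + 1 = n, so degree 0 is covered with no condition.
  refine ⟨single (n + 1) 0 (n + 1) (ι (n + 1) v) + ⟨fun p q => match p with
    | 0 => 0
    | p + 1 => s p q (z.1 p q), fun p q h => by
      cases p with
      | zero => rfl
      | succ p => exact (congrArg (s p q) (z.2 p q (by omega))).trans (map_zero (s p q))⟩, ?_⟩
  · have h1 : d dh dv n (single (n + 1) 0 (n + 1) (ι (n + 1) v)) =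
        single n 0 n (ι n (dC n v)) := by
      rw [d_single, ← hι]
      simp [singleH, singleV]
    rw [map_add, h1]
    refine Subtype.ext ?_
    funext p q
    change (single (S := S) n 0 n (ι n (dC n v))).1 p q + (dh p q (s p q (z.1 p q)) + _) = _
    by_cases hpq : p + q = n
    · cases p with
      | zero =>
        obtain rfl : q = n := by omega
        change _ + (_ + (-1 : ℤ) ^ 0 • dv 0 q 0) = _
        rw [single_val_same (by omega), hv, map_zero, smul_zero, add_zero, add_comm]
        exact hs0 _ _
      | succ p =>
        -- The vertical term is, up to sign, s applied to dv of the neighbouring entry. The cycle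
        -- condition replaces it by s dh z, after which the contraction identity closes the entry.
        change _ + (_ + (-1 : ℤ) ^ (p + 1) • dv (p + 1) q (s p (q + 1) (z.1 p (q + 1)))) = _
        rw [single_val_ne (by omega), zero_add, hsv, pow_succ, mul_neg_one, neg_smul,
          ← map_zsmul, ← map_neg, ← eq_neg_of_add_eq_zero_left (hz p q (by omega))]
        exact hs _ _ _
    · rw [single_val_ne (by omega), z.2 p q hpq, map_zero, map_zero, zero_add, zero_add]
      cases p with
      | zero =>
        change (-1 : ℤ) ^ 0 • dv 0 q 0 = 0
        rw [map_zero, smul_zero]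
      | succ p =>
        change (-1 : ℤ) ^ (p + 1) • dv (p + 1) q (s p (q + 1) (z.1 p (q + 1))) = 0
        rw [z.2 p (q + 1) (by omega)]
        simp

end Tot

end Total


/-! ## Isomorphisms of cohomology algebras -/

namespace DGAlg

variable {k : Type u} [Field k]

/-- The cohomology algebras of `D` and `D'` are isomorphic. -/
def CohIso (D D' : DGAlg k) : Prop :=
  ∃ e : ∀ n, D.H n ≃ₗ[k] D'.H n,
    (∀ m n r (h : m + n = r) (x : D.H m) (y : D.H n),
      e r (D.HMul m n r h x y) = D'.HMul m n r h (e m x) (e n y)) ∧ e 0 D.HOne = D'.HOne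

theorem CohIso.trans {D D' D'' : DGAlg k} (h : CohIso D D') (h' : CohIso D' D'') :
    CohIso D D'' := by
  obtain ⟨e, he, he1⟩ := h
  obtain ⟨f, hf, hf1⟩ := h'
  exact ⟨fun n => (e n).trans (f n), fun m n r h x y => by
    simp only [LinearEquiv.trans_apply, he, hf], by
    simp only [LinearEquiv.trans_apply, he1, hf1]⟩

variable {D D' : DGAlg k}

theorem map_mem_coboundaries (α : ∀ n, D.C n →ₗ[k] D'.C n)
    (hα : ∀ n x, α (n + 1) (D.d n x) = D'.d n (α n x)) (n : ℕ) {x : D.C n}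
    (hx : x ∈ D.coboundaries n) : α n x ∈ D'.coboundaries n := by
  cases n with
  | zero =>
    obtain rfl : x = 0 := hx
    exact (α 0).map_zero
  | succ n =>
    obtain ⟨y, rfl⟩ := hx
    exact ⟨α n y, (hα n y).symm⟩

/-- The map induced on cohomology by a chain map. -/
def mapH (α : ∀ n, D.C n →ₗ[k] D'.C n)
    (hα : ∀ n x, α (n + 1) (D.d n x) = D'.d n (α n x)) (n : ℕ) : D.H n →ₗ[k] D'.H n :=
  Submodule.mapQ _ _ ((α n).restrict (p := D.cocycles n) (q := D'.cocycles n) fun x hx => by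
      have hx' : D.d n x = 0 := hx
      change D'.d n (α n x) = 0
      rw [← hα, hx', map_zero])
    (fun x hx => map_mem_coboundaries α hα n hx)

theorem mk_eq_mk {n : ℕ} {x y : D.cocycles n} (h : x.1 - y.1 ∈ D.coboundaries n) :
    (Submodule.Quotient.mk x : D.H n) = Submodule.Quotient.mk y :=
  (Submodule.Quotient.eq _).2 h

/-- Mutually inverse chain maps up to coboundaries, multiplicative and unital up to coboundaries,
induce an isomorphism of cohomology algebras. -/
theorem CohIso.of_chainMaps (α : ∀ n, D.C n →ₗ[k] D'.C n)
    (hα : ∀ n x, α (n + 1) (D.d n x) = D'.d n (α n x)) (β : ∀ n, D'.C n →ₗ[k] D.C n)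
    (hβ : ∀ n x, β (n + 1) (D'.d n x) = D.d n (β n x))
    (hβα : ∀ n x, D.d n x = 0 → β n (α n x) - x ∈ D.coboundaries n)
    (hαβ : ∀ n x, D'.d n x = 0 → α n (β n x) - x ∈ D'.coboundaries n)
    (hmul : ∀ m n r (h : m + n = r) x y, D.d m x = 0 → D.d n y = 0 →
      α r (D.mul m n r h x y) - D'.mul m n r h (α m x) (α n y) ∈ D'.coboundaries r)
    (hone : α 0 D.one - D'.one ∈ D'.coboundaries 0) : CohIso D D' := by
  refine ⟨fun n => LinearEquiv.ofLinearMap (mapH α hα n) (mapH β hβ n) ?_ ?_, ?_, mk_eq_mk hone⟩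
  · refine LinearMap.ext fun x => ?_
    obtain ⟨x, rfl⟩ := Submodule.Quotient.mk_surjective _ x
    exact mk_eq_mk (hαβ n x.1 x.2)
  · refine LinearMap.ext fun x => ?_
    obtain ⟨x, rfl⟩ := Submodule.Quotient.mk_surjective _ x
    exact mk_eq_mk (hβα n x.1 x.2)
  · intro m n r h x y
    obtain ⟨x, rfl⟩ := Submodule.Quotient.mk_surjective _ x
    obtain ⟨y, rfl⟩ := Submodule.Quotient.mk_surjective _ y
    exact mk_eq_mk (hmul m n r h x.1 y.1 x.2 y.2)

end DGAlg

/-! ## Bimodules as right modules -/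

section RightModules

variable {k R : Type u} [Field k] [Ring R] [Algebra k R]

variable (k R) in
/-- A bimodule regarded as a right module. -/
abbrev rightModule (M : Type u) [AddCommGroup M] [Module (Env k R) M] : Module Rᵐᵒᵖ M :=
  Module.compHom M (Algebra.TensorProduct.includeRight : Rᵐᵒᵖ →ₐ[k] Env k R).toRingHom

/-- After exchanging the factors, the enveloping algebra is the vector space R with scalars extended
to Rᵐᵒᵖ, and every vector space is free. -/
theorem free_env : @Module.Free Rᵐᵒᵖ (Env k R) _ _ (rightModule k R (Env k R)) := by
  let := rightModule k R (Env k R)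
  suffices h : ∀ (r : Rᵐᵒᵖ) (x : Rᵐᵒᵖ ⊗[k] R),
      TensorProduct.comm k Rᵐᵒᵖ R (r • x) = (1 ⊗ₜ[k] r) * TensorProduct.comm k Rᵐᵒᵖ R x by
    let e : (Rᵐᵒᵖ ⊗[k] R) ≃ₗ[Rᵐᵒᵖ] Env k R := { TensorProduct.comm k Rᵐᵒᵖ R with map_smul' := h }
    exact Module.Free.of_equiv e
  intro r x
  induction x with
  | zero => simp
  | add x y hx hy => rw [smul_add, map_add, map_add, hx, hy, mul_add]
  | tmul a b => simp [TensorProduct.smul_tmul']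

/-- A projective bimodule is a retract of a free one, and restricting scalars along Rᵐᵒᵖ → R^e keeps
free modules free. -/
theorem projective_rightModule (M : Type u) [AddCommGroup M] [Module (Env k R) M]
    [Module.Projective (Env k R) M] : @Module.Projective Rᵐᵒᵖ _ M _ (rightModule k R M) := by
  let := rightModule k R (Env k R)
  let := rightModule k R M
  have := free_env (k := k) (R := R)
  obtain ⟨s, hs⟩ := (inferInstance : Module.Projective (Env k R) M)
  let π : (M →₀ Env k R) →ₗ[Rᵐᵒᵖ] M :=
    { Finsupp.linearCombination (Env k R) (id : M → M) with
      map_smul' := fun r x =>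
        map_smul (Finsupp.linearCombination (Env k R) (id : M → M)) ((1 : R) ⊗ₜ[k] r) x }
  let ι : M →ₗ[Rᵐᵒᵖ] (M →₀ Env k R) :=
    { s with map_smul' := fun r x => map_smul s ((1 : R) ⊗ₜ[k] r) x }
  exact Module.Projective.of_split ι π (LinearMap.ext hs)

theorem projective_self_right : Module.Projective Rᵐᵒᵖ R :=
  Module.Projective.of_equiv' (M := Rᵐᵒᵖ)
    { (opAddEquiv (α := R)).symm with map_smul' := fun _ _ => rfl }

theorem aug_rightAct (P : BimodRes k R) (x : P.X 0) (r : R) :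
    P.ε (rightAct k R (P.X 0) x r) = P.ε x * r := by
  rw [rightAct_apply, P.ε_smul]
  simp

theorem aug_leftAct (P : BimodRes k R) (x : P.X 0) (r : R) :
    P.ε (leftAct k R (P.X 0) r x) = r * P.ε x := by
  rw [leftAct_apply, P.ε_smul]
  simp

/-- A projective bimodule resolution is contractible as a complex of right modules. -/
theorem BimodRes.exists_right_contraction (P : BimodRes k R) :
    ∃ (u : P.X 0) (s : ∀ n, P.X n →ₗ[k] P.X (n + 1)),
      (∀ n x r, s n (rightAct k R (P.X n) x r) = rightAct k R (P.X (n + 1)) (s n x) r) ∧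
      (∀ x, P.d 0 (s 0 x) + rightAct k R (P.X 0) u (P.ε x) = x) ∧
      ∀ n x, P.d (n + 1) (s (n + 1) x) + s n (P.d n x) = x := by
  let := fun n => rightModule k R (P.X n)
  have := P.projective
  have := fun n => projective_rightModule (k := k) (R := R) (P.X n)
  have := projective_self_right (R := R)
  obtain ⟨ι, s, -, h0, h⟩ := exists_contraction (S := Rᵐᵒᵖ) (P := P.X) (T := R)
    (fun n => { P.d n with map_smul' := fun r x => map_smul (P.d n) ((1 : R) ⊗ₜ[k] r) x })
    { P.ε with map_smul' := fun r x => aug_rightAct P x r.unop }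
    P.ε_surjective P.exact_zero P.exact_succ
  have hs : ∀ n x r, s n (rightAct k R (P.X n) x r) = rightAct k R (P.X (n + 1)) (s n x) r :=
    fun n x r => map_smul (s n) (op r) x
  -- A scalar c acts as right multiplication by its image in R, so right R-linearity of s already
  -- forces k-linearity.
  have hk : ∀ n (c : k) (x : P.X n), c • x = rightAct k R (P.X n) x (algebraMap k R c) := by
    intro n c x
    rw [Algebra.algebraMap_eq_smul_one, map_smul]
    simp [rightAct_apply, ← Algebra.TensorProduct.one_def]
  -- The section ι : R → P₀ is right linear, hence determined by u = ι 1 through ι(r) = u r.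
  refine ⟨ι 1, fun n => { s n with map_smul' := fun c x => ?_ }, hs, fun x => ?_, h⟩
  · exact (congrArg (s n) (hk n c x)).trans ((hs n x _).trans (hk _ c _).symm)
  · have : rightAct k R (P.X 0) (ι 1) (P.ε x) = ι (P.ε x) :=
      (map_smul ι (op (P.ε x)) 1).symm.trans (congrArg ι (one_mul (P.ε x)))
    rw [this]
    exact h0 x

end RightModules

/-! ## The tensor square of a resolution -/

section TensorSquare

variable {k R : Type u} [Field k] [Ring R] [Algebra k R]

/-- Total differentials are linear over an arbitrary ring and so carry integer signs, whereas
diagonal maps carry signs in k. This passes between the two. -/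
theorem neg_one_pow_smul_eq {V : Type*} [AddCommGroup V] [Module k V] (p : ℕ) (v : V) :
    (-1 : k) ^ p • v = (-1 : ℤ) ^ p • v := by
  rcases neg_one_pow_eq_or ℤ p with h | h
  · have : (-1 : k) ^ p = 1 := by exact_mod_cast congrArg (Int.cast (R := k)) h
    rw [h, this, one_smul, one_smul]
  · have : (-1 : k) ^ p = -1 := by exact_mod_cast congrArg (Int.cast (R := k)) h
    rw [h, this, neg_smul, neg_smul, one_smul, one_smul]

namespace RelTensor

variable {M N M' N' M'' N'' : Type u}
  [AddCommGroup M] [Module k M] [Module (Env k R) M] [IsScalarTower k (Env k R) M]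
  [AddCommGroup N] [Module k N] [Module (Env k R) N] [IsScalarTower k (Env k R) N]
  [AddCommGroup M'] [Module k M'] [Module (Env k R) M'] [IsScalarTower k (Env k R) M']
  [AddCommGroup N'] [Module k N'] [Module (Env k R) N'] [IsScalarTower k (Env k R) N']
  [AddCommGroup M''] [Module k M''] [Module (Env k R) M''] [IsScalarTower k (Env k R) M'']
  [AddCommGroup N''] [Module k N''] [Module (Env k R) N''] [IsScalarTower k (Env k R) N'']

theorem _root_.SmashHH.map_leftAct (f : M →ₗ[Env k R] M') (r : R) (m : M) :
    f (leftAct k R M r m) = leftAct k R M' r (f m) := map_smul f _ m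

theorem _root_.SmashHH.map_rightAct (f : M →ₗ[Env k R] M') (r : R) (m : M) :
    f (rightAct k R M m r) = rightAct k R M' (f m) r := map_smul f _ m

theorem map_env_smul (f : M →ₗ[Env k R] M') (g : N →ₗ[Env k R] N') (e : Env k R)
    (z : RelTensor k R M N) : map f g (e • z) = e • map f g z := by
  induction e using TensorProduct.induction_on with
  | zero =>
    have h : (0 : Env k R) • map f g z = 0 := Module.zero_smul _
    exact (congrArg (map f g) (Module.zero_smul z)).trans ((map_zero (map f g)).trans h.symm)
  | add a b ha hb => rw [add_smul, map_add, ha, hb, add_smul]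
  | tmul r s =>
    obtain ⟨t, rfl⟩ := proj_surjective z
    rw [env_smul_proj]
    induction t with
    | zero => simp
    | add x y hx hy => simp only [map_add, smul_add, hx, hy]
    | tmul m n =>
      rw [outerAct_tmul, map_proj, map_proj, env_smul_proj, outerAct_tmul, SmashHH.map_leftAct,
        SmashHH.map_rightAct]

/-- The map `f ⊗_R g` as a bimodule map. -/
def mapEnv (f : M →ₗ[Env k R] M') (g : N →ₗ[Env k R] N') :
    RelTensor k R M N →ₗ[Env k R] RelTensor k R M' N' :=
  { map f g with map_smul' := map_env_smul f g }

@[simp] theorem mapEnv_apply (f : M →ₗ[Env k R] M') (g : N →ₗ[Env k R] N')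
    (z : RelTensor k R M N) : mapEnv f g z = map f g z := rfl

theorem map_map (f : M →ₗ[Env k R] M') (g : N →ₗ[Env k R] N') (f' : M' →ₗ[Env k R] M'')
    (g' : N' →ₗ[Env k R] N'') (z : RelTensor k R M N) :
    map f' g' (map f g z) = map (f' ∘ₗ f) (g' ∘ₗ g) z := by
  have : map f' g' ∘ₗ map f g = map (f' ∘ₗ f) (g' ∘ₗ g) := ext fun m n => rfl
  exact LinearMap.congr_fun this z

theorem map_eq_zero_left (f : M →ₗ[Env k R] M') (g : N →ₗ[Env k R] N') (hf : ∀ x, f x = 0)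
    (z : RelTensor k R M N) : map f g z = 0 := by
  have : map f g = 0 := ext fun m n => by simp [hf]
  exact LinearMap.congr_fun this z

theorem map_eq_zero_right (f : M →ₗ[Env k R] M') (g : N →ₗ[Env k R] N') (hg : ∀ x, g x = 0)
    (z : RelTensor k R M N) : map f g z = 0 := by
  have : map f g = 0 := ext fun m n => by simp [hg]
  exact LinearMap.congr_fun this z

/-- The map `f ⊗_R N` for a right linear map `f`. -/
def mapLeft (f : M →ₗ[k] M') (hf : ∀ m r, f (rightAct k R M m r) = rightAct k R M' (f m) r) :
    RelTensor k R M N →ₗ[k] RelTensor k R M' N :=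
  lift (((TensorProduct.mk k M' N).compr₂ (proj k R M' N)).comp f) (fun m r n => by
    have := proj_balanced (k := k) (R := R) (f m) r n
    rw [← hf] at this
    exact this)

end RelTensor

theorem leftAct_mul {M : Type u} [AddCommGroup M] [Module k M] [Module (Env k R) M]
    [IsScalarTower k (Env k R) M] (r s : R) (m : M) :
    leftAct k R M (r * s) m = leftAct k R M r (leftAct k R M s m) := by
  simp [leftAct_apply, smul_smul]

theorem rightAct_mul {M : Type u} [AddCommGroup M] [Module k M] [Module (Env k R) M]
    [IsScalarTower k (Env k R) M] (r s : R) (m : M) :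
    rightAct k R M m (r * s) = rightAct k R M (rightAct k R M m r) s := by
  simp [rightAct_apply, smul_smul]

namespace BimodRes

variable (P : BimodRes k R)

/-- The entries of `P ⊗_R P`. -/
abbrev Sq (p q : ℕ) : Type u := RelTensor k R (P.X p) (P.X q)

/-- The differential of `P ⊗_R P`. -/
def sqD (n : ℕ) : Tot (Env k R) P.Sq (n + 1) →ₗ[Env k R] Tot (Env k R) P.Sq n :=
  Tot.d (fun p _ => RelTensor.mapEnv (P.d p) LinearMap.id)
    (fun _ q => RelTensor.mapEnv LinearMap.id (P.d q)) n

theorem sqD_val (n p q : ℕ) (z : Tot (Env k R) P.Sq (n + 1)) :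
    (P.sqD n z).1 p q = RelTensor.map (P.d p) LinearMap.id (z.1 (p + 1) q) +
      (-1 : ℤ) ^ p • RelTensor.map LinearMap.id (P.d q) (z.1 p (q + 1)) := rfl

/-- The map `P_0 ⊗_R P_q → P_q` given by the augmentation. -/
def sqAug (q : ℕ) : P.Sq 0 q →ₗ[k] P.X q :=
  RelTensor.lift ((leftAct k R (P.X q)).comp P.ε) (fun m r n => by
    rw [LinearMap.comp_apply, LinearMap.comp_apply, aug_rightAct, leftAct_mul])

@[simp] theorem sqAug_proj (q : ℕ) (m : P.X 0) (n : P.X q) :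
    P.sqAug q (RelTensor.proj k R _ _ (m ⊗ₜ n)) = leftAct k R (P.X q) (P.ε m) n := rfl

theorem sqAug_dv (q : ℕ) (z : P.Sq 0 (q + 1)) :
    P.sqAug q (RelTensor.map LinearMap.id (P.d q) z) = P.d q (P.sqAug (q + 1) z) := by
  have : P.sqAug q ∘ₗ RelTensor.map LinearMap.id (P.d q) =
      (P.d q).restrictScalars k ∘ₗ P.sqAug (q + 1) :=
    RelTensor.ext fun m n => (SmashHH.map_leftAct (P.d q) _ _).symm
  exact LinearMap.congr_fun this z

theorem sqAug_dh (q : ℕ) (z : P.Sq 1 q) :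
    P.sqAug q (RelTensor.map (P.d 0) LinearMap.id z) = 0 := by
  have : P.sqAug q ∘ₗ RelTensor.map (P.d 0) LinearMap.id = 0 :=
    RelTensor.ext fun m n => by simp [P.exact_zero.apply_apply_eq_zero m]
  exact LinearMap.congr_fun this z

theorem aug_sqAug (z : P.Sq 0 0) : P.ε (P.sqAug 0 z) =
    BimodHom.pair (P.aug (AlgHom.id k R)) (P.aug (AlgHom.id k R)) z := by
  have : P.ε ∘ₗ P.sqAug 0 =
      BimodHom.pair (P.aug (AlgHom.id k R)) (P.aug (AlgHom.id k R)) :=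
    RelTensor.ext fun m n => aug_leftAct P _ _
  exact LinearMap.congr_fun this z

/-- A right linear contraction s of P may be tensored over R with the identity of the second factor.
So the rows of P ⊗_R P contract onto the column P, with v ↦ u ⊗ v as section, and the only remaining
obstruction is the class of the augmented entry in P, which `hC` kills. -/
theorem mem_range_sqD (n : ℕ) (z : Tot (Env k R) P.Sq n) (hz : ∀ p q, p + q + 1 = n →
      RelTensor.map (P.d p) LinearMap.id (z.1 (p + 1) q) +
        (-1 : ℤ) ^ p • RelTensor.map LinearMap.id (P.d q) (z.1 p (q + 1)) = 0)
    (hC : ∃ v, P.d n v = P.sqAug n (z.1 0 n)) : z ∈ LinearMap.range (P.sqD n) := by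
  obtain ⟨u, s, hs, h0, h1⟩ := P.exists_right_contraction
  refine Tot.exact_of_contraction (C := P.X) _ _ (fun q => P.d q)
    (fun q => (P.sqAug q).toAddMonoidHom) (fun q v => RelTensor.proj k R _ _ (u ⊗ₜ v))
    (fun p q => (RelTensor.mapLeft (s p) (hs p)).toAddMonoidHom) ?_ ?_ ?_ ?_ n z hz hC
  · intro q x
    have : RelTensor.map (P.d 0) LinearMap.id ∘ₗ RelTensor.mapLeft (s 0) (hs 0) +
        (RelTensor.proj k R (P.X 0) (P.X q) ∘ₗ TensorProduct.mk k (P.X 0) (P.X q) u) ∘ₗ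
          P.sqAug q = LinearMap.id := by
      refine RelTensor.ext fun m n => ?_
      change RelTensor.proj k R _ _ (P.d 0 (s 0 m) ⊗ₜ n) +
        RelTensor.proj k R _ _ (u ⊗ₜ leftAct k R (P.X q) (P.ε m) n) = _
      rw [← RelTensor.proj_balanced, ← map_add, ← TensorProduct.add_tmul, h0]
      rfl
    exact LinearMap.congr_fun this x
  · intro p q x
    have : RelTensor.map (P.d (p + 1)) LinearMap.id ∘ₗ
          RelTensor.mapLeft (N := P.X q) (s (p + 1)) (hs (p + 1)) +
        RelTensor.mapLeft (s p) (hs p) ∘ₗ RelTensor.map (P.d p) LinearMap.id =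
          LinearMap.id := by
      refine RelTensor.ext fun m n => ?_
      change RelTensor.proj k R _ _ (P.d (p + 1) (s (p + 1) m) ⊗ₜ n) +
        RelTensor.proj k R _ _ (s p (P.d p m) ⊗ₜ n) = _
      rw [← map_add, ← TensorProduct.add_tmul, h1]
      rfl
    exact LinearMap.congr_fun this x
  · intro p q x
    have : RelTensor.map LinearMap.id (P.d q) ∘ₗ RelTensor.mapLeft (s p) (hs p) =
        RelTensor.mapLeft (s p) (hs p) ∘ₗ RelTensor.map LinearMap.id (P.d q) :=
      RelTensor.ext fun m n => rfl
    exact LinearMap.congr_fun this x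
  · intro q v
    rfl

theorem exact_sqD (n : ℕ) : Function.Exact (P.sqD (n + 1)) (P.sqD n) := by
  intro z
  constructor
  · intro h
    have hz : ∀ p q, RelTensor.map (P.d p) LinearMap.id (z.1 (p + 1) q) +
        (-1 : ℤ) ^ p • RelTensor.map LinearMap.id (P.d q) (z.1 p (q + 1)) = 0 := fun p q =>
      congrFun (congrFun (congrArg Subtype.val h) p) q
    refine P.mem_range_sqD (n + 1) z (fun p q _ => hz p q) ((P.exact_succ n _).1 ?_)
    -- In column 0 the horizontal term dies under the augmentation, which shows that the augmented
    -- entry is a cycle of P.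
    have h0 := congrArg (P.sqAug n) (hz 0 n)
    rw [map_add, sqAug_dh, zero_add, pow_zero, one_smul, sqAug_dv, map_zero] at h0
    exact h0
  · rintro ⟨w, rfl⟩
    refine Tot.d_d _ _ ?_ ?_ ?_ n w
    · intro p q x
      rw [RelTensor.mapEnv_apply, RelTensor.mapEnv_apply, RelTensor.map_map]
      exact RelTensor.map_eq_zero_left _ _ (fun y => (P.exact_succ p).apply_apply_eq_zero y) _
    · intro p q x
      rw [RelTensor.mapEnv_apply, RelTensor.mapEnv_apply, RelTensor.map_map]
      exact RelTensor.map_eq_zero_right _ _ (fun y => (P.exact_succ q).apply_apply_eq_zero y) _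
    · intro p q x
      simp only [RelTensor.mapEnv_apply, RelTensor.map_map]
      rfl

/-- In degree 0 the cycle condition is vacuous, and exactness at P₀ turns vanishing under ε ⊗ ε into
the boundary condition on the column. -/
theorem mem_range_sqD_zero (z : Tot (Env k R) P.Sq 0)
    (h : BimodHom.pair (P.aug (AlgHom.id k R)) (P.aug (AlgHom.id k R)) (z.1 0 0) = 0) :
    z ∈ LinearMap.range (P.sqD 0) :=
  P.mem_range_sqD 0 z (fun p q h => by omega) ((P.exact_zero _).1 (by rw [aug_sqAug, h]))

end BimodRes

end TensorSquare


/-! ## Comparison of resolutions -/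

section Comparison

variable {k : Type u} [Field k]

theorem ProjRes.d_d {S T : Type u} [Ring S] [Algebra k S] [AddCommGroup T] [Module k T]
    {act : S →ₐ[k] Module.End k T} (P : ProjRes k S T act) (n : ℕ) (x : P.X (n + 2)) :
    P.d n (P.d (n + 1) x) = 0 := (P.exact_succ n).apply_apply_eq_zero x

theorem ProjRes.exists_lift {S T : Type u} [Ring S] [Algebra k S] [AddCommGroup T] [Module k T]
    {act : S →ₐ[k] Module.End k T} (P Q : ProjRes k S T act) :
    ∃ f : ∀ n, P.X n →ₗ[S] Q.X n, (∀ x, Q.ε (f 0 x) = P.ε x) ∧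
      ∀ n x, Q.d n (f (n + 1) x) = f n (P.d n x) := by
  -- The representation on T is made into a module structure, so that ε becomes S-linear and the
  -- lifting property applies to it.
  let : Module S T := Module.compHom T act.toRingHom
  have := P.projective
  obtain ⟨f₀, hf₀⟩ := exists_lift_of_range (S := S) { Q.ε with map_smul' := Q.ε_smul }
    { P.ε with map_smul' := P.ε_smul } fun x => Q.ε_surjective (P.ε x)
  have hf : ∀ x, Q.ε (f₀ x) = P.ε x := hf₀
  obtain ⟨f, rfl, h⟩ := exists_chainMap P.d Q.d P.d_d Q.exact_succ f₀ fun x =>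
    (Q.exact_zero _).1 (by rw [hf, P.exact_zero.apply_apply_eq_zero])
  exact ⟨f, hf, h⟩

variable {R B : Type u} [Ring R] [Algebra k R] [Ring B] [Algebra k B] (j : R →ₐ[k] B)

theorem hochschild_d_apply (P : BimodRes k R) (Δ : BimodDiagonal P) (n : ℕ)
    (f : BimodHom j (P.X n)) (x : P.X (n + 1)) :
    ((hochschild j P Δ).d n f : BimodHom j (P.X (n + 1))).1 x = (-(-1 : k) ^ n) • f.1 (P.d n x) :=
  rfl

theorem neg_neg_one_pow_mul_self (n : ℕ) : (-(-1 : k) ^ n) * (-(-1 : k) ^ n) = 1 := by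
  rw [neg_mul_neg, ← mul_pow]
  simp

theorem cocycle_apply_d (P : BimodRes k R) (Δ : BimodDiagonal P) {n : ℕ}
    {f : BimodHom j (P.X n)} (hf : (hochschild j P Δ).d n f = 0) (x : P.X (n + 1)) :
    f.1 (P.d n x) = 0 := by
  have h : (-(-1 : k) ^ n) • f.1 (P.d n x) = 0 :=
    LinearMap.congr_fun (congrArg Subtype.val hf) x
  rw [← one_smul k (f.1 (P.d n x)), ← neg_neg_one_pow_mul_self n, mul_smul, h, smul_zero]

theorem mem_coboundaries_zero (P : BimodRes k R) (Δ : BimodDiagonal P) {f : BimodHom j (P.X 0)}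
    (hf : ∀ x, f.1 x = 0) :
    (f : (hochschild j P Δ).C 0) ∈ (hochschild j P Δ).coboundaries 0 :=
  Subtype.ext (LinearMap.ext hf)

theorem mem_coboundaries_succ (P : BimodRes k R) (Δ : BimodDiagonal P) {n : ℕ}
    {f : BimodHom j (P.X (n + 1))} (g : BimodHom j (P.X n)) (hf : ∀ x, f.1 x = g.1 (P.d n x)) :
    (f : (hochschild j P Δ).C (n + 1)) ∈ (hochschild j P Δ).coboundaries (n + 1) := by
  refine ⟨((-(-1 : k) ^ n) • g : BimodHom j (P.X n)), Subtype.ext (LinearMap.ext fun x => ?_)⟩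
  rw [hf, hochschild_d_apply]
  change (-(-1 : k) ^ n) • (-(-1 : k) ^ n) • g.1 (P.d n x) = g.1 (P.d n x)
  rw [smul_smul, neg_neg_one_pow_mul_self, one_smul]

/-- The endomorphism g f of P lies over the identity, so g f − id = d h + h d. A cocycle a kills a d
h, and a h d is a coboundary. -/
theorem comp_sub_mem_coboundaries {P Q : BimodRes k R} (Δ : BimodDiagonal P)
    (f : ∀ n, P.X n →ₗ[Env k R] Q.X n) (hf₀ : ∀ x, Q.ε (f 0 x) = P.ε x)
    (hf : ∀ n x, Q.d n (f (n + 1) x) = f n (P.d n x))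
    (g : ∀ n, Q.X n →ₗ[Env k R] P.X n) (hg₀ : ∀ x, P.ε (g 0 x) = Q.ε x)
    (hg : ∀ n x, P.d n (g (n + 1) x) = g n (Q.d n x)) (n : ℕ) (a : BimodHom j (P.X n))
    (ha : (hochschild j P Δ).d n a = 0) :
    (BimodHom.precomp (f n) (BimodHom.precomp (g n) a) - a : BimodHom j (P.X n)) ∈
      (hochschild j P Δ).coboundaries n := by
  have := P.projective
  obtain ⟨h, h0, h1⟩ := exists_homotopy P.d P.d P.d_d P.exact_succ
    (fun n => g n ∘ₗ f n - LinearMap.id)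
    (fun n x => by
      simp only [LinearMap.sub_apply, LinearMap.comp_apply, LinearMap.id_apply, map_sub, hg, hf])
    (fun x => (P.exact_zero _).1 (by simp [hf₀, hg₀]))
  have key : ∀ x, (BimodHom.precomp (f n) (BimodHom.precomp (g n) a) - a).1 x =
      a.1 ((g n ∘ₗ f n - LinearMap.id : P.X n →ₗ[Env k R] P.X n) x) := fun x => (map_sub a.1 _ _).symm
  cases n with
  | zero =>
    refine mem_coboundaries_zero j P Δ fun x => ?_
    rw [key, ← h0]
    exact cocycle_apply_d j P Δ ha _
  | succ n =>
    refine mem_coboundaries_succ j P Δ (BimodHom.precomp (h n) a) fun x => ?_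
    rw [key, ← h1, map_add, cocycle_apply_d j P Δ ha, zero_add]
    rfl

/-- A chain map over the identity is compatible with diagonal maps up to homotopy. -/
theorem exists_diagonal_homotopy {P Q : BimodRes k R} (Δ : BimodDiagonal P) (Δ' : BimodDiagonal Q)
    (f : ∀ n, P.X n →ₗ[Env k R] Q.X n) (hf₀ : ∀ x, Q.ε (f 0 x) = P.ε x)
    (hf : ∀ n x, Q.d n (f (n + 1) x) = f n (P.d n x)) :
    ∃ h : ∀ n, P.X n →ₗ[Env k R] Tot (Env k R) Q.Sq (n + 1),
      (∀ x, (Q.sqD 0 (h 0 x)).1 0 0 =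
        Δ'.ω 0 0 0 (f 0 x) - RelTensor.map (f 0) (f 0) (Δ.ω 0 0 0 x)) ∧
      ∀ n p q x, (Q.sqD (n + 1) (h (n + 1) x)).1 p q + (h n (P.d n x)).1 p q =
        Δ'.ω (n + 1) p q (f (n + 1) x) - RelTensor.map (f p) (f q) (Δ.ω (n + 1) p q x) := by
  have := P.projective
  -- The difference of the two chain maps Δ' f and (f ⊗ f) Δ from P to Q ⊗_R Q, both of which lift
  -- the identity of R.
  let G : ∀ n, P.X n →ₗ[Env k R] Tot (Env k R) Q.Sq n := fun n =>
    LinearMap.codRestrict (Tot (Env k R) Q.Sq n)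
      (LinearMap.pi fun p => LinearMap.pi fun q => Δ'.ω n p q ∘ₗ f n -
        RelTensor.mapEnv (f p) (f q) ∘ₗ Δ.ω n p q) (fun x p q h => by
          simp [Δ.shape n p q h, Δ'.shape n p q h])
  have hG : ∀ n x p q, (G n x).1 p q =
    Δ'.ω n p q (f n x) - RelTensor.map (f p) (f q) (Δ.ω n p q x) := fun n x p q => rfl
  have hc1 : ∀ p, Q.d p ∘ₗ f (p + 1) = f p ∘ₗ P.d p := fun p => LinearMap.ext (hf p)
  obtain ⟨h, h0, h1⟩ := exists_homotopy P.d Q.sqD P.d_d Q.exact_sqD G (fun n x => by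
      refine Subtype.ext ?_
      funext p q
      rw [BimodRes.sqD_val, hG, hG, hG, map_sub, map_sub, ← hf, Δ'.comm, Δ.comm,
        neg_one_pow_smul_eq, neg_one_pow_smul_eq, map_add, map_zsmul]
      simp only [RelTensor.map_map, hc1, smul_sub, LinearMap.id_comp, LinearMap.comp_id]
      abel) (fun x => by
      -- Both diagonals become ε after augmentation, so in degree 0 the difference is killed by ε ⊗
      -- ε.
      refine Q.mem_range_sqD_zero _ ?_
      rw [hG, map_sub, Δ'.aug, BimodHom.pair_map]
      have e : BimodHom.precomp (f 0) (Q.aug (AlgHom.id k R)) = P.aug (AlgHom.id k R) :=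
        Subtype.ext (LinearMap.ext hf₀)
      rw [e, Δ.aug, hf₀, sub_self])
  refine ⟨h, fun x => ?_, fun n p q x => ?_⟩
  · rw [h0, hG]
  · rw [← hG, ← h1]
    rfl

/-- Each summand of the differential of Q ⊗_R Q applies d to one tensor factor, where one of the two
cocycles annihilates it. -/
theorem pair_sqD {Q : BimodRes k R} (Δ' : BimodDiagonal Q) {m n : ℕ} {a : BimodHom j (Q.X m)}
    {b : BimodHom j (Q.X n)} (ha : (hochschild j Q Δ').d m a = 0)
    (hb : (hochschild j Q Δ').d n b = 0) (r : ℕ) (z : Tot (Env k R) Q.Sq (r + 1)) :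
    BimodHom.pair a b ((Q.sqD r z).1 m n) = 0 := by
  have ha' : BimodHom.precomp (Q.d m) a = 0 :=
    Subtype.ext (LinearMap.ext (cocycle_apply_d j Q Δ' ha))
  have hb' : BimodHom.precomp (Q.d n) b = 0 :=
    Subtype.ext (LinearMap.ext (cocycle_apply_d j Q Δ' hb))
  rw [BimodRes.sqD_val, map_add, map_zsmul, BimodHom.pair_map, BimodHom.pair_map, ha', hb']
  simp

/-- Pair the homotopy between Δ' f and (f ⊗ f) Δ with a ⊗ b. The part that is a boundary in Q ⊗_R Q
vanishes by `pair_sqD`; the part in which the homotopy follows the differential of P is a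
coboundary. -/
theorem precomp_mul_sub_mem_coboundaries {P Q : BimodRes k R} (Δ : BimodDiagonal P)
    (Δ' : BimodDiagonal Q) (f : ∀ n, P.X n →ₗ[Env k R] Q.X n) (hf₀ : ∀ x, Q.ε (f 0 x) = P.ε x)
    (hf : ∀ n x, Q.d n (f (n + 1) x) = f n (P.d n x)) (m n r : ℕ) (h : m + n = r)
    (a : BimodHom j (Q.X m)) (b : BimodHom j (Q.X n)) (ha : (hochschild j Q Δ').d m a = 0)
    (hb : (hochschild j Q Δ').d n b = 0) :
    (BimodHom.precomp (f r) ((hochschild j Q Δ').mul m n r h a b : BimodHom j (Q.X r)) -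
      (-1 : k) ^ (m * n) • BimodHom.cup (Δ.ω r m n) (BimodHom.precomp (f m) a)
        (BimodHom.precomp (f n) b) : BimodHom j (P.X r)) ∈ (hochschild j P Δ).coboundaries r := by
  obtain ⟨H, H0, H1⟩ := exists_diagonal_homotopy Δ Δ' f hf₀ hf
  have key : ∀ x, (BimodHom.precomp (f r) ((hochschild j Q Δ').mul m n r h a b : BimodHom j (Q.X r)) -
      (-1 : k) ^ (m * n) • BimodHom.cup (Δ.ω r m n) (BimodHom.precomp (f m) a)
        (BimodHom.precomp (f n) b) : BimodHom j (P.X r)).1 x = (-1 : k) ^ (m * n) • BimodHom.pair a b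
          (Δ'.ω r m n (f r x) - RelTensor.map (f m) (f n) (Δ.ω r m n x)) := fun x => by
    rw [map_sub, BimodHom.pair_map, smul_sub]
    rfl
  cases r with
  | zero =>
    obtain ⟨rfl, rfl⟩ : m = 0 ∧ n = 0 := by omega
    refine mem_coboundaries_zero j P Δ fun x => ?_
    rw [key, ← H0, pair_sqD j Δ' ha hb, smul_zero]
  | succ r =>
    -- The bounding cochain is a ⊗ b composed with component (m, n) of the homotopy.
    let w : BimodHom j (P.X r) := ⟨BimodHom.pair a b ∘ₗ ((Tot.comp (r + 1) m n :
        Tot (Env k R) Q.Sq (r + 1) →ₗ[Env k R] Q.Sq m n) ∘ₗ H r).restrictScalars k,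
      fun s t x => by
        have := BimodHom.pair_smul a b s t ((H r x).1 m n)
        refine Eq.trans ?_ this
        change BimodHom.pair a b ((H r ((s ⊗ₜ[k] op t) • x)).1 m n) = _
        rw [map_smul]
        rfl⟩
    refine mem_coboundaries_succ j P Δ ((-1 : k) ^ (m * n) • w) fun x => ?_
    rw [key, ← H1, map_add, pair_sqD j Δ' ha hb, zero_add]
    rfl

/-- Hochschild cohomology with its cup product does not depend on the resolution and the
diagonal map. -/
theorem hochschild_cohIso {P Q : BimodRes k R} (Δ : BimodDiagonal P) (Δ' : BimodDiagonal Q) :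
    DGAlg.CohIso (hochschild j P Δ) (hochschild j Q Δ') := by
  obtain ⟨f, hf₀, hf⟩ := P.exists_lift Q
  obtain ⟨g, hg₀, hg⟩ := Q.exists_lift P
  have comm : ∀ {P Q : BimodRes k R} (Δ : BimodDiagonal P) (Δ' : BimodDiagonal Q)
      (f : ∀ n, P.X n →ₗ[Env k R] Q.X n) (_ : ∀ n x, Q.d n (f (n + 1) x) = f n (P.d n x))
      (n : ℕ) (a : BimodHom j (Q.X n)),
      BimodHom.precomp (f (n + 1)) ((hochschild j Q Δ').d n a) =
        (hochschild j P Δ).d n (BimodHom.precomp (f n) a) := by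
    intro P Q Δ Δ' f hf n a
    refine Subtype.ext (LinearMap.ext fun x => ?_)
    change (-(-1 : k) ^ n) • a.1 (Q.d n (f (n + 1) x)) = (-(-1 : k) ^ n) • a.1 (f n (P.d n x))
    rw [hf]
  refine DGAlg.CohIso.of_chainMaps (D := hochschild j P Δ) (D' := hochschild j Q Δ')
    -- Cochains pull back, so the map from the complex of P to that of Q is given by g : Q → P, and
    -- its inverse up to homotopy by f.
    (fun n => BimodHom.precomp (g n)) (comm Δ' Δ g hg)
    (fun n => BimodHom.precomp (f n)) (comm Δ Δ' f hf)
    (comp_sub_mem_coboundaries j Δ f hf₀ hf g hg₀ hg)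
    (comp_sub_mem_coboundaries j Δ' g hg₀ hg f hf₀ hf)
    (precomp_mul_sub_mem_coboundaries j Δ' Δ g hg₀ hg) ?_
  refine mem_coboundaries_zero j Q Δ' fun x => ?_
  change j (P.ε (g 0 x)) - j (Q.ε x) = 0
  rw [hg₀, sub_self]

end Comparison


/-! ## Modules over a smash product -/

section Bialgebra

variable {k Γ A : Type u} [Field k] [Ring Γ] [Bialgebra k Γ] [Ring A] [Algebra k A]
  [Module Γ A] [IsScalarTower k Γ A] [IsModuleAlgebra k Γ A]

/-- The diagonal action on the tensor product of two representations. -/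
def diagHom {M N : Type u} [AddCommGroup M] [Module k M] [AddCommGroup N] [Module k N]
    (ρ : Γ →ₐ[k] Module.End k M) (ρ' : Γ →ₐ[k] Module.End k N) :
    Γ →ₐ[k] Module.End k (M ⊗[k] N) :=
  (Module.endTensorEndAlgHom (R := k) (S := k) (A := k) (M := M) (N := N)).comp
    ((Algebra.TensorProduct.map ρ ρ').comp (Bialgebra.comulAlgHom k Γ))

theorem diagHom_tmul {M N : Type u} [AddCommGroup M] [Module k M] [AddCommGroup N] [Module k N]
    (ρ : Γ →ₐ[k] Module.End k M) (ρ' : Γ →ₐ[k] Module.End k N) (γ : Γ) (m : M) (n : N) :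
    diagHom ρ ρ' γ (m ⊗ₜ n) =
      sweedler (TensorProduct.mk k M N) (ρ.toLinearMap.flip m) (ρ'.toLinearMap.flip n) γ := by
  rw [sweedler_apply _ _ _ (ℛ k γ)]
  simp only [diagHom, AlgHom.comp_apply, Bialgebra.comulAlgHom_apply]
  rw [← (ℛ k γ).eq, map_sum, map_sum, LinearMap.sum_apply]
  rfl

/-- The compatibility `γ (a m) = ∑ (γ₁ a) (γ₂ m)` of actions of `Γ` and `A` on `M`. -/
def Compatible {E : Type u} [Ring E] [Algebra k E] (f : A →ₐ[k] E) (ρ : Γ →ₐ[k] E) : Prop :=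
  ∀ (γ : Γ) (a : A), ρ γ * f a =
    sweedler (LinearMap.mul k E) (f.toLinearMap ∘ₗ orbit k a) ρ.toLinearMap γ

/-- Since A acts on the first factor only, coassociativity lets the leading legs of γ absorb a and
leaves the factor N untouched. This is used twice, to adjoin Γ and then L to K. -/
theorem Compatible.diagHom {M N : Type u} [AddCommGroup M] [Module k M] [AddCommGroup N]
    [Module k N] {f : A →ₐ[k] Module.End k M} {ρ : Γ →ₐ[k] Module.End k M} (h : Compatible f ρ)
    (ρ' : Γ →ₐ[k] Module.End k N) :
    Compatible ((Module.End.rTensorAlgHom k M N).comp f) (diagHom ρ ρ') := by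
  intro γ a
  refine TensorProduct.ext' fun m n => ?_
  have e : ρ.toLinearMap.flip (f a m) = sweedler (LinearMap.id (R := k) (M := Module.End k M))
      (f.toLinearMap ∘ₗ orbit (Γ := Γ) k a) (ρ.toLinearMap.flip m) := by
    ext x
    have := LinearMap.congr_fun (h x a) m
    rw [sweedler_apply _ _ _ (ℛ k x), LinearMap.sum_apply] at this
    rw [sweedler_apply _ _ _ (ℛ k x)]
    exact this
  change SmashHH.diagHom ρ ρ' γ (f a m ⊗ₜ n) = _
  rw [diagHom_tmul, e, sweedler_assoc _ _ (TensorProduct.mk k M N) (LinearMap.rTensorHom N)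
    (fun _ _ _ => rfl), sweedler_apply _ _ _ (ℛ k γ), sweedler_apply _ _ _ (ℛ k γ),
    LinearMap.sum_apply]
  refine Finset.sum_congr rfl fun i _ => ?_
  rw [LinearMap.mul_apply', Module.End.mul_apply, AlgHom.toLinearMap_apply, diagHom_tmul]
  rfl

namespace SmashProduct

theorem lift_mulHom {E : Type u} [Ring E] [Algebra k E] (f : A →ₐ[k] E) (ρ : Γ →ₐ[k] E)
    (h : Compatible f ρ) (x y : A ⊗[k] Γ) :
    TensorProduct.lift ((LinearMap.mul k E).compl₁₂ f.toLinearMap ρ.toLinearMap)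
        (mulHom k Γ A x y) =
      TensorProduct.lift ((LinearMap.mul k E).compl₁₂ f.toLinearMap ρ.toLinearMap) x *
        TensorProduct.lift ((LinearMap.mul k E).compl₁₂ f.toLinearMap ρ.toLinearMap) y := by
  induction x with
  | zero => simp
  | add x x' hx hx' => simp only [map_add, LinearMap.add_apply, hx, hx', add_mul]
  | tmul a γ =>
    induction y with
    | zero => simp
    | add y y' hy hy' => simp only [map_add, hy, hy', mul_add]
    | tmul b δ =>
      rw [mulHom_tmul_tmul k a b γ δ (ℛ k γ), map_sum]
      have e := congrArg (fun t => f a * t * ρ δ) (h γ b)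
      rw [sweedler_apply _ _ _ (ℛ k γ)] at e
      simp only [Finset.mul_sum, Finset.sum_mul] at e
      simp only [lift.tmul, LinearMap.compl₁₂_apply, LinearMap.mul_apply',
        AlgHom.toLinearMap_apply, map_mul]
      simp only [LinearMap.mul_apply', LinearMap.comp_apply, AlgHom.toLinearMap_apply,
        orbit_apply, mul_assoc] at e ⊢
      exact e.symm

/-- Compatible algebra maps from `A` and `Γ` induce an algebra map from the smash product. -/
def lift {E : Type u} [Ring E] [Algebra k E] (f : A →ₐ[k] E) (ρ : Γ →ₐ[k] E)
    (h : Compatible f ρ) : SmashProduct k Γ A →ₐ[k] E :=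
  AlgHom.ofLinearMap
    (TensorProduct.lift ((LinearMap.mul k E).compl₁₂ f.toLinearMap ρ.toLinearMap) :
      A ⊗[k] Γ →ₗ[k] E)
    (by
      change f 1 * ρ 1 = 1
      rw [map_one, map_one, one_mul])
    (lift_mulHom f ρ h)

theorem lift_inl {E : Type u} [Ring E] [Algebra k E] (f : A →ₐ[k] E) (ρ : Γ →ₐ[k] E)
    (h : Compatible f ρ) (a : A) : lift f ρ h (inl k a) = f a := by
  change f a * ρ 1 = f a
  rw [map_one, mul_one]

theorem lift_inr {E : Type u} [Ring E] [Algebra k E] (f : A →ₐ[k] E) (ρ : Γ →ₐ[k] E)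
    (h : Compatible f ρ) (γ : Γ) : lift f ρ h (inr k γ) = ρ γ := by
  change f 1 * ρ γ = ρ γ
  rw [map_one, one_mul]

theorem inl_mul_inr (a : A) (γ : Γ) :
    inl k a * inr k γ = (a ⊗ₜ[k] γ : A ⊗[k] Γ) := by
  change mulHom k Γ A (a ⊗ₜ[k] (1 : Γ)) ((1 : A) ⊗ₜ[k] γ) = _
  rw [mulHom_inl_left, mul_one]

theorem induction {p : SmashProduct k Γ A → Prop} (x : SmashProduct k Γ A) (h0 : p 0)
    (hadd : ∀ x y, p x → p y → p (x + y)) (h : ∀ a γ, p (inl k a * inr k γ)) : p x := by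
  induction x using TensorProduct.induction_on with
  | zero => exact h0
  | add x y hx hy => exact hadd x y hx hy
  | tmul a γ =>
    rw [← inl_mul_inr]
    exact h a γ

end SmashProduct

/-! ### The right action on `K ⊗ Γ` -/

section RightAction

variable (K : Type u) [AddCommGroup K] [Module k K] [Module (Env k A) K]
  [IsScalarTower k (Env k A) K]

/-- The right action `(x ⊗ δ) (a ⊗ γ) = ∑ x (δ₁ a) ⊗ δ₂ γ` of the smash product on `K ⊗ Γ`. -/
def smashAct : K ⊗[k] Γ →ₗ[k] A ⊗[k] Γ →ₗ[k] K ⊗[k] Γ :=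
  TensorProduct.lift ((LinearMap.llcomp k (A ⊗[k] Γ) (A ⊗[k] Γ) (K ⊗[k] Γ)).compl₁₂
    ((LinearMap.rTensorHom Γ).comp (rightAct k A K)) (diagAct k A Γ).toLinearMap)

variable {K}

theorem smashAct_tmul (x : K) (δ : Γ) (r : A ⊗[k] Γ) :
    smashAct K (x ⊗ₜ δ) r = (rightAct k A K x).rTensor Γ (diagAct k A Γ δ r) := rfl

theorem smashAct_inr (x : K) (δ γ : Γ) :
    smashAct K (x ⊗ₜ δ) ((1 : A) ⊗ₜ[k] γ) = x ⊗ₜ (δ * γ) := by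
  change (rightAct k A K x).rTensor Γ (diagAct k A Γ δ ((1 : A) ⊗ₜ γ)) = _
  rw [diagAct_tmul, sweedler_counit_left _ _ _ (1 : A) (fun γ => IsModuleAlgebra.smul_one' γ)]
  change rightAct k A K x 1 ⊗ₜ (δ * γ) = _
  rw [rightAct_apply]
  congr 1
  exact one_smul (Env k A) x

theorem smashAct_inl (x : K) (δ : Γ) (a : A) :
    smashAct K (x ⊗ₜ δ) (a ⊗ₜ[k] (1 : Γ)) =
      sweedler (TensorProduct.mk k K Γ) (rightAct k A K x ∘ₗ orbit k a) LinearMap.id δ := by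
  change (rightAct k A K x).rTensor Γ (diagAct k A Γ δ (a ⊗ₜ 1)) = _
  rw [diagAct_tmul, sweedler_apply _ _ _ (ℛ k δ), sweedler_apply _ _ _ (ℛ k δ), map_sum]
  refine Finset.sum_congr rfl fun i _ => ?_
  simp

theorem smashAct_one (y : K ⊗[k] Γ) : smashAct K y ((1 : A) ⊗ₜ (1 : Γ)) = y := by
  induction y with
  | zero => simp
  | add x y hx hy => rw [map_add, LinearMap.add_apply, hx, hy]
  | tmul x δ => rw [smashAct_inr, mul_one]

theorem smashAct_rTensor (x : K) (z : A ⊗[k] Γ) (r : A ⊗[k] Γ) :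
    smashAct K ((rightAct k A K x).rTensor Γ z) r =
      (rightAct k A K x).rTensor Γ (SmashProduct.mulHom k Γ A z r) := by
  induction z with
  | zero => simp
  | add z z' hz hz' => simp only [map_add, LinearMap.add_apply, hz, hz']
  | tmul a γ =>
    rw [LinearMap.rTensor_tmul, smashAct_tmul, SmashProduct.mulHom_tmul,
      ← LinearMap.rTensor_comp_apply]
    congr 2
    exact LinearMap.ext fun b => (rightAct_mul a b x).symm

/-- The diagonal action of δ on A ⊗ Γ is left multiplication by 1 ⊗ δ, so the claim is associativity
of the smash product. -/
theorem mulHom_diagAct (δ : Γ) (r s : A ⊗[k] Γ) :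
    SmashProduct.mulHom k Γ A (diagAct k A Γ δ r) s =
      diagAct k A Γ δ (SmashProduct.mulHom k Γ A r s) := by
  have h : ∀ z : A ⊗[k] Γ,
      SmashProduct.mulHom k Γ A ((1 : A) ⊗ₜ δ) z = diagAct k A Γ δ z := fun z => by
    have e : LinearMap.mul k A 1 = LinearMap.id := LinearMap.ext fun a => one_mul a
    rw [SmashProduct.mulHom_tmul, e, LinearMap.rTensor_id, LinearMap.id_apply]
  rw [← h, ← h, SmashProduct.mulHom_assoc]

/-- K ⊗ Γ stands for K ⊗_A (A#Γ): acting by r on x ⊗ δ amounts to multiplying (1 ⊗ δ) r in A#Γ and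
letting its A-part act on x from the right. -/
theorem smashAct_mul (y : K ⊗[k] Γ) (r s : A ⊗[k] Γ) :
    smashAct K y (SmashProduct.mulHom k Γ A r s) = smashAct K (smashAct K y r) s := by
  induction y with
  | zero => simp
  | add x y hx hy => simp only [map_add, LinearMap.add_apply, hx, hy]
  | tmul x δ =>
    rw [smashAct_tmul, smashAct_tmul, smashAct_rTensor, mulHom_diagAct]

theorem smashAct_leftAct (a : A) (y : K ⊗[k] Γ) (r : A ⊗[k] Γ) :
    smashAct K ((leftAct k A K a).rTensor Γ y) r =
      (leftAct k A K a).rTensor Γ (smashAct K y r) := by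
  induction y with
  | zero => simp
  | add x y hx hy => simp only [map_add, LinearMap.add_apply, hx, hy]
  | tmul x δ =>
    rw [LinearMap.rTensor_tmul, smashAct_tmul, smashAct_tmul, ← LinearMap.rTensor_comp_apply]
    congr 2
    exact LinearMap.ext fun b => (leftAct_rightAct a b x).symm

variable [Module Γ K] [IsScalarTower k Γ K] [IsEquivariant k Γ A K]

/-- Equivariance gives γ(xc) = ∑ (γ₁x)(γ₂c), and coassociativity hands the remaining leg to the
factor Γ, where the definition of the right action reappears. -/
theorem diagAct_rTensor_rightAct (γ : Γ) (x : K) (z : A ⊗[k] Γ) :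
    diagAct k K Γ γ ((rightAct k A K x).rTensor Γ z) =
      smashAct K (sweedler (TensorProduct.mk k K Γ) (orbit k x) LinearMap.id γ) z := by
  induction z with
  | zero => exact (map_zero _).trans (map_zero _).symm
  | add z z' hz hz' =>
    rw [map_add, map_add, hz, hz']
    exact (map_add (smashAct K _) z z').symm
  | tmul c ε =>
    rw [LinearMap.rTensor_tmul, diagAct_tmul]
    have e1 : orbit k (rightAct k A K x c) =
        sweedler (rightAct k A K) (orbit k x) (orbit (Γ := Γ) k c) :=
      LinearMap.ext fun γ => IsEquivariant.smul_right γ c x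
    rw [e1, sweedler_assoc (rightAct k A K) (TensorProduct.mk k K Γ) (TensorProduct.mk k A Γ)
      ((LinearMap.rTensorHom Γ).comp (rightAct k A K)) (fun _ _ _ => rfl)]
    rw [sweedler_apply _ _ _ (ℛ k γ), sweedler_apply _ _ _ (ℛ k γ), map_sum, LinearMap.sum_apply]
    refine Finset.sum_congr rfl fun i _ => ?_
    rw [TensorProduct.mk_apply, smashAct_tmul, LinearMap.id_apply, diagAct_tmul]
    rfl

/-- Half of the bimodule axiom on K ⊗ Γ: left multiplication by Γ commutes with right multiplication
by A#Γ. -/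
theorem smashAct_diagAct (γ : Γ) (y : K ⊗[k] Γ) (r : A ⊗[k] Γ) :
    smashAct K (diagAct k K Γ γ y) r = diagAct k K Γ γ (smashAct K y r) := by
  induction y with
  | zero => simp
  | add x y hx hy => simp only [map_add, LinearMap.add_apply, hx, hy]
  | tmul x δ =>
    rw [smashAct_tmul, diagAct_rTensor_rightAct, diagAct_tmul, sweedler_apply _ _ _ (ℛ k γ),
      sweedler_apply _ _ _ (ℛ k γ), map_sum, map_sum, LinearMap.sum_apply, LinearMap.sum_apply]
    refine Finset.sum_congr rfl fun i _ => ?_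
    rw [TensorProduct.mk_apply, TensorProduct.mk_apply, smashAct_tmul, smashAct_tmul,
      ← Module.End.mul_apply, ← map_mul]
    rfl

variable (k Γ A K) in
/-- The left action of `A` on `K ⊗ Γ`. -/
def leftHom : A →ₐ[k] Module.End k (K ⊗[k] Γ) :=
  (Module.End.rTensorAlgHom k K Γ).comp
    ((Algebra.lsmul k k K : Env k A →ₐ[k] Module.End k K).comp
      (Algebra.TensorProduct.includeLeft : A →ₐ[k] Env k A))

theorem compatible_diagAct :
    Compatible (leftHom k Γ A K) (diagAct k K Γ : Γ →ₐ[k] Module.End k (K ⊗[k] Γ)) := by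
  have h : Compatible ((Algebra.lsmul k k K : Env k A →ₐ[k] Module.End k K).comp
      (Algebra.TensorProduct.includeLeft : A →ₐ[k] Env k A))
      (Algebra.lsmul k k K : Γ →ₐ[k] Module.End k K) := fun γ a => by
    refine LinearMap.ext fun x => ?_
    have := IsEquivariant.smul_left (k := k) γ a x
    rw [sweedler_apply _ _ _ (ℛ k γ)] at this ⊢
    rw [LinearMap.sum_apply]
    exact this
  exact h.diagHom (Algebra.lsmul k k Γ : Γ →ₐ[k] Module.End k Γ)

end RightAction

end Bialgebra


/-! ## The bimodule induced from an equivariant bimodule and a right module -/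

section Antipode

variable {k Γ : Type u} [Field k] [Ring Γ] [HopfAlgebra k Γ]
  (hS : Function.Bijective (HopfAlgebra.antipode k (A := Γ)))

/-- The inverse of the antipode as an algebra map `Γ → Γᵐᵒᵖ`. -/
def invAntipode : Γ →ₐ[k] Γᵐᵒᵖ :=
  (AlgEquiv.opComm (AlgEquiv.ofBijective (HopfAlgebra.antipodeAlgHomOp k Γ)
    (opEquiv.bijective.comp hS))).symm.toAlgHom

theorem antipode_invAntipode (γ : Γ) :
    HopfAlgebra.antipode k (unop (invAntipode hS γ)) = γ :=
  (AlgEquiv.opComm (AlgEquiv.ofBijective (HopfAlgebra.antipodeAlgHomOp k Γ)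
    (opEquiv.bijective.comp hS))).apply_symm_apply γ

/-- Apply S, which is injective and reverses products: S⁻¹(γ₂)γ₁ becomes S(γ₁)γ₂. -/
theorem sum_invAntipode_mul (γ : Γ) : ∑ i ∈ (ℛ k γ).index,
    unop (invAntipode hS ((ℛ k γ).right i)) * (ℛ k γ).left i = counit (R := k) γ • 1 := by
  refine hS.injective ?_
  rw [map_sum, map_smul, HopfAlgebra.antipode_one, ← HopfAlgebra.sum_antipode_mul_eq_smul (ℛ k γ)]
  exact Finset.sum_congr rfl fun i _ => by
    rw [HopfAlgebra.antipode_mul_antidistrib, antipode_invAntipode]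

theorem sum_mul_invAntipode (γ : Γ) : ∑ i ∈ (ℛ k γ).index,
    (ℛ k γ).right i * unop (invAntipode hS ((ℛ k γ).left i)) = counit (R := k) γ • 1 := by
  refine hS.injective ?_
  rw [map_sum, map_smul, HopfAlgebra.antipode_one, ← HopfAlgebra.sum_mul_antipode_eq_smul (ℛ k γ)]
  exact Finset.sum_congr rfl fun i _ => by
    rw [HopfAlgebra.antipode_mul_antidistrib, antipode_invAntipode]

theorem sweedler_counit_right {U V W : Type u} [AddCommGroup U] [Module k U] [AddCommGroup V]
    [Module k V] [AddCommGroup W] [Module k W] (β : U →ₗ[k] V →ₗ[k] W) (f : Γ →ₗ[k] U)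
    (g : Γ →ₗ[k] V) (b : V) (h : ∀ γ, g γ = counit (R := k) γ • b) (γ : Γ) :
    sweedler β f g γ = β (f γ) b := by
  rw [sweedler_apply _ _ _ (ℛ k γ)]
  have e : ∑ i ∈ (ℛ k γ).index, counit (R := k) ((ℛ k γ).right i) • (ℛ k γ).left i = γ := by
    have := congrArg (TensorProduct.rid k Γ) (sum_tmul_counit_eq (R := k) (ℛ k γ))
    rw [map_sum] at this
    simpa only [TensorProduct.rid_tmul, one_smul] using this
  conv_rhs => rw [← e]
  simp [h, map_sum]

/-- Coassociativity regroups the threefold coproduct so that Λ receives the last two legs, which it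
contracts to the counit. -/
theorem sweedler_sweedler_cancel {V W : Type u} [AddCommGroup V] [Module k V] [AddCommGroup W]
    [Module k W] (D : Γ →ₗ[k] V →ₗ[k] W) (Λ : Γ →ₗ[k] Γ →ₗ[k] V) (v : V)
    (hΛ : ∀ γ, ∑ i ∈ (ℛ k γ).index, Λ ((ℛ k γ).left i) ((ℛ k γ).right i) =
      counit (R := k) γ • v) (γ : Γ) :
    ∑ i ∈ (ℛ k γ).index, ∑ j ∈ (ℛ k ((ℛ k γ).left i)).index,
      D ((ℛ k ((ℛ k γ).left i)).left j)
        (Λ ((ℛ k ((ℛ k γ).left i)).right j) ((ℛ k γ).right i)) = D γ v := by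
  let T : Γ →ₗ[k] Γ →ₗ[k] Γ →ₗ[k] W :=
    LinearMap.mk₂ k (fun a b => D a ∘ₗ Λ b) (fun a a' b => by rw [map_add, LinearMap.add_comp])
      (fun c a b => by rw [map_smul, LinearMap.smul_comp])
      (fun a b b' => by rw [map_add, LinearMap.comp_add])
      (fun c a b => by rw [map_smul, LinearMap.comp_smul])
  have h := LinearMap.congr_fun (sweedler_assoc (TensorProduct.mk k Γ Γ) (TensorProduct.lift T) Λ D
    (fun _ _ _ => rfl) LinearMap.id LinearMap.id LinearMap.id) γ
  rw [sweedler_counit_right D LinearMap.id _ v (fun γ => by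
    rw [sweedler_apply _ _ _ (ℛ k γ)]
    exact hΛ γ), sweedler_apply _ _ _ (ℛ k γ)] at h
  refine Eq.trans (Finset.sum_congr rfl fun i _ => ?_) h
  rw [sweedler_apply _ _ _ (ℛ k _), map_sum, LinearMap.sum_apply]
  rfl

variable (L : Type u) [AddCommGroup L] [Module k L] [Module Γᵐᵒᵖ L] [IsScalarTower k Γᵐᵒᵖ L]

/-- The left action `γ l = l · S⁻¹(γ)` on a right module. -/
def invHom : Γ →ₐ[k] Module.End k L := (Algebra.lsmul k k L).comp (invAntipode hS)

variable {L}

variable {W : Type u} [AddCommGroup W] [Module k W]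

/-- Here l·S⁻¹(γ₃)γ₂ collapses, which makes the map given by the universal property Γ-linear. In
`cancel_invHom_smul` it is l·γ₃S⁻¹(γ₂) that collapses, which gives the relation among the
generators. -/
theorem cancel_smul_invHom (D : Γ →ₗ[k] L →ₗ[k] W) (l : L) (γ : Γ) :
    ∑ i ∈ (ℛ k γ).index, ∑ j ∈ (ℛ k ((ℛ k γ).left i)).index,
      D ((ℛ k ((ℛ k γ).left i)).left j) (op ((ℛ k ((ℛ k γ).left i)).right j) •
        invHom hS L ((ℛ k γ).right i) l) = D γ l := by
  refine sweedler_sweedler_cancel D (LinearMap.mk₂ k (fun b c => op b • invHom hS L c l)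
    (fun a a' b => by rw [op_add, add_smul]) (fun c a b => by rw [op_smul, smul_assoc])
    (fun a b b' => by rw [map_add, LinearMap.add_apply, smul_add])
    (fun c a b => by
      rw [map_smul (invHom hS L), LinearMap.smul_apply]
      exact (Algebra.lsmul k k L (op a)).map_smul c _)) l (fun γ => ?_) γ
  have h := congrArg (fun x => op x • l) (sum_invAntipode_mul hS γ)
  simp only [Finset.op_sum, op_mul, Finset.sum_smul, mul_smul, op_smul, op_one, smul_assoc, one_smul] at h
  exact h

theorem cancel_invHom_smul (D : Γ →ₗ[k] L →ₗ[k] W) (l : L) (γ : Γ) :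
    ∑ i ∈ (ℛ k γ).index, ∑ j ∈ (ℛ k ((ℛ k γ).left i)).index,
      D ((ℛ k ((ℛ k γ).left i)).left j) (invHom hS L ((ℛ k ((ℛ k γ).left i)).right j)
        (op ((ℛ k γ).right i) • l)) = D γ l := by
  refine sweedler_sweedler_cancel D (LinearMap.mk₂ k (fun b c => invHom hS L b (op c • l))
    (fun a a' b => by rw [map_add, LinearMap.add_apply])
    (fun c a b => by rw [map_smul (invHom hS L), LinearMap.smul_apply])
    (fun a b b' => by rw [op_add, add_smul, map_add])
    (fun c a b => by rw [op_smul, smul_assoc, (invHom hS L a).map_smul])) l (fun γ => ?_) γ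
  have h := congrArg (fun x => op x • l) (sum_mul_invAntipode hS γ)
  simp only [Finset.op_sum, op_mul, Finset.sum_smul, mul_smul, op_smul, op_one, smul_assoc, one_smul] at h
  exact h

end Antipode

section Induced

variable {k Γ A : Type u} [Field k] [Ring Γ] [HopfAlgebra k Γ]
  (hS : Function.Bijective (HopfAlgebra.antipode k (A := Γ))) [Ring A] [Algebra k A]
  [Module Γ A] [IsScalarTower k Γ A] [IsModuleAlgebra k Γ A]
  (L K : Type u) [AddCommGroup L] [Module k L] [Module Γᵐᵒᵖ L] [IsScalarTower k Γᵐᵒᵖ L]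
  [AddCommGroup K] [Module k K] [Module (Env k A) K] [IsScalarTower k (Env k A) K]
  [Module Γ K] [IsScalarTower k Γ K] [IsEquivariant k Γ A K]

/-- The bimodule over the smash product induced by `L` and `K`, on the space `K ⊗ Γ ⊗ L`. -/
def Ind (_ : Function.Bijective (HopfAlgebra.antipode k (A := Γ))) (L K : Type u)
    [AddCommGroup L] [Module k L] [AddCommGroup K] [Module k K] : Type u :=
  (K ⊗[k] Γ) ⊗[k] L

namespace Ind

instance : AddCommGroup (Ind hS L K) := inferInstanceAs (AddCommGroup ((K ⊗[k] Γ) ⊗[k] L))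

instance : Module k (Ind hS L K) := inferInstanceAs (Module k ((K ⊗[k] Γ) ⊗[k] L))

variable (A) in
/-- The left action of the smash product. -/
def leftRep : SmashProduct k Γ A →ₐ[k] Module.End k ((K ⊗[k] Γ) ⊗[k] L) :=
  SmashProduct.lift _ _ ((compatible_diagAct (k := k) (Γ := Γ) (A := A) (K := K)).diagHom
    (invHom hS L))

variable (Γ A) in
/-- The right action of the smash product. -/
def rightRep : (SmashProduct k Γ A)ᵐᵒᵖ →ₐ[k] Module.End k ((K ⊗[k] Γ) ⊗[k] L) :=
  (Module.End.rTensorAlgHom k (K ⊗[k] Γ) L).comp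
    (AlgHom.ofLinearMap ((smashAct K).flip ∘ₗ
        ((opLinearEquiv k : SmashProduct k Γ A ≃ₗ[k] _).symm.toLinearMap :
          (SmashProduct k Γ A)ᵐᵒᵖ →ₗ[k] A ⊗[k] Γ))
      (LinearMap.ext fun y => smashAct_one y)
      (fun r s => LinearMap.ext fun y => smashAct_mul y s.unop r.unop))

theorem leftRep_inl (a : A) (y : K ⊗[k] Γ) (l : L) :
    leftRep A hS L K (SmashProduct.inl k a) (y ⊗ₜ l) = (leftAct k A K a).rTensor Γ y ⊗ₜ l := by
  rw [leftRep, SmashProduct.lift_inl]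
  rfl

theorem leftRep_inr (γ : Γ) (z : (K ⊗[k] Γ) ⊗[k] L) :
    leftRep A hS L K (SmashProduct.inr k γ) z = diagHom (diagAct k K Γ) (invHom hS L) γ z := by
  rw [leftRep, SmashProduct.lift_inr]

theorem rightRep_tmul (r : SmashProduct k Γ A) (y : K ⊗[k] Γ) (l : L) :
    rightRep Γ A L K (op r) (y ⊗ₜ l) = smashAct K y r ⊗ₜ l := rfl

theorem leftRep_rightRep (r : SmashProduct k Γ A) (s : (SmashProduct k Γ A)ᵐᵒᵖ) :
    Commute (leftRep A hS L K r) (rightRep Γ A L K s) := by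
  obtain ⟨s, rfl⟩ := op_surjective s
  induction r using SmashProduct.induction with
  | h0 => rw [map_zero]; exact Commute.zero_left _
  | hadd x y hx hy => rw [map_add]; exact hx.add_left hy
  | h a γ =>
    rw [map_mul]
    refine Commute.mul_left ?_ ?_
    · refine TensorProduct.ext' fun y l => ?_
      rw [Module.End.mul_apply, Module.End.mul_apply]
      rw [leftRep_inl, rightRep_tmul, rightRep_tmul, leftRep_inl]
      exact congrArg (· ⊗ₜ[k] l) (smashAct_leftAct a y s).symm
    · refine TensorProduct.ext' fun y l => ?_
      rw [Module.End.mul_apply, Module.End.mul_apply]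
      rw [leftRep_inr, rightRep_tmul, leftRep_inr, diagHom_tmul, diagHom_tmul,
        sweedler_apply _ _ _ (ℛ k γ), sweedler_apply _ _ _ (ℛ k γ), map_sum]
      refine Finset.sum_congr rfl fun i _ => ?_
      exact congrArg (· ⊗ₜ[k] invHom hS L ((ℛ k γ).right i) l)
        (smashAct_diagAct ((ℛ k γ).left i) y s).symm

variable (A) in
/-- The bimodule structure as a representation of the enveloping algebra. -/
def envRep : Env k (SmashProduct k Γ A) →ₐ[k] Module.End k ((K ⊗[k] Γ) ⊗[k] L) :=
  Algebra.TensorProduct.lift (leftRep A hS L K) (rightRep Γ A L K) (leftRep_rightRep hS L K)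

instance : Module (Env k (SmashProduct k Γ A)) (Ind hS L K) :=
  Module.compHom ((K ⊗[k] Γ) ⊗[k] L) (envRep A hS L K).toRingHom

instance : IsScalarTower k (Env k (SmashProduct k Γ A)) (Ind hS L K) where
  smul_assoc c e z := LinearMap.congr_fun (map_smul (envRep A hS L K) c e) z

variable {L K}

theorem leftAct_eq (r : SmashProduct k Γ A) (z : (K ⊗[k] Γ) ⊗[k] L) :
    leftAct k (SmashProduct k Γ A) (Ind hS L K) r z = leftRep A hS L K r z := by
  change envRep A hS L K (r ⊗ₜ 1) z = _
  rw [envRep, Algebra.TensorProduct.lift_tmul, map_one, mul_one]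

theorem rightAct_eq (r : SmashProduct k Γ A) (z : (K ⊗[k] Γ) ⊗[k] L) :
    rightAct k (SmashProduct k Γ A) (Ind hS L K) z r = rightRep Γ A L K (op r) z := by
  change envRep A hS L K (1 ⊗ₜ op r) z = _
  rw [envRep, Algebra.TensorProduct.lift_tmul, map_one, one_mul]

end Ind

end Induced


/-! ### The universal property of the induced bimodule -/

section Universal

variable {k Γ A : Type u} [Field k] [Ring Γ] [HopfAlgebra k Γ] [Ring A] [Algebra k A]
  [Module Γ A] [IsScalarTower k Γ A] [IsModuleAlgebra k Γ A]

/-- The smash product is spanned by the products of elements of A and Γ, so linearity on each side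
may be tested on the two subalgebras separately. -/
theorem env_smul_of_smash {M N : Type u} [AddCommGroup M] [Module k M]
    [Module (Env k (SmashProduct k Γ A)) M] [IsScalarTower k (Env k (SmashProduct k Γ A)) M]
    [AddCommGroup N] [Module k N]
    [Module (Env k (SmashProduct k Γ A)) N] [IsScalarTower k (Env k (SmashProduct k Γ A)) N]
    (g : M →ₗ[k] N)
    (h1 : ∀ a x, g (leftAct k (SmashProduct k Γ A) M (SmashProduct.inl k a) x) =
      leftAct k (SmashProduct k Γ A) N (SmashProduct.inl k a) (g x))
    (h2 : ∀ γ x, g (leftAct k (SmashProduct k Γ A) M (SmashProduct.inr k γ) x) =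
      leftAct k (SmashProduct k Γ A) N (SmashProduct.inr k γ) (g x))
    (h3 : ∀ a x, g (rightAct k (SmashProduct k Γ A) M x (SmashProduct.inl k a)) =
      rightAct k (SmashProduct k Γ A) N (g x) (SmashProduct.inl k a))
    (h4 : ∀ γ x, g (rightAct k (SmashProduct k Γ A) M x (SmashProduct.inr k γ)) =
      rightAct k (SmashProduct k Γ A) N (g x) (SmashProduct.inr k γ))
    (e : Env k (SmashProduct k Γ A)) (x : M) : g (e • x) = e • g x := by
  have hl : ∀ r x, g (leftAct k (SmashProduct k Γ A) M r x) =
      leftAct k (SmashProduct k Γ A) N r (g x) := fun r => by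
    induction r using SmashProduct.induction with
    | h0 => intro x; simp
    | hadd r s hr hs => intro x; simp only [map_add, LinearMap.add_apply, hr, hs]
    | h a γ => intro x; rw [leftAct_mul, leftAct_mul, h1, h2]
  have hr : ∀ r x, g (rightAct k (SmashProduct k Γ A) M x r) =
      rightAct k (SmashProduct k Γ A) N (g x) r := fun r => by
    induction r using SmashProduct.induction with
    | h0 => intro x; simp
    | hadd r s hr hs => intro x; simp only [map_add, hr, hs]
    | h a γ => intro x; rw [rightAct_mul, rightAct_mul, h4, h3]
  induction e using TensorProduct.induction_on with
  | zero =>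
    have h : (0 : Env k (SmashProduct k Γ A)) • g x = 0 := Module.zero_smul _
    exact (congrArg g (Module.zero_smul x)).trans ((map_zero g).trans h.symm)
  | add a b ha hb => rw [add_smul, map_add, ha, hb, add_smul]
  | tmul r s =>
    obtain ⟨s, rfl⟩ := op_surjective s
    rw [left_right_act, left_right_act, hl, hr]

variable {L K : Type u} [AddCommGroup L] [Module k L] [Module Γᵐᵒᵖ L] [IsScalarTower k Γᵐᵒᵖ L]
  [AddCommGroup K] [Module k K] [Module (Env k A) K] [IsScalarTower k (Env k A) K]
  [Module Γ K] [IsScalarTower k Γ K]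
  {M N : Type u} [AddCommGroup M] [Module k M]
  [Module (Env k (SmashProduct k Γ A)) M] [IsScalarTower k (Env k (SmashProduct k Γ A)) M]
  [AddCommGroup N] [Module k N]
  [Module (Env k (SmashProduct k Γ A)) N] [IsScalarTower k (Env k (SmashProduct k Γ A)) N]

variable (Γ A) in
/-- A bilinear map `L × K → M` which is `A`-bilinear in `K` and satisfies
`∑ γ₁ F(l γ₂, x) = ∑ F(l, γ₁ x) γ₂`. -/
structure IsGen (F : L →ₗ[k] K →ₗ[k] M) : Prop where
  left : ∀ l a x, F l (leftAct k A K a x) =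
    leftAct k (SmashProduct k Γ A) M (SmashProduct.inl k a) (F l x)
  right : ∀ l a x, F l (rightAct k A K x a) =
    rightAct k (SmashProduct k Γ A) M (F l x) (SmashProduct.inl k a)
  equiv : ∀ l x (γ : Γ), sweedler (leftAct k (SmashProduct k Γ A) M)
      (SmashProduct.inr (Γ := Γ) (A := A) k).toLinearMap (F.flip x ∘ₗ rightOrbit k l) γ =
    sweedler (rightAct k (SmashProduct k Γ A) M) (F l ∘ₗ orbit k x)
      (SmashProduct.inr (Γ := Γ) (A := A) k).toLinearMap γ

theorem IsGen.comp {F : L →ₗ[k] K →ₗ[k] M} (hF : IsGen Γ A F)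
    (g : M →ₗ[Env k (SmashProduct k Γ A)] N) : IsGen Γ A (F.compr₂ (g.restrictScalars k)) where
  left l a x := (congrArg g (hF.left l a x)).trans (map_leftAct g _ _)
  right l a x := (congrArg g (hF.right l a x)).trans (map_rightAct g _ _)
  equiv l x γ := by
    have h := congrArg g (hF.equiv l x γ)
    rw [sweedler_apply _ _ _ (ℛ k γ), sweedler_apply _ _ _ (ℛ k γ), map_sum, map_sum] at h
    simp only [map_leftAct, map_rightAct] at h
    rw [sweedler_apply _ _ _ (ℛ k γ), sweedler_apply _ _ _ (ℛ k γ)]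
    exact h

variable (hS : Function.Bijective (HopfAlgebra.antipode k (A := Γ))) [IsEquivariant k Γ A K]

namespace Ind

variable (L K) in
/-- The generators `x ⊗ 1 ⊗ l` of the induced bimodule. -/
def gen : L →ₗ[k] K →ₗ[k] Ind hS L K :=
  LinearMap.mk₂ k (fun l x => ((x ⊗ₜ[k] (1 : Γ)) ⊗ₜ[k] l : (K ⊗[k] Γ) ⊗[k] L))
    (fun l l' x => TensorProduct.tmul_add _ _ _)
    (fun c l x => TensorProduct.tmul_smul _ _ _)
    (fun l x x' => by
      rw [TensorProduct.add_tmul, TensorProduct.add_tmul]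
      rfl)
    (fun c l x => by
      rw [← TensorProduct.smul_tmul', ← TensorProduct.smul_tmul']
      rfl)

theorem gen_apply (l : L) (x : K) :
    gen L K hS l x = ((x ⊗ₜ[k] (1 : Γ)) ⊗ₜ[k] l : (K ⊗[k] Γ) ⊗[k] L) := rfl

theorem rightAct_inr_tmul (l : L) (x : K) (δ γ : Γ) :
    rightAct k (SmashProduct k Γ A) (Ind hS L K) ((x ⊗ₜ[k] δ) ⊗ₜ[k] l : (K ⊗[k] Γ) ⊗[k] L)
      (SmashProduct.inr k γ) = ((x ⊗ₜ[k] (δ * γ)) ⊗ₜ[k] l : (K ⊗[k] Γ) ⊗[k] L) := by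
  rw [rightAct_eq, rightRep_tmul]
  exact congrArg (· ⊗ₜ[k] l) (smashAct_inr (A := A) x δ γ)

theorem rightAct_gen (l : L) (x : K) (γ : Γ) :
    rightAct k (SmashProduct k Γ A) (Ind hS L K) (gen L K hS l x) (SmashProduct.inr k γ) =
      ((x ⊗ₜ[k] γ) ⊗ₜ[k] l : (K ⊗[k] Γ) ⊗[k] L) := by
  rw [gen_apply, rightAct_inr_tmul, one_mul]

theorem leftAct_inr_tmul (y : K ⊗[k] Γ) (l : L) (γ : Γ) :
    leftAct k (SmashProduct k Γ A) (Ind hS L K) (SmashProduct.inr k γ) (y ⊗ₜ[k] l :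
      (K ⊗[k] Γ) ⊗[k] L) = sweedler (TensorProduct.mk k (K ⊗[k] Γ) L)
        ((diagAct k K Γ).toLinearMap.flip y) ((invHom hS L).toLinearMap.flip l) γ := by
  rw [leftAct_eq, leftRep_inr, diagHom_tmul]

/-- Acting by γ₁ on y ⊗ lγ₂ puts an S⁻¹ next to γ₂ on the factor L, where the two cancel; only the
diagonal action on y survives. -/
theorem sweedler_leftAct_tmul (y : K ⊗[k] Γ) (l : L) (γ : Γ) :
    sweedler (leftAct k (SmashProduct k Γ A) (Ind hS L K)) (SmashProduct.inr (Γ := Γ) (A := A) k).toLinearMap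
      (TensorProduct.mk k (K ⊗[k] Γ) L y ∘ₗ rightOrbit k l) γ =
        diagAct k K Γ γ y ⊗ₜ[k] l := by
  rw [sweedler_apply _ _ _ (ℛ k γ)]
  refine Eq.trans (Finset.sum_congr rfl fun i _ => ?_) (cancel_invHom_smul hS
    ((TensorProduct.mk k (K ⊗[k] Γ) L).comp ((diagAct k K Γ).toLinearMap.flip y)) l γ)
  refine (leftAct_inr_tmul hS y _ _).trans ?_
  rw [sweedler_apply _ _ _ (ℛ k _)]
  rfl

theorem gen_leftAct (l : L) (a : A) (x : K) : gen L K hS l (leftAct k A K a x) =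
    leftAct k (SmashProduct k Γ A) (Ind hS L K) (SmashProduct.inl k a) (gen L K hS l x) := by
  refine Eq.trans ?_ (leftAct_eq hS _ ((x ⊗ₜ[k] (1 : Γ)) ⊗ₜ[k] l)).symm
  rw [leftRep_inl, LinearMap.rTensor_tmul]
  rfl

theorem gen_rightAct (l : L) (a : A) (x : K) : gen L K hS l (rightAct k A K x a) =
    rightAct k (SmashProduct k Γ A) (Ind hS L K) (gen L K hS l x) (SmashProduct.inl k a) := by
  refine Eq.trans ?_ (rightAct_eq hS _ ((x ⊗ₜ[k] (1 : Γ)) ⊗ₜ[k] l)).symm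
  rw [rightRep_tmul]
  refine congrArg (· ⊗ₜ[k] l) (?_ : _ = smashAct K (x ⊗ₜ[k] (1 : Γ)) (a ⊗ₜ[k] (1 : Γ)))
  rw [smashAct_tmul, map_one]
  rfl

/-- Both sides equal ∑ γ₁x ⊗ γ₂ ⊗ l: on the left S⁻¹ has cancelled the action on l, on the right γ₂
multiplies the factor Γ. -/
theorem sweedler_gen (l : L) (x : K) (γ : Γ) :
    sweedler (leftAct k (SmashProduct k Γ A) (Ind hS L K))
        (SmashProduct.inr (Γ := Γ) (A := A) k).toLinearMap
        ((gen L K hS).flip x ∘ₗ rightOrbit k l) γ =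
      sweedler (rightAct k (SmashProduct k Γ A) (Ind hS L K)) (gen L K hS l ∘ₗ orbit k x)
        (SmashProduct.inr (Γ := Γ) (A := A) k).toLinearMap γ := by
  refine (sweedler_leftAct_tmul hS (x ⊗ₜ[k] (1 : Γ)) l γ).trans ?_
  rw [diagAct_tmul, sweedler_apply _ _ _ (ℛ k γ), sweedler_apply _ _ _ (ℛ k γ),
    TensorProduct.sum_tmul]
  refine Finset.sum_congr rfl fun i _ => ?_
  rw [LinearMap.comp_apply, orbit_apply, AlgHom.toLinearMap_apply, rightAct_gen,
    TensorProduct.mk_apply, orbit_apply, smul_eq_mul, mul_one]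

theorem isGen_gen : IsGen Γ A (gen L K hS) where
  left := gen_leftAct hS
  right := gen_rightAct hS
  equiv := sweedler_gen hS

/-- The generators span under right multiplication by Γ, because x ⊗ γ ⊗ l is the generator of (l,
x) times γ. -/
theorem hom_ext {g g' : Ind hS L K →ₗ[Env k (SmashProduct k Γ A)] M}
    (h : ∀ l x, g (gen L K hS l x) = g' (gen L K hS l x)) : g = g' := by
  have e : (g.restrictScalars k : (K ⊗[k] Γ) ⊗[k] L →ₗ[k] M) = g'.restrictScalars k := by
    refine TensorProduct.ext_threefold fun x γ l => ?_
    have := congrArg (fun m => rightAct k (SmashProduct k Γ A) M m (SmashProduct.inr k γ)) (h l x)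
    simp only [← map_rightAct] at this
    rwa [rightAct_gen] at this
  exact LinearMap.ext fun z => LinearMap.congr_fun e z

variable (Γ A) in
/-- The linear map on the induced bimodule given by a bilinear map. -/
def liftMap (F : L →ₗ[k] K →ₗ[k] M) : (K ⊗[k] Γ) ⊗[k] L →ₗ[k] M :=
  TensorProduct.lift (TensorProduct.lift (LinearMap.mk₂ k
    (fun x γ => (rightAct k (SmashProduct k Γ A) M).flip (SmashProduct.inr k γ) ∘ₗ F.flip x)
    (fun x x' γ => by rw [map_add, LinearMap.comp_add])
    (fun c x γ => by rw [map_smul, LinearMap.comp_smul])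
    (fun x γ γ' => by rw [map_add, map_add, LinearMap.add_comp])
    (fun c x γ => by rw [map_smul, map_smul, LinearMap.smul_comp])))

theorem liftMap_tmul (F : L →ₗ[k] K →ₗ[k] M) (x : K) (γ : Γ) (l : L) :
    liftMap Γ A F ((x ⊗ₜ γ) ⊗ₜ l) =
      rightAct k (SmashProduct k Γ A) M (F l x) (SmashProduct.inr k γ) := rfl

/-- On generators this is the relation in `IsGen`. It spreads to x ⊗ δ by right multiplication with
δ, since left and right actions on M commute. -/
theorem liftMap_smash {F : L →ₗ[k] K →ₗ[k] M} (hF : IsGen Γ A F) (y : K ⊗[k] Γ) (l : L)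
    (γ : Γ) : sweedler (leftAct k (SmashProduct k Γ A) M) (SmashProduct.inr (Γ := Γ) (A := A) k).toLinearMap
        (liftMap Γ A F ∘ₗ TensorProduct.mk k (K ⊗[k] Γ) L y ∘ₗ rightOrbit k l) γ =
      liftMap Γ A F (diagAct k K Γ γ y ⊗ₜ l) := by
  induction y with
  | zero =>
    rw [sweedler_apply _ _ _ (ℛ k γ)]
    simp
  | add y y' hy hy' =>
    simp only [sweedler_apply _ _ _ (ℛ k γ), map_add, LinearMap.comp_add, LinearMap.add_comp,
      LinearMap.add_apply, Finset.sum_add_distrib, TensorProduct.add_tmul] at hy hy' ⊢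
    rw [hy, hy']
  | tmul x δ =>
    have h := congrArg (fun m => rightAct k (SmashProduct k Γ A) M m (SmashProduct.inr k δ))
      (hF.equiv l x γ)
    simp only [sweedler_apply _ _ _ (ℛ k γ), map_sum, LinearMap.sum_apply] at h
    rw [diagAct_tmul, sweedler_apply _ _ _ (ℛ k γ), sweedler_apply _ _ _ (ℛ k γ),
      TensorProduct.sum_tmul, map_sum]
    refine (Finset.sum_congr rfl fun i _ => ?_).trans
      (h.trans (Finset.sum_congr rfl fun i _ => ?_))
    · exact leftAct_rightAct _ _ _
    · rw [← rightAct_mul, TensorProduct.mk_apply, liftMap_tmul]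
      congr 1
      exact (map_mul (SmashProduct.inr (A := A) k) _ _).symm

/-- The universal property of the induced bimodule. -/
def lift (F : L →ₗ[k] K →ₗ[k] M) (hF : IsGen Γ A F) :
    Ind hS L K →ₗ[Env k (SmashProduct k Γ A)] M :=
  { liftMap Γ A F with
    map_smul' := env_smul_of_smash (M := Ind hS L K)
      (show Ind hS L K →ₗ[k] M from liftMap Γ A F)
      (fun a z => by
        have : liftMap Γ A F ∘ₗ leftRep A hS L K (SmashProduct.inl k a) =
            leftAct k (SmashProduct k Γ A) M (SmashProduct.inl k a) ∘ₗ liftMap Γ A F :=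
          TensorProduct.ext_threefold fun x γ l => by
            rw [LinearMap.comp_apply, leftRep_inl, LinearMap.rTensor_tmul, liftMap_tmul, hF.left,
              ← leftAct_rightAct]
            rfl
        exact (congrArg (liftMap Γ A F) (leftAct_eq hS _ z)).trans (LinearMap.congr_fun this z))
      (fun γ z => by
        have : liftMap Γ A F ∘ₗ leftRep A hS L K (SmashProduct.inr k γ) =
            leftAct k (SmashProduct k Γ A) M (SmashProduct.inr k γ) ∘ₗ liftMap Γ A F :=
          TensorProduct.ext' fun y l => by
            rw [LinearMap.comp_apply, leftRep_inr, diagHom_tmul, sweedler_apply _ _ _ (ℛ k γ),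
              map_sum]
            -- The value at γ(y ⊗ l) is a sum over γ₁y ⊗ l·S⁻¹(γ₂). Pulling γ₁ out of the first
            -- factor by `liftMap_smash` costs an extra leg acting on l, and S⁻¹ cancels precisely
            -- that leg.
            refine Eq.trans (Finset.sum_congr rfl fun i _ => ?_) (cancel_smul_invHom hS
              ((((leftAct k (SmashProduct k Γ A) M).comp
                (SmashProduct.inr (Γ := Γ) (A := A) k).toLinearMap).compl₂
                  (liftMap Γ A F ∘ₗ TensorProduct.mk k (K ⊗[k] Γ) L y))) l γ)
            refine (liftMap_smash hF y _ _).symm.trans ?_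
            rw [sweedler_apply _ _ _ (ℛ k _)]
            rfl
        exact (congrArg (liftMap Γ A F) (leftAct_eq hS _ z)).trans (LinearMap.congr_fun this z))
      (fun a z => by
        have : liftMap Γ A F ∘ₗ rightRep Γ A L K (op (SmashProduct.inl k a)) =
            (rightAct k (SmashProduct k Γ A) M).flip (SmashProduct.inl k a) ∘ₗ
              liftMap Γ A F :=
          TensorProduct.ext_threefold fun x γ l => by
            rw [LinearMap.comp_apply, LinearMap.comp_apply, liftMap_tmul, LinearMap.flip_apply,
              ← rightAct_mul, SmashProduct.inr_mul_inl, rightRep_tmul]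
            have e : smashAct K (x ⊗ₜ γ) (SmashProduct.inl k a) =
              sweedler (TensorProduct.mk k K Γ) (rightAct k A K x ∘ₗ orbit k a) LinearMap.id γ :=
                smashAct_inl x γ a
            rw [e, sweedler_apply _ _ _ (ℛ k γ), sweedler_apply _ _ _ (ℛ k γ),
              TensorProduct.sum_tmul, map_sum, map_sum]
            refine Finset.sum_congr rfl fun i _ => ?_
            rw [TensorProduct.mk_apply, liftMap_tmul, LinearMap.mul_apply', rightAct_mul]
            exact congrArg (fun m => rightAct k (SmashProduct k Γ A) M m _) (hF.right l _ x)
        exact (congrArg (liftMap Γ A F) (rightAct_eq hS _ z)).trans (LinearMap.congr_fun this z))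
      (fun γ z => by
        have : liftMap Γ A F ∘ₗ rightRep Γ A L K (op (SmashProduct.inr k γ)) =
            (rightAct k (SmashProduct k Γ A) M).flip (SmashProduct.inr k γ) ∘ₗ
              liftMap Γ A F :=
          TensorProduct.ext_threefold fun x δ l => by
            have e : smashAct (A := A) K (x ⊗ₜ δ) (SmashProduct.inr k γ) = x ⊗ₜ[k] (δ * γ) :=
              smashAct_inr x δ γ
            rw [LinearMap.comp_apply, LinearMap.comp_apply, liftMap_tmul, LinearMap.flip_apply,
              ← rightAct_mul, rightRep_tmul, e, liftMap_tmul, map_mul]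
        exact (congrArg (liftMap Γ A F) (rightAct_eq hS _ z)).trans (LinearMap.congr_fun this z)) }

@[simp] theorem lift_gen (F : L →ₗ[k] K →ₗ[k] M) (hF : IsGen Γ A F) (l : L) (x : K) :
    lift hS F hF (gen L K hS l x) = F l x := by
  change liftMap Γ A F ((x ⊗ₜ 1) ⊗ₜ l) = _
  rw [liftMap_tmul, map_one, rightAct_apply]
  exact one_smul (Env k (SmashProduct k Γ A)) _

end Ind

end Universal


theorem rightOrbit_apply {k Γ : Type u} [Field k] [Ring Γ] [Bialgebra k Γ] {M : Type u}
    [AddCommGroup M] [Module k M] [Module Γᵐᵒᵖ M] [IsScalarTower k Γᵐᵒᵖ M] (m : M) (γ : Γ) :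
    rightOrbit k m γ = op γ • m := rfl

/-! ### Conjugation of linear maps by the Hopf algebra -/

section Conjugation

variable {k Γ A : Type u} [Field k] [Ring Γ] [HopfAlgebra k Γ] [Ring A] [Algebra k A]
  [Module Γ A] [IsScalarTower k Γ A] [IsModuleAlgebra k Γ A]
  {L L' K K' : Type u} [AddCommGroup L] [Module k L] [Module Γᵐᵒᵖ L] [IsScalarTower k Γᵐᵒᵖ L]
  [AddCommGroup L'] [Module k L'] [Module Γᵐᵒᵖ L'] [IsScalarTower k Γᵐᵒᵖ L']
  [AddCommGroup K] [Module k K] [Module (Env k A) K] [IsScalarTower k (Env k A) K]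
  [Module Γ K] [IsScalarTower k Γ K]
  [AddCommGroup K'] [Module k K'] [Module (Env k A) K'] [IsScalarTower k (Env k A) K']
  [Module Γ K'] [IsScalarTower k Γ K']
  {M N : Type u} [AddCommGroup M] [Module k M]
  [Module (Env k (SmashProduct k Γ A)) M] [IsScalarTower k (Env k (SmashProduct k Γ A)) M]
  [AddCommGroup N] [Module k N]
  [Module (Env k (SmashProduct k Γ A)) N] [IsScalarTower k (Env k (SmashProduct k Γ A)) N]

theorem IsGen.precompL {F : L →ₗ[k] K →ₗ[k] M} (hF : IsGen Γ A F) (h : L' →ₗ[Γᵐᵒᵖ] L) :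
    IsGen Γ A (F ∘ₗ h.restrictScalars k) where
  left l a x := hF.left (h l) a x
  right l a x := hF.right (h l) a x
  equiv l x γ := by
    refine Eq.trans ?_ (hF.equiv (h l) x γ)
    rw [sweedler_apply _ _ _ (ℛ k γ), sweedler_apply _ _ _ (ℛ k γ)]
    refine Finset.sum_congr rfl fun i _ => ?_
    exact congrArg (fun l => leftAct k (SmashProduct k Γ A) M _ (F l x)) (map_smul h _ l)

theorem IsGen.precompK {F : L →ₗ[k] K →ₗ[k] M} (hF : IsGen Γ A F) (h : K' →ₗ[Env k A] K)
    (hh : ∀ (γ : Γ) x, h (γ • x) = γ • h x) :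
    IsGen Γ A (F.compl₂ (h.restrictScalars k)) where
  left l a x := (congrArg (F l) (map_leftAct h a x)).trans (hF.left l a (h x))
  right l a x := (congrArg (F l) (map_rightAct h a x)).trans (hF.right l a (h x))
  equiv l x γ := by
    refine (hF.equiv l (h x) γ).trans ?_
    rw [sweedler_apply _ _ _ (ℛ k γ), sweedler_apply _ _ _ (ℛ k γ)]
    refine Finset.sum_congr rfl fun i _ => ?_
    exact congrArg (fun x => rightAct k (SmashProduct k Γ A) M (F l x) _) (hh _ x).symm

theorem IsGen.zero : IsGen Γ A (0 : L →ₗ[k] K →ₗ[k] M) where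
  left l a x := by simp
  right l a x := by simp
  equiv l x γ := by
    rw [sweedler_apply _ _ _ (ℛ k γ), sweedler_apply _ _ _ (ℛ k γ)]
    simp

theorem IsGen.add {F G : L →ₗ[k] K →ₗ[k] M} (hF : IsGen Γ A F) (hG : IsGen Γ A G) :
    IsGen Γ A (F + G) where
  left l a x := by simp only [LinearMap.add_apply, map_add, hF.left, hG.left]
  right l a x := by simp only [LinearMap.add_apply, map_add, hF.right, hG.right]
  equiv l x γ := by
    have h1 := hF.equiv l x γ
    have h2 := hG.equiv l x γ
    rw [sweedler_apply _ _ _ (ℛ k γ), sweedler_apply _ _ _ (ℛ k γ)] at h1 h2 ⊢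
    simp only [LinearMap.comp_apply, LinearMap.flip_apply, LinearMap.add_apply, map_add,
      Finset.sum_add_distrib] at h1 h2 ⊢
    rw [h1, h2]

theorem IsGen.smul {F : L →ₗ[k] K →ₗ[k] M} (hF : IsGen Γ A F) (c : k) :
    IsGen Γ A (c • F) where
  left l a x := by simp only [LinearMap.smul_apply, map_smul, hF.left]
  right l a x := by simp only [LinearMap.smul_apply, map_smul, hF.right]
  equiv l x γ := by
    have h1 := hF.equiv l x γ
    rw [sweedler_apply _ _ _ (ℛ k γ), sweedler_apply _ _ _ (ℛ k γ)] at h1 ⊢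
    simp only [LinearMap.comp_apply, LinearMap.flip_apply, LinearMap.smul_apply, map_smul,
      ← Finset.smul_sum] at h1 ⊢
    rw [h1]

variable (Γ A) in
/-- The linear map `γ ↦ ∑ f(γ₁ x) γ₂`. -/
def rightTwist (f : K →ₗ[k] M) (x : K) : Γ →ₗ[k] M :=
  sweedler (rightAct k (SmashProduct k Γ A) M) (f ∘ₗ orbit k x)
    (SmashProduct.inr (Γ := Γ) (A := A) k).toLinearMap

variable (Γ A) in
/-- The linear map `γ ↦ ∑ S(γ₁) u(γ₂)`. -/
def antipodeTwist (u : Γ →ₗ[k] M) : Γ →ₗ[k] M :=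
  sweedler (leftAct k (SmashProduct k Γ A) M)
    ((SmashProduct.inr (Γ := Γ) (A := A) k).toLinearMap ∘ₗ HopfAlgebra.antipode k) u

variable (Γ A) in
/-- The linear map `γ ↦ ∑ γ₁ u(γ₂)`. -/
def leftTwist (u : Γ →ₗ[k] M) : Γ →ₗ[k] M :=
  sweedler (leftAct k (SmashProduct k Γ A) M)
    (SmashProduct.inr (Γ := Γ) (A := A) k).toLinearMap u

/-- The inclusion of Γ into A#Γ has its composite with S as convolution inverse, so convolving maps
Γ → M with it on the left is a bijection. The other composite is treated next. -/
theorem antipodeTwist_leftTwist (u : Γ →ₗ[k] M) :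
    antipodeTwist Γ A (leftTwist Γ A u) = u := by
  ext γ
  rw [antipodeTwist, leftTwist, ← sweedler_assoc (LinearMap.mul k (SmashProduct k Γ A))
    (leftAct k (SmashProduct k Γ A) M) _ _ (fun a b m => leftAct_mul a b m),
    sweedler_counit_left _ _ _ (1 : SmashProduct k Γ A)]
  · rw [leftAct_apply]
    exact one_smul (Env k (SmashProduct k Γ A)) _
  · intro γ
    rw [sweedler_apply _ _ _ (ℛ k γ)]
    have h := congrArg (SmashProduct.inr (Γ := Γ) (A := A) k)
      (HopfAlgebra.sum_antipode_mul_eq_smul (ℛ k γ))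
    rw [map_sum, map_smul, map_one] at h
    rw [← h]
    exact Finset.sum_congr rfl fun i _ => (map_mul (SmashProduct.inr (Γ := Γ) (A := A) k) _ _).symm

theorem leftTwist_antipodeTwist (u : Γ →ₗ[k] M) :
    leftTwist Γ A (antipodeTwist Γ A u) = u := by
  ext γ
  rw [antipodeTwist, leftTwist, ← sweedler_assoc (LinearMap.mul k (SmashProduct k Γ A))
    (leftAct k (SmashProduct k Γ A) M) _ _ (fun a b m => leftAct_mul a b m),
    sweedler_counit_left _ _ _ (1 : SmashProduct k Γ A)]
  · rw [leftAct_apply]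
    exact one_smul (Env k (SmashProduct k Γ A)) _
  · intro γ
    rw [sweedler_apply _ _ _ (ℛ k γ)]
    have h := congrArg (SmashProduct.inr (Γ := Γ) (A := A) k)
      (HopfAlgebra.sum_mul_antipode_eq_smul (ℛ k γ))
    rw [map_sum, map_smul, map_one] at h
    rw [← h]
    exact Finset.sum_congr rfl fun i _ => (map_mul (SmashProduct.inr (Γ := Γ) (A := A) k) _ _).symm

theorem leftTwist_injective : Function.Injective (leftTwist (k := k) Γ A (M := M)) :=
  Function.LeftInverse.injective (antipodeTwist_leftTwist (k := k))

variable (Γ A) in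
/-- The map `x ↦ ∑ S(γ₁) f(γ₂ x) γ₃`, as a linear map in `γ`. -/
def conj (f : K →ₗ[k] M) : Γ →ₗ[k] K →ₗ[k] M :=
  (LinearMap.mk₂ k (fun x γ => antipodeTwist Γ A (rightTwist Γ A f x) γ)
    (fun x x' γ => by
      simp only [antipodeTwist, rightTwist, sweedler_apply _ _ _ (ℛ k _), LinearMap.comp_apply,
        orbit_apply, smul_add, map_add, LinearMap.add_apply, Finset.sum_add_distrib])
    (fun c x γ => by
      simp only [antipodeTwist, rightTwist, sweedler_apply _ _ _ (ℛ k _), LinearMap.comp_apply,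
        orbit_apply, smul_comm _ c x, map_smul, LinearMap.smul_apply, ← Finset.smul_sum])
    (fun x γ γ' => map_add _ _ _) (fun c x γ => map_smul _ _ _)).flip

theorem leftTwist_conj (f : K →ₗ[k] M) (x : K) :
    leftTwist Γ A ((conj Γ A f).flip x) = rightTwist Γ A f x :=
  leftTwist_antipodeTwist _

/-- The conjugate of f is the only solution u of ∑ γ₁u(γ₂) = ∑ f(γ₁x)γ₂. The properties of `conj`
below come from this equation, which involves no antipode. -/
theorem conj_unique (f : K →ₗ[k] M) (x : K) (u : Γ →ₗ[k] M)
    (h : leftTwist Γ A u = rightTwist Γ A f x) : u = (conj Γ A f).flip x :=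
  leftTwist_injective (A := A) (h.trans (leftTwist_conj f x).symm)

theorem map_conj (p : M →ₗ[Env k (SmashProduct k Γ A)] N) (f : K →ₗ[k] M) (γ : Γ) (x : K) :
    p (conj Γ A f γ x) = conj Γ A (p.restrictScalars k ∘ₗ f) γ x := by
  change p (antipodeTwist Γ A (rightTwist Γ A f x) γ) =
    antipodeTwist Γ A (rightTwist Γ A (p.restrictScalars k ∘ₗ f) x) γ
  simp only [antipodeTwist, rightTwist, sweedler_apply _ _ _ (ℛ k _), map_sum, map_leftAct,
    map_rightAct, LinearMap.comp_apply, LinearMap.restrictScalars_apply]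

/-- The relation in `IsGen` says that γ ↦ F(lγ, x) solves the equation that characterizes the
conjugate of F(l). So the relation amounts to right Γ-linearity for the conjugation action. -/
theorem IsGen.conj_eq {F : L →ₗ[k] K →ₗ[k] M} (hF : IsGen Γ A F) (l : L) (γ : Γ) :
    conj Γ A (F l) γ = F (op γ • l) := by
  ext x
  exact (LinearMap.congr_fun (conj_unique (F l) x (F.flip x ∘ₗ rightOrbit k l)
    (LinearMap.ext fun γ => hF.equiv l x γ)) γ).symm

theorem inr_inl_leftAct (a : A) (u : Γ →ₗ[k] M) :
    leftTwist Γ A (leftAct k (SmashProduct k Γ A) M (SmashProduct.inl k a) ∘ₗ u) =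
      sweedler (leftAct k (SmashProduct k Γ A) M)
        ((SmashProduct.inl k).toLinearMap ∘ₗ orbit k a) (leftTwist Γ A u) := by
  rw [leftTwist, leftTwist, ← sweedler_assoc (LinearMap.mul k (SmashProduct k Γ A))
    (leftAct k (SmashProduct k Γ A) M) _ _ (fun a b m => leftAct_mul a b m)]
  ext γ
  rw [sweedler_apply _ _ _ (ℛ k γ), sweedler_apply _ _ _ (ℛ k γ)]
  refine Finset.sum_congr rfl fun i _ => ?_
  rw [← SmashProduct.inr_mul_inl, leftAct_mul]
  rfl

variable [IsEquivariant k Γ A K]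

/-- Both sides solve the same equation: moving γ past a gives ∑ (γ₁a) f(γ₂x)γ₃, which is ∑
f(γ₁(ax))γ₂ by equivariance of K. -/
theorem conj_leftAct (f : K →ₗ[k] M)
    (hf : ∀ a x, f (leftAct k A K a x) =
      leftAct k (SmashProduct k Γ A) M (SmashProduct.inl k a) (f x)) (γ : Γ) (a : A) (x : K) :
    conj Γ A f γ (leftAct k A K a x) =
      leftAct k (SmashProduct k Γ A) M (SmashProduct.inl k a) (conj Γ A f γ x) := by
  refine (LinearMap.congr_fun (conj_unique f (leftAct k A K a x)
    (leftAct k (SmashProduct k Γ A) M (SmashProduct.inl k a) ∘ₗ (conj Γ A f).flip x) ?_) γ).symm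
  have e : f ∘ₗ orbit k (leftAct k A K a x) = sweedler (leftAct k (SmashProduct k Γ A) M)
      ((SmashProduct.inl k).toLinearMap ∘ₗ orbit k a) (f ∘ₗ orbit (Γ := Γ) k x) := by
    ext γ
    rw [LinearMap.comp_apply, orbit_apply, IsEquivariant.smul_left,
      sweedler_apply _ _ _ (ℛ k γ), sweedler_apply _ _ _ (ℛ k γ), map_sum]
    exact Finset.sum_congr rfl fun i _ => hf _ _
  rw [inr_inl_leftAct, leftTwist_conj, rightTwist, rightTwist, e]
  exact (sweedler_assoc _ _ _ _ (fun a m b => (leftAct_rightAct a b m).symm) _ _ _).symm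

theorem conj_rightAct (f : K →ₗ[k] M)
    (hf : ∀ a x, f (rightAct k A K x a) =
      rightAct k (SmashProduct k Γ A) M (f x) (SmashProduct.inl k a)) (γ : Γ) (a : A) (x : K) :
    conj Γ A f γ (rightAct k A K x a) =
      rightAct k (SmashProduct k Γ A) M (conj Γ A f γ x) (SmashProduct.inl k a) := by
  refine (LinearMap.congr_fun (conj_unique f (rightAct k A K x a)
    ((rightAct k (SmashProduct k Γ A) M).flip (SmashProduct.inl k a) ∘ₗ
      (conj Γ A f).flip x) ?_) γ).symm
  have e : f ∘ₗ orbit k (rightAct k A K x a) = sweedler (rightAct k (SmashProduct k Γ A) M)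
      (f ∘ₗ orbit (Γ := Γ) k x) ((SmashProduct.inl k).toLinearMap ∘ₗ orbit k a) := by
    ext γ
    rw [LinearMap.comp_apply, orbit_apply, IsEquivariant.smul_right,
      sweedler_apply _ _ _ (ℛ k γ), sweedler_apply _ _ _ (ℛ k γ), map_sum]
    exact Finset.sum_congr rfl fun i _ => hf _ _
  rw [rightTwist, e, sweedler_assoc (rightAct k (SmashProduct k Γ A) M)
    (rightAct k (SmashProduct k Γ A) M) (LinearMap.mul k (SmashProduct k Γ A))
    (rightAct k (SmashProduct k Γ A) M) (fun m a b => (rightAct_mul a b m).symm)]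
  ext γ
  have h := congrArg (fun m => rightAct k (SmashProduct k Γ A) M m (SmashProduct.inl k a))
    (LinearMap.congr_fun (leftTwist_conj (A := A) f x) γ)
  rw [rightTwist, leftTwist, sweedler_apply _ _ _ (ℛ k γ), sweedler_apply _ _ _ (ℛ k γ)] at h
  simp only [map_sum, LinearMap.sum_apply, ← leftAct_rightAct] at h
  rw [leftTwist, sweedler_apply _ _ _ (ℛ k γ), sweedler_apply _ _ _ (ℛ k γ)]
  refine h.trans (Finset.sum_congr rfl fun i _ => ?_)
  rw [← SmashProduct.inr_mul_inl, rightAct_mul]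
  rfl

/-- This is the relation in `IsGen` for the family δ ↦ `conj Γ A f δ` on Γ as a right module over
itself: one A-bilinear map f on K yields a whole family on a free module. -/
theorem conj_mul (f : K →ₗ[k] M) (δ γ : Γ) (x : K) :
    sweedler (leftAct k (SmashProduct k Γ A) M) (SmashProduct.inr (Γ := Γ) (A := A) k).toLinearMap
        ((conj Γ A f).flip x ∘ₗ LinearMap.mulLeft k δ) γ =
      sweedler (rightAct k (SmashProduct k Γ A) M) (conj Γ A f δ ∘ₗ orbit k x)
        (SmashProduct.inr (Γ := Γ) (A := A) k).toLinearMap γ := by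
  -- The two sides with γ fixed, as functions of δ. Convolution on the left is injective, and after
  -- it both become ∑ f(δ₁γ₁x)δ₂γ₂.
  let u : Γ →ₗ[k] M := ∑ i ∈ (ℛ k γ).index,
    leftAct k (SmashProduct k Γ A) M (SmashProduct.inr k ((ℛ k γ).left i)) ∘ₗ
      (conj Γ A f).flip x ∘ₗ LinearMap.mulRight k ((ℛ k γ).right i)
  let v : Γ →ₗ[k] M := ∑ i ∈ (ℛ k γ).index,
    (rightAct k (SmashProduct k Γ A) M).flip (SmashProduct.inr k ((ℛ k γ).right i)) ∘ₗ
      (conj Γ A f).flip ((ℛ k γ).left i • x)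
  have huv : u = v := by
    refine leftTwist_injective (A := A) (LinearMap.ext fun δ => ?_)
    have h := LinearMap.congr_fun (leftTwist_conj (A := A) f x) (δ * γ)
    -- The coproduct of δγ is expanded as the product of the two coproducts, so that the defining
    -- equation can be read at δγ.
    let r : Repr k (δ * γ) _ := ⟨(ℛ k δ).index ×ˢ (ℛ k γ).index,
      fun p => (ℛ k δ).left p.1 * (ℛ k γ).left p.2,
      fun p => (ℛ k δ).right p.1 * (ℛ k γ).right p.2, by
        rw [Bialgebra.comul_mul, ← (ℛ k δ).eq, ← (ℛ k γ).eq, Finset.sum_mul_sum,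
          Finset.sum_product]
        simp only [Algebra.TensorProduct.tmul_mul_tmul]⟩
    rw [rightTwist, leftTwist, sweedler_apply _ _ _ r, sweedler_apply _ _ _ r] at h
    rw [leftTwist, leftTwist, sweedler_apply _ _ _ (ℛ k δ), sweedler_apply _ _ _ (ℛ k δ)]
    have e1 : ∑ i ∈ (ℛ k δ).index, leftAct k (SmashProduct k Γ A) M
        ((SmashProduct.inr k).toLinearMap ((ℛ k δ).left i)) (u ((ℛ k δ).right i)) =
        ∑ p ∈ (ℛ k δ).index ×ˢ (ℛ k γ).index, leftAct k (SmashProduct k Γ A) M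
          (SmashProduct.inr k ((ℛ k δ).left p.1 * (ℛ k γ).left p.2))
            (conj Γ A f ((ℛ k δ).right p.1 * (ℛ k γ).right p.2) x) := by
      rw [Finset.sum_product]
      refine Finset.sum_congr rfl fun i _ => ?_
      simp only [u, LinearMap.sum_apply, map_sum]
      refine Finset.sum_congr rfl fun j _ => ?_
      rw [map_mul, leftAct_mul]
      rfl
    have e2 : ∑ i ∈ (ℛ k δ).index, leftAct k (SmashProduct k Γ A) M
        ((SmashProduct.inr k).toLinearMap ((ℛ k δ).left i)) (v ((ℛ k δ).right i)) =
        ∑ p ∈ (ℛ k δ).index ×ˢ (ℛ k γ).index, rightAct k (SmashProduct k Γ A) M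
          (f (((ℛ k δ).left p.1 * (ℛ k γ).left p.2) • x))
          (SmashProduct.inr k ((ℛ k δ).right p.1 * (ℛ k γ).right p.2)) := by
      rw [Finset.sum_product_right]
      simp only [v, LinearMap.sum_apply, map_sum]
      rw [Finset.sum_comm]
      refine Finset.sum_congr rfl fun j _ => ?_
      have h' := congrArg (fun m => rightAct k (SmashProduct k Γ A) M m
        (SmashProduct.inr k ((ℛ k γ).right j)))
        (LinearMap.congr_fun (leftTwist_conj (A := A) f ((ℛ k γ).left j • x)) δ)
      rw [rightTwist, leftTwist, sweedler_apply _ _ _ (ℛ k δ),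
        sweedler_apply _ _ _ (ℛ k δ)] at h'
      simp only [map_sum, LinearMap.sum_apply, ← leftAct_rightAct] at h'
      refine h'.trans (Finset.sum_congr rfl fun i _ => ?_)
      rw [map_mul, rightAct_mul, mul_smul]
      rfl
    exact e1.trans (h.trans e2.symm)
  have h := LinearMap.congr_fun huv δ
  simp only [u, v, LinearMap.sum_apply] at h
  rw [sweedler_apply _ _ _ (ℛ k γ), sweedler_apply _ _ _ (ℛ k γ)]
  exact h

end Conjugation

/-! ### Projectivity of the induced bimodule -/

section Projective

variable {k Γ A : Type u} [Field k] [Ring Γ] [HopfAlgebra k Γ] [Ring A] [Algebra k A]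
  [Module Γ A] [IsScalarTower k Γ A] [IsModuleAlgebra k Γ A]
  {L K : Type u} [AddCommGroup L] [Module k L] [Module Γᵐᵒᵖ L] [IsScalarTower k Γᵐᵒᵖ L]
  [AddCommGroup K] [Module k K] [Module (Env k A) K] [IsScalarTower k (Env k A) K]
  [Module Γ K] [IsScalarTower k Γ K]
  {M N : Type u} [AddCommGroup M] [Module k M]
  [Module (Env k (SmashProduct k Γ A)) M] [IsScalarTower k (Env k (SmashProduct k Γ A)) M]
  [AddCommGroup N] [Module k N]
  [Module (Env k (SmashProduct k Γ A)) N] [IsScalarTower k (Env k (SmashProduct k Γ A)) N]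

variable (k Γ A) in
/-- The inclusion of the enveloping algebra of `A` into that of the smash product. -/
def envInl : Env k A →ₐ[k] Env k (SmashProduct k Γ A) :=
  Algebra.TensorProduct.map (SmashProduct.inl k) (SmashProduct.inl k).op

/-- M and N are regarded as A-bimodules through A → A#Γ, where projectivity of K over A^e applies.
-/
theorem exists_bimodule_lift [Module.Projective (Env k A) K]
    (p : M →ₗ[Env k (SmashProduct k Γ A)] N) (hp : Function.Surjective p) (g : K →ₗ[k] N)
    (hl : ∀ a x, g (leftAct k A K a x) =
      leftAct k (SmashProduct k Γ A) N (SmashProduct.inl k a) (g x))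
    (hr : ∀ a x, g (rightAct k A K x a) =
      rightAct k (SmashProduct k Γ A) N (g x) (SmashProduct.inl k a)) :
    ∃ f : K →ₗ[k] M, (∀ a x, f (leftAct k A K a x) =
      leftAct k (SmashProduct k Γ A) M (SmashProduct.inl k a) (f x)) ∧
      (∀ a x, f (rightAct k A K x a) =
        rightAct k (SmashProduct k Γ A) M (f x) (SmashProduct.inl k a)) ∧
      ∀ x, p (f x) = g x := by
  let _ : Module (Env k A) M := Module.compHom M (envInl k Γ A).toRingHom
  let _ : Module (Env k A) N := Module.compHom N (envInl k Γ A).toRingHom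
  have hM : ∀ (e : Env k A) (m : M), e • m = envInl k Γ A e • m := fun _ _ => rfl
  have hN : ∀ (e : Env k A) (m : N), e • m = envInl k Γ A e • m := fun _ _ => rfl
  have : IsScalarTower k (Env k A) M := ⟨fun c e m => by rw [hM, map_smul, smul_assoc, hM]⟩
  let p' : M →ₗ[Env k A] N := { p with map_smul' := fun e m => map_smul p (envInl k Γ A e) m }
  let g' : K →ₗ[Env k A] N :=
    { g with
      map_smul' := fun e x => by
        change g (e • x) = envInl k Γ A e • g x
        induction e using TensorProduct.induction_on with
        | zero =>
          have h : (0 : Env k (SmashProduct k Γ A)) • g x = 0 := Module.zero_smul _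
          rw [map_zero, h]
          exact (congrArg g (Module.zero_smul x)).trans (map_zero g)
        | add a b ha hb => rw [add_smul, map_add, ha, hb, map_add, add_smul]
        | tmul a b =>
          obtain ⟨b, rfl⟩ := op_surjective b
          rw [left_right_act, hl, hr, ← left_right_act]
          rfl }
  obtain ⟨f, hf⟩ := Module.projective_lifting_property p' g' hp
  refine ⟨f.restrictScalars k, fun a x => ?_, fun a x => ?_, fun x => LinearMap.congr_fun hf x⟩
  · refine (map_smul f _ x).trans ?_
    rw [hM, leftAct_apply]
    congr 1
  · refine (map_smul f _ x).trans ?_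
    rw [hM, rightAct_apply]
    congr 1

variable [IsEquivariant k Γ A K]

/-- L is a retract of the free right Γ-module on its own elements, so it suffices to lift on that
module. There a lift is chosen freely at each basis element and transported by conjugation. -/
theorem IsGen.exists_lift [Module.Projective (Env k A) K] [Module.Projective Γᵐᵒᵖ L]
    (p : M →ₗ[Env k (SmashProduct k Γ A)] N) (hp : Function.Surjective p)
    {G : L →ₗ[k] K →ₗ[k] N} (hG : IsGen Γ A G) :
    ∃ F : L →ₗ[k] K →ₗ[k] M, IsGen Γ A F ∧ ∀ l x, p (F l x) = G l x := by
  obtain ⟨s, hs⟩ := Module.projective_def'.1 (inferInstance : Module.Projective Γᵐᵒᵖ L)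
  choose f hl hr hf using fun l => exists_bimodule_lift p hp (G l) (hG.left l) (hG.right l)
  -- On the basis element of l times γ the value is the conjugate by γ of an A-bilinear lift of
  -- G(l).
  let F' : (L →₀ Γᵐᵒᵖ) →ₗ[k] K →ₗ[k] M := Finsupp.lsum k fun l =>
    conj Γ A (f l) ∘ₗ (opLinearEquiv k : Γ ≃ₗ[k] Γᵐᵒᵖ).symm.toLinearMap
  have hF' : ∀ l γ, F' (Finsupp.single l (op γ)) = conj Γ A (f l) γ := fun l γ =>
    Finsupp.lsum_single _ _ _ _
  have hgen : IsGen Γ A F' := by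
    refine ⟨fun y a x => ?_, fun y a x => ?_, fun y x γ => ?_⟩
    · refine Finsupp.induction_linear y (by simp) (fun y z hy hz => ?_) fun l c => ?_
      · simp only [map_add, LinearMap.add_apply, hy, hz]
      · obtain ⟨c, rfl⟩ := op_surjective c
        rw [hF', conj_leftAct _ (hl l)]
    · refine Finsupp.induction_linear y (by simp) (fun y z hy hz => ?_) fun l c => ?_
      · simp only [map_add, LinearMap.add_apply, hy, hz]
      · obtain ⟨c, rfl⟩ := op_surjective c
        rw [hF', conj_rightAct _ (hr l)]
    · rw [sweedler_apply _ _ _ (ℛ k γ), sweedler_apply _ _ _ (ℛ k γ)]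
      simp only [LinearMap.comp_apply, LinearMap.flip_apply, rightOrbit_apply]
      refine Finsupp.induction_linear y (by simp) (fun y z hy hz => ?_) fun l c => ?_
      · simp only [smul_add, map_add, LinearMap.add_apply, Finset.sum_add_distrib, hy, hz]
      · obtain ⟨c, rfl⟩ := op_surjective c
        have h := conj_mul (A := A) (f l) c γ x
        rw [sweedler_apply _ _ _ (ℛ k γ), sweedler_apply _ _ _ (ℛ k γ)] at h
        refine Eq.trans (Finset.sum_congr rfl fun i _ => ?_) (h.trans ?_)
        · congr 1
          refine (congrArg (fun y => F' y x) (Finsupp.smul_single _ _ _)).trans ?_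
          exact LinearMap.congr_fun (hF' l (c * (ℛ k γ).right i)) x
        · exact Finset.sum_congr rfl fun i _ => by rw [hF']; rfl
  refine ⟨F' ∘ₗ s.restrictScalars k, hgen.precompL s, fun l x => ?_⟩
  -- Conjugation commutes with p, and the conjugate of G(l) by c is G(lc); so F' lifts G composed
  -- with the projection of the free module onto L.
  have key : ∀ y : L →₀ Γᵐᵒᵖ, p (F' y x) = G (Finsupp.linearCombination Γᵐᵒᵖ id y) x := fun y => by
    refine Finsupp.induction_linear y (by simp) (fun y z hy hz => ?_) fun l c => ?_
    · simp only [map_add, LinearMap.add_apply, hy, hz]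
    · obtain ⟨c, rfl⟩ := op_surjective c
      have e : p.restrictScalars k ∘ₗ f l = G l := LinearMap.ext (hf l)
      rw [hF', map_conj, e, hG.conj_eq, Finsupp.linearCombination_single]
      rfl
  rw [LinearMap.comp_apply, key]
  exact congrArg (fun l => G l x) (LinearMap.congr_fun hs l)

/-- A section of a surjection onto the induced bimodule is, by the universal property, a lift of its
tautological family of generators. -/
theorem Ind.projective (hS : Function.Bijective (HopfAlgebra.antipode k (A := Γ)))
    [Module.Projective (Env k A) K] [Module.Projective Γᵐᵒᵖ L] :
    Module.Projective (Env k (SmashProduct k Γ A)) (Ind hS L K) := by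
  refine Module.Projective.of_lifting_property'' fun p hp => ?_
  obtain ⟨F, hF, h⟩ := IsGen.exists_lift p hp (Ind.isGen_gen (A := A) (L := L) (K := K) hS)
  refine ⟨Ind.lift hS F hF, Ind.hom_ext hS fun l x => ?_⟩
  rw [LinearMap.comp_apply, Ind.lift_gen, h]
  rfl

end Projective


/-! ## Algebra extensions as bimodules -/

section Extension

variable {k R B : Type u} [Field k] [Ring R] [Algebra k R] [Ring B] [Algebra k B]

/-- The algebra `B` as an `R`-bimodule along an algebra map `j : R → B`. -/
def ExtMod (_ : R →ₐ[k] B) : Type u := B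

variable (j : R →ₐ[k] B)

namespace ExtMod

instance : Ring (ExtMod j) := inferInstanceAs (Ring B)

instance : Algebra k (ExtMod j) := inferInstanceAs (Algebra k B)

/-- The algebra map `j` with values in the bimodule. -/
def of : R →ₐ[k] ExtMod j := j

/-- The representation of the enveloping algebra of `R` on `B`. -/
def envRep : Env k R →ₐ[k] Module.End k (ExtMod j) :=
  (AlgHom.mulLeftRight k (ExtMod j)).comp (Algebra.TensorProduct.map (of j) (of j).op)

instance : Module (Env k R) (ExtMod j) := Module.compHom (ExtMod j) (envRep j).toRingHom

instance : IsScalarTower k (Env k R) (ExtMod j) where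
  smul_assoc c e b := LinearMap.congr_fun (map_smul (envRep j) c e) b

theorem envRep_id : envRep (AlgHom.id k R) = AlgHom.mulLeftRight k R := by
  have : Algebra.TensorProduct.map (of (AlgHom.id k R)) (of (AlgHom.id k R)).op =
      AlgHom.id k (Env k R) := Algebra.TensorProduct.map_id
  rw [envRep, this]
  rfl

variable {j}

theorem tmul_smul (r s : R) (b : ExtMod j) : (r ⊗ₜ[k] op s) • b = of j r * b * of j s := by
  change envRep j (r ⊗ₜ op s) b = _
  rw [envRep, AlgHom.comp_apply, Algebra.TensorProduct.map_tmul]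
  exact AlgHom.mulLeftRight_apply k (ExtMod j) _ _ _

theorem leftAct_eq (r : R) (b : ExtMod j) : leftAct k R (ExtMod j) r b = of j r * b := by
  rw [leftAct_apply, ← op_one, tmul_smul, map_one, mul_one]

theorem rightAct_eq (r : R) (b : ExtMod j) : rightAct k R (ExtMod j) b r = b * of j r := by
  rw [rightAct_apply, tmul_smul, map_one, one_mul]

theorem map_smul_of_mem {M : Type u} [AddCommGroup M] [Module k M] [Module (Env k R) M]
    [IsScalarTower k (Env k R) M] (f : BimodHom (of j) M) (e : Env k R) (m : M) :
    f.1 (e • m) = e • f.1 m := by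
  induction e using TensorProduct.induction_on with
  | zero =>
    have h : (0 : Env k R) • f.1 m = 0 := Module.zero_smul _
    exact (congrArg f.1 (Module.zero_smul m)).trans ((map_zero f.1).trans h.symm)
  | add a b ha hb => rw [add_smul, map_add, ha, hb, add_smul]
  | tmul r s =>
    obtain ⟨s, rfl⟩ := op_surjective s
    rw [f.2, tmul_smul]

/-- Bimodule maps into `B` as linear maps over the enveloping algebra. -/
def ofBimodHom {M : Type u} [AddCommGroup M] [Module k M] [Module (Env k R) M]
    [IsScalarTower k (Env k R) M] (f : BimodHom j M) : M →ₗ[Env k R] ExtMod j :=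
  { (f.1 : M →ₗ[k] ExtMod j) with map_smul' := map_smul_of_mem (j := j) f }

/-- Linear maps over the enveloping algebra as bimodule maps into `B`. -/
def toBimodHom {M : Type u} [AddCommGroup M] [Module k M] [Module (Env k R) M]
    [IsScalarTower k (Env k R) M] (f : M →ₗ[Env k R] ExtMod j) : BimodHom j M :=
  ⟨(f.restrictScalars k : M →ₗ[k] ExtMod j), fun r s m =>
    (map_smul f (r ⊗ₜ[k] op s) m).trans (tmul_smul r s (f m))⟩

end ExtMod

end Extension

/-! ## The resolution of the smash product -/

section Scalars

variable {k S : Type u} [Field k] [Ring S] [Algebra k S] (T : ℕ → ℕ → Type u)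
  [∀ p q, AddCommGroup (T p q)] [∀ p q, Module S (T p q)] [∀ p q, Module k (T p q)]
  [∀ p q, IsScalarTower k S (T p q)]

/-- The vector space structure of a total complex. -/
instance Tot.instModule (n : ℕ) : Module k (Tot S T n) := Submodule.module' _

instance Tot.instIsScalarTower (n : ℕ) : IsScalarTower k S (Tot S T n) :=
  ⟨fun c e z => Subtype.ext (funext fun p => funext fun q => smul_assoc c e (z.1 p q))⟩

end Scalars

section Resolution

variable {k Γ A : Type u} [Field k] [Ring Γ] [HopfAlgebra k Γ] [Ring A] [Algebra k A]
  [Module Γ A] [IsScalarTower k Γ A] [IsModuleAlgebra k Γ A]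
  (hS : Function.Bijective (HopfAlgebra.antipode k (A := Γ)))

namespace Ind

variable {L L' K K' : Type u} [AddCommGroup L] [Module k L] [Module Γᵐᵒᵖ L]
  [IsScalarTower k Γᵐᵒᵖ L] [AddCommGroup L'] [Module k L'] [Module Γᵐᵒᵖ L']
  [IsScalarTower k Γᵐᵒᵖ L']
  [AddCommGroup K] [Module k K] [Module (Env k A) K] [IsScalarTower k (Env k A) K]
  [Module Γ K] [IsScalarTower k Γ K] [IsEquivariant k Γ A K]
  [AddCommGroup K'] [Module k K'] [Module (Env k A) K'] [IsScalarTower k (Env k A) K']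
  [Module Γ K'] [IsScalarTower k Γ K'] [IsEquivariant k Γ A K']
  {M : Type u} [AddCommGroup M] [Module k M]
  [Module (Env k (SmashProduct k Γ A)) M] [IsScalarTower k (Env k (SmashProduct k Γ A)) M]

variable (L K) in
/-- The elements `y ⊗ l` of the induced bimodule. -/
def tens : K ⊗[k] Γ →ₗ[k] L →ₗ[k] Ind hS L K := TensorProduct.mk k (K ⊗[k] Γ) L

theorem linear_ext {V : Type u} [AddCommGroup V] [Module k V] {f g : Ind hS L K →ₗ[k] V}
    (h : ∀ y l, f (tens hS L K y l) = g (tens hS L K y l)) : f = g :=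
  TensorProduct.ext' (N := L) (M := K ⊗[k] Γ) h

theorem rightAct_gen' (l : L) (x : K) (γ : Γ) :
    rightAct k (SmashProduct k Γ A) (Ind hS L K) (gen L K hS l x) (SmashProduct.inr k γ) =
      tens hS L K (x ⊗ₜ[k] γ) l := rightAct_gen hS l x γ

theorem lift_tens (F : L →ₗ[k] K →ₗ[k] M) (hF : IsGen Γ A F) (x : K) (γ : Γ) (l : L) :
    Ind.lift hS F hF (tens hS L K (x ⊗ₜ γ) l) =
      rightAct k (SmashProduct k Γ A) M (F l x) (SmashProduct.inr k γ) := rfl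

variable (L K) in
/-- The linear map induced by a linear map on `L`. -/
def lmap (s : L →ₗ[k] L') : Ind hS L K →ₗ[k] Ind hS L' K := s.lTensor (K ⊗[k] Γ)

@[simp] theorem lmap_tens (s : L →ₗ[k] L') (y : K ⊗[k] Γ) (l : L) :
    lmap hS L K s (tens hS L K y l) = tens hS L' K y (s l) := rfl

variable (L K) in
/-- The linear map `y ⊗ l ↦ ξ(l) y`. -/
def column (ξ : L →ₗ[k] k) : Ind hS L K →ₗ[k] K ⊗[k] Γ :=
  (TensorProduct.rid k (K ⊗[k] Γ)).toLinearMap ∘ₗ ξ.lTensor (K ⊗[k] Γ)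

@[simp] theorem column_tens (ξ : L →ₗ[k] k) (y : K ⊗[k] Γ) (l : L) :
    column hS L K ξ (tens hS L K y l) = ξ l • y := by
  change TensorProduct.rid k (K ⊗[k] Γ) (y ⊗ₜ ξ l) = _
  rw [TensorProduct.rid_tmul]

variable (K) in
/-- Functoriality of the induced bimodule in the right module. -/
def mapL (h : L →ₗ[Γᵐᵒᵖ] L') :
    Ind hS L K →ₗ[Env k (SmashProduct k Γ A)] Ind hS L' K :=
  Ind.lift hS _ ((isGen_gen hS).precompL h)

variable (L) in
/-- Functoriality of the induced bimodule in the equivariant bimodule. -/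
def mapK (h : K →ₗ[Env k A] K') (hh : ∀ (γ : Γ) x, h (γ • x) = γ • h x) :
    Ind hS L K →ₗ[Env k (SmashProduct k Γ A)] Ind hS L K' :=
  Ind.lift hS _ ((isGen_gen hS).precompK h hh)

@[simp] theorem mapL_gen (h : L →ₗ[Γᵐᵒᵖ] L') (l : L) (x : K) :
    mapL (A := A) hS K h (gen L K hS l x) = gen L' K hS (h l) x := lift_gen hS _ _ l x

@[simp] theorem mapK_gen (h : K →ₗ[Env k A] K') (hh : ∀ (γ : Γ) x, h (γ • x) = γ • h x)
    (l : L) (x : K) : mapK hS L h hh (gen L K hS l x) = gen L K' hS l (h x) :=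
  lift_gen hS _ _ l x

@[simp] theorem mapL_tens (h : L →ₗ[Γᵐᵒᵖ] L') (y : K ⊗[k] Γ) (l : L) :
    mapL (A := A) hS K h (tens hS L K y l) = tens hS L' K y (h l) := by
  induction y with
  | zero => rw [map_zero, map_zero, LinearMap.zero_apply, LinearMap.zero_apply, map_zero]
  | add y y' hy hy' => simp only [map_add, LinearMap.add_apply, hy, hy']
  | tmul x γ =>
    rw [mapL, lift_tens, LinearMap.comp_apply, LinearMap.restrictScalars_apply, rightAct_gen']

@[simp] theorem mapK_tens (h : K →ₗ[Env k A] K') (hh : ∀ (γ : Γ) x, h (γ • x) = γ • h x)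
    (y : K ⊗[k] Γ) (l : L) :
    mapK hS L h hh (tens hS L K y l) =
      tens hS L K' ((h.restrictScalars k).rTensor Γ y) l := by
  induction y with
  | zero => simp only [map_zero, LinearMap.zero_apply]
  | add y y' hy hy' => simp only [map_add, LinearMap.add_apply, hy, hy']
  | tmul x γ =>
    rw [mapK, lift_tens, LinearMap.compl₂_apply, LinearMap.restrictScalars_apply, rightAct_gen',
      LinearMap.rTensor_tmul, LinearMap.restrictScalars_apply]

end Ind

variable (K : EquivRes k Γ A) (L : TrivRes k Γ)

/-- The double complex of induced bimodules. -/
abbrev IndCx (p q : ℕ) : Type u := Ind hS (L.X p) (K.X q)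

/-- The differential of the double complex that comes from `L`. -/
def indH (p q : ℕ) :
    IndCx hS K L (p + 1) q →ₗ[Env k (SmashProduct k Γ A)] IndCx hS K L p q :=
  Ind.mapL hS _ (L.d p)

/-- The differential of the double complex that comes from `K`. -/
def indV (p q : ℕ) :
    IndCx hS K L p (q + 1) →ₗ[Env k (SmashProduct k Γ A)] IndCx hS K L p q :=
  Ind.mapK hS _ (K.d q) (K.d_smul q)

/-- The bilinear map `(l, x) ↦ ξ(l) τ(x)`. -/
def augGen : L.X 0 →ₗ[k] K.X 0 →ₗ[k] ExtMod (AlgHom.id k (SmashProduct k Γ A)) :=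
  L.ε.smulRight (((ExtMod.of (AlgHom.id k (SmashProduct k Γ A))).comp
    (SmashProduct.inl k)).toLinearMap ∘ₗ K.ε)

theorem augGen_apply (l : L.X 0) (x : K.X 0) : augGen K L l x =
    L.ε l • ExtMod.of (AlgHom.id k (SmashProduct k Γ A)) (SmashProduct.inl k (K.ε x)) := rfl

/-- On one side ξ(lγ₂) = ξ(l)ε(γ₂) leaves ξ(l) γ τ(x). On the other, Γ-linearity of τ gives ξ(l) ∑
(γ₁τ(x))γ₂. They agree by the commutation rule of the smash product. -/
theorem isGen_augGen : IsGen Γ A (augGen K L) where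
  left l a x := by
    rw [ExtMod.leftAct_eq, augGen_apply, augGen_apply, aug_leftAct, map_mul, map_mul, mul_smul_comm]
  right l a x := by
    rw [ExtMod.rightAct_eq, augGen_apply, augGen_apply, aug_rightAct, map_mul, map_mul, smul_mul_assoc]
  equiv l x γ := by
    have h := SmashProduct.inr_mul_inl k γ (K.ε x)
    rw [sweedler_apply _ _ _ (ℛ k γ)] at h
    rw [sweedler_apply _ _ _ (ℛ k γ), sweedler_apply _ _ _ (ℛ k γ)]
    have e : γ = ∑ i ∈ (ℛ k γ).index, counit (R := k) ((ℛ k γ).right i) • (ℛ k γ).left i := by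
      have := congrArg (TensorProduct.rid k Γ) (sum_tmul_counit_eq (R := k) (ℛ k γ))
      rw [map_sum] at this
      simpa only [TensorProduct.rid_tmul, one_smul] using this.symm
    have e' : SmashProduct.inr k γ * SmashProduct.inl k (K.ε x) = ∑ i ∈ (ℛ k γ).index,
        counit (R := k) ((ℛ k γ).right i) •
          (SmashProduct.inr k ((ℛ k γ).left i) * SmashProduct.inl k (K.ε x)) := by
      conv_lhs => rw [e, map_sum, Finset.sum_mul]
      exact Finset.sum_congr rfl fun i _ => by rw [map_smul, smul_mul_assoc]
    trans L.ε l • ExtMod.of (AlgHom.id k (SmashProduct k Γ A))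
      (SmashProduct.inr k γ * SmashProduct.inl k (K.ε x))
    · rw [e', map_sum, Finset.smul_sum]
      refine Finset.sum_congr rfl fun i _ => ?_
      rw [ExtMod.leftAct_eq, LinearMap.comp_apply, LinearMap.flip_apply, augGen_apply,
        rightOrbit_apply, L.ε_smul, map_smul, map_mul, mul_smul_comm, smul_smul]
      congr 1
      exact mul_comm _ _
    · rw [h, map_sum, Finset.smul_sum]
      refine Finset.sum_congr rfl fun i _ => ?_
      rw [ExtMod.rightAct_eq, LinearMap.comp_apply, orbit_apply]
      refine Eq.trans ?_ (congrArg (· * _) (augGen_apply K L l _).symm)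
      rw [orbit_apply, K.ε_smul', smul_mul_assoc, LinearMap.mul_apply', map_mul]
      rfl

/-- The augmentation of the double complex. -/
def indAug : IndCx hS K L 0 0 →ₗ[Env k (SmashProduct k Γ A)]
    ExtMod (AlgHom.id k (SmashProduct k Γ A)) :=
  Ind.lift hS _ (isGen_augGen K L)

theorem column_indH (q : ℕ) (z : IndCx hS K L 1 q) :
    Ind.column hS _ _ L.ε (indH hS K L 0 q z) = 0 := by
  have : Ind.column hS _ _ L.ε ∘ₗ (indH hS K L 0 q).restrictScalars k = 0 :=
    Ind.linear_ext hS fun y l => by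
      have h : L.ε (L.d 0 l) = 0 := L.exact_zero.apply_apply_eq_zero l
      rw [LinearMap.comp_apply, LinearMap.restrictScalars_apply, indH, Ind.mapL_tens,
        Ind.column_tens, h, zero_smul]
      rfl
  exact LinearMap.congr_fun this z

theorem column_indV (q : ℕ) (z : IndCx hS K L 0 (q + 1)) :
    Ind.column hS _ _ L.ε (indV hS K L 0 q z) =
      ((K.d q).restrictScalars k).rTensor Γ (Ind.column hS _ _ L.ε z) := by
  have : Ind.column hS _ _ L.ε ∘ₗ (indV hS K L 0 q).restrictScalars k =
      ((K.d q).restrictScalars k).rTensor Γ ∘ₗ Ind.column hS _ _ L.ε :=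
    Ind.linear_ext hS fun y l => by
      rw [LinearMap.comp_apply, LinearMap.comp_apply, LinearMap.restrictScalars_apply, indV,
        Ind.mapK_tens, Ind.column_tens, Ind.column_tens, map_smul]
  exact LinearMap.congr_fun this z

/-- The augmentation factors as ξ in the direction of L followed by τ ⊗ Γ, under the identification
of A#Γ with A ⊗ Γ. Exactness at the end is thereby reduced to that of K ⊗ Γ. -/
theorem indAug_eq (z : IndCx hS K L 0 0) :
    indAug hS K L z = (K.ε.rTensor Γ (Ind.column hS _ _ L.ε z) : A ⊗[k] Γ) := by
  have : (indAug hS K L).restrictScalars k =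
      ((K.ε.rTensor Γ ∘ₗ Ind.column hS _ _ L.ε : IndCx hS K L 0 0 →ₗ[k] A ⊗[k] Γ) :
        IndCx hS K L 0 0 →ₗ[k] ExtMod (AlgHom.id k (SmashProduct k Γ A))) :=
    Ind.linear_ext hS fun y l => by
      refine Eq.trans ?_ (congrArg (K.ε.rTensor Γ) (Ind.column_tens hS L.ε y l)).symm
      induction y with
      | zero => simp only [map_zero, LinearMap.zero_apply, smul_zero]; rfl
      | add y y' hy hy' =>
        rw [map_add, LinearMap.add_apply, map_add, hy, hy', smul_add, map_add]
        rfl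
      | tmul x γ =>
        have e : indAug hS K L (Ind.tens hS _ _ (x ⊗ₜ γ) l) =
            L.ε l • (ExtMod.of (AlgHom.id k (SmashProduct k Γ A)) (SmashProduct.inl k (K.ε x)) *
              ExtMod.of (AlgHom.id k (SmashProduct k Γ A)) (SmashProduct.inr k γ)) := by
          rw [indAug, Ind.lift_tens, augGen_apply, ExtMod.rightAct_eq, smul_mul_assoc]
        refine e.trans ?_
        rw [map_smul, LinearMap.rTensor_tmul, ← SmashProduct.inl_mul_inr]
        rfl
  exact LinearMap.congr_fun this z

theorem indAug_indH (z : IndCx hS K L 1 0) : indAug hS K L (indH hS K L 0 0 z) = 0 := by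
  rw [indAug_eq, column_indH, map_zero]
  rfl

theorem indAug_indV (z : IndCx hS K L 0 1) : indAug hS K L (indV hS K L 0 0 z) = 0 := by
  have : K.ε ∘ₗ (K.d 0).restrictScalars k = 0 :=
    LinearMap.ext fun x => K.exact_zero.apply_apply_eq_zero x
  rw [indAug_eq, column_indV, ← LinearMap.comp_apply, ← LinearMap.rTensor_comp, this,
    LinearMap.rTensor_zero]
  rfl

/-- The differential of the resolution. -/
def indD (n : ℕ) : Tot (Env k (SmashProduct k Γ A)) (IndCx hS K L) (n + 1)
    →ₗ[Env k (SmashProduct k Γ A)] Tot (Env k (SmashProduct k Γ A)) (IndCx hS K L) n :=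
  Tot.d (indH hS K L) (indV hS K L) n

/-- The contraction of L is only k-linear, and so is the map it induces here. This suffices, since
exactness of the total complex is a statement about abelian groups. -/
theorem indH_lmap_zero (ι : k →ₗ[k] L.X 0) (s : L.X 0 →ₗ[k] L.X 1)
    (h : ∀ l, L.d 0 (s l) + ι (L.ε l) = l) (q : ℕ) (x : IndCx hS K L 0 q) :
    indH hS K L 0 q (Ind.lmap hS (L.X 0) (K.X q) s x) +
      Ind.tens hS (L.X 0) (K.X q) (Ind.column hS (L.X 0) (K.X q) L.ε x) (ι 1) = x := by
  have : (indH hS K L 0 q).restrictScalars k ∘ₗ Ind.lmap hS (L.X 0) (K.X q) s +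
      (Ind.tens hS (L.X 0) (K.X q)).flip (ι 1) ∘ₗ Ind.column hS (L.X 0) (K.X q) L.ε =
        LinearMap.id := Ind.linear_ext hS fun y l => by
    have e : ι (L.ε l) = L.ε l • ι 1 := by rw [← map_smul, smul_eq_mul, mul_one]
    rw [LinearMap.add_apply, LinearMap.comp_apply, LinearMap.comp_apply, Ind.column_tens,
      Ind.lmap_tens, LinearMap.restrictScalars_apply, indH, Ind.mapL_tens, LinearMap.flip_apply,
      map_smul, LinearMap.smul_apply, ← map_smul, ← e, ← map_add, h, LinearMap.id_apply]
  exact LinearMap.congr_fun this x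

theorem indH_lmap (p q : ℕ) (s : L.X p →ₗ[k] L.X (p + 1)) (s' : L.X (p + 1) →ₗ[k] L.X (p + 2))
    (h : ∀ l, L.d (p + 1) (s' l) + s (L.d p l) = l) (x : IndCx hS K L (p + 1) q) :
    indH hS K L (p + 1) q (Ind.lmap hS (L.X (p + 1)) (K.X q) s' x) +
      Ind.lmap hS (L.X p) (K.X q) s (indH hS K L p q x) = x := by
  have : (indH hS K L (p + 1) q).restrictScalars k ∘ₗ Ind.lmap hS (L.X (p + 1)) (K.X q) s' +
      Ind.lmap hS (L.X p) (K.X q) s ∘ₗ (indH hS K L p q).restrictScalars k =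
        LinearMap.id := Ind.linear_ext hS fun y l => by
    rw [LinearMap.add_apply, LinearMap.comp_apply, LinearMap.comp_apply,
      Ind.lmap_tens, LinearMap.restrictScalars_apply, LinearMap.restrictScalars_apply, indH, indH,
      Ind.mapL_tens, Ind.mapL_tens, Ind.lmap_tens, ← map_add, h, LinearMap.id_apply]
  exact LinearMap.congr_fun this x

theorem indV_lmap (p q : ℕ) (s : L.X p →ₗ[k] L.X (p + 1)) (x : IndCx hS K L p (q + 1)) :
    indV hS K L (p + 1) q (Ind.lmap hS (L.X p) (K.X (q + 1)) s x) =
      Ind.lmap hS (L.X p) (K.X q) s (indV hS K L p q x) := by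
  have : (indV hS K L (p + 1) q).restrictScalars k ∘ₗ Ind.lmap hS (L.X p) (K.X (q + 1)) s =
      Ind.lmap hS (L.X p) (K.X q) s ∘ₗ (indV hS K L p q).restrictScalars k :=
    Ind.linear_ext hS fun y l => by
      rw [LinearMap.comp_apply, LinearMap.comp_apply, Ind.lmap_tens,
        LinearMap.restrictScalars_apply, LinearMap.restrictScalars_apply, indV, indV,
        Ind.mapK_tens, Ind.mapK_tens, Ind.lmap_tens]
  exact LinearMap.congr_fun this x

/-- The rows contract onto the column K ⊗ Γ because L → k is contractible over the field k; what is
left is a boundary condition in that column. -/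
theorem mem_range_indD (n : ℕ) (z : Tot (Env k (SmashProduct k Γ A)) (IndCx hS K L) n)
    (hz : ∀ p q, p + q + 1 = n → indH hS K L p q (z.1 (p + 1) q) +
      (-1 : ℤ) ^ p • indV hS K L p q (z.1 p (q + 1)) = 0)
    (hC : ∃ v, ((K.d n).restrictScalars k).rTensor Γ v =
      Ind.column hS (L.X 0) (K.X n) L.ε (z.1 0 n)) :
    z ∈ LinearMap.range (indD hS K L n) := by
  obtain ⟨ι, s, -, h0, h1⟩ := exists_contraction (S := k) (P := L.X) (T := k)
    (fun n => (L.d n).restrictScalars k) L.ε L.ε_surjective L.exact_zero L.exact_succ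
  have h2 := indH_lmap_zero hS K L ι (s 0) h0
  have h3 := fun p q => indH_lmap hS K L p q (s p) (s (p + 1)) (h1 p)
  have h4 := fun p q => indV_lmap hS K L p q (s p)
  have h5 : ∀ q (v : K.X (q + 1) ⊗[k] Γ), indV hS K L 0 q (Ind.tens hS _ _ v (ι 1)) =
      Ind.tens hS _ _ (((K.d q).restrictScalars k).rTensor Γ v) (ι 1) :=
    fun q v => Ind.mapK_tens hS (K.d q) (K.d_smul q) v (ι 1)
  let dC := fun q (v : K.X (q + 1) ⊗[k] Γ) => ((K.d q).restrictScalars k).rTensor Γ v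
  let e := fun q => (Ind.column hS (L.X 0) (K.X q) L.ε).toAddMonoidHom
  let i := fun q (v : K.X q ⊗[k] Γ) => Ind.tens hS (L.X 0) (K.X q) v (ι 1)
  let t := fun p q => (Ind.lmap hS (L.X p) (K.X q) (s p)).toAddMonoidHom
  have := Tot.exact_of_contraction (T := IndCx hS K L) (C := fun q => K.X q ⊗[k] Γ)
    (indH hS K L) (indV hS K L) dC e i t h2 h3 h4 h5 n z hz hC
  exact this

theorem indD_indD (n : ℕ) (z : Tot (Env k (SmashProduct k Γ A)) (IndCx hS K L) (n + 2)) :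
    indD hS K L n (indD hS K L (n + 1) z) = 0 := by
  refine Tot.d_d _ _ (fun p q x => ?_) (fun p q x => ?_) (fun p q x => ?_) n z
  · have : indH hS K L p q ∘ₗ indH hS K L (p + 1) q = 0 := Ind.hom_ext hS fun l x => by
      rw [LinearMap.comp_apply, indH, indH, Ind.mapL_gen, Ind.mapL_gen,
        (L.exact_succ p).apply_apply_eq_zero, map_zero]
      rfl
    exact LinearMap.congr_fun this x
  · have : indV hS K L p q ∘ₗ indV hS K L p (q + 1) = 0 := Ind.hom_ext hS fun l x => by
      rw [LinearMap.comp_apply, indV, indV, Ind.mapK_gen, Ind.mapK_gen,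
        (K.exact_succ q).apply_apply_eq_zero, map_zero]
      rfl
    exact LinearMap.congr_fun this x
  · have : indH hS K L p q ∘ₗ indV hS K L (p + 1) q = indV hS K L p q ∘ₗ indH hS K L p (q + 1) :=
      Ind.hom_ext hS fun l x => by
        rw [LinearMap.comp_apply, LinearMap.comp_apply, indH, indH, indV, indV, Ind.mapK_gen,
          Ind.mapL_gen, Ind.mapL_gen, Ind.mapK_gen]
    exact LinearMap.congr_fun this x

theorem exact_indD (n : ℕ) : Function.Exact (indD hS K L (n + 1)) (indD hS K L n) := by
  intro z
  constructor
  · intro h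
    have hz : ∀ p q, indH hS K L p q (z.1 (p + 1) q) +
        (-1 : ℤ) ^ p • indV hS K L p q (z.1 p (q + 1)) = 0 := fun p q =>
      congrFun (congrFun (congrArg Subtype.val h) p) q
    refine mem_range_indD hS K L (n + 1) z (fun p q _ => hz p q) ?_
    -- The column K ⊗ Γ is exact by flatness of Γ over k, and the (0, n) component of the cycle
    -- condition shows that the augmented entry is a cycle there.
    refine (Module.Flat.rTensor_exact Γ (f := (K.d (n + 1)).restrictScalars k)
      (g := (K.d n).restrictScalars k) (K.exact_succ n) _).1 ?_
    have h0 := congrArg (Ind.column hS _ _ L.ε) (hz 0 n)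
    rwa [pow_zero, one_smul, map_add, column_indH, zero_add, column_indV, map_zero] at h0
  · rintro ⟨w, rfl⟩
    exact indD_indD hS K L n w

/-- The augmentation of the resolution. -/
def indε : Tot (Env k (SmashProduct k Γ A)) (IndCx hS K L) 0
    →ₗ[Env k (SmashProduct k Γ A)] ExtMod (AlgHom.id k (SmashProduct k Γ A)) :=
  indAug hS K L ∘ₗ Tot.comp 0 0 0

theorem indε_surjective : Function.Surjective (indε hS K L) := by
  intro r
  obtain ⟨y, hy⟩ := LinearMap.rTensor_surjective Γ K.ε_surjective (r : A ⊗[k] Γ)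
  obtain ⟨l, hl⟩ := L.ε_surjective 1
  refine ⟨Tot.single 0 0 0 (Ind.tens hS _ _ y l), ?_⟩
  change indAug hS K L ((Tot.single (S := Env k (SmashProduct k Γ A)) (T := IndCx hS K L) 0 0 0
    (Ind.tens hS _ _ y l)).1 0 0) = r
  rw [Tot.single_val_same (n := 0) (p := 0) (q := 0) rfl, indAug_eq, Ind.column_tens, hl, one_smul]
  exact hy

theorem exact_indε : Function.Exact (indD hS K L 0) (indε hS K L) := by
  intro z
  constructor
  · intro h
    refine mem_range_indD hS K L 0 z (fun p q h => by omega) ?_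
    -- At the end of the complex right exactness of − ⊗ Γ identifies the kernel of τ ⊗ Γ with
    -- boundaries of the column.
    refine (rTensor_exact Γ (f := (K.d 0).restrictScalars k) K.exact_zero K.ε_surjective _).1 ?_
    exact (indAug_eq hS K L _).symm.trans h
  · rintro ⟨w, rfl⟩
    change indAug hS K L (indH hS K L 0 0 (w.1 1 0) +
      (-1 : ℤ) ^ 0 • indV hS K L 0 0 (w.1 0 1)) = 0
    rw [map_add, map_zsmul, indAug_indH, indAug_indV, smul_zero, add_zero]

/-- The bimodule resolution of the smash product given by `K` and `L`. -/
def indRes : BimodRes k (SmashProduct k Γ A) where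
  X n := Tot (Env k (SmashProduct k Γ A)) (IndCx hS K L) n
  modk n := Tot.instModule _ n
  tower n := Tot.instIsScalarTower _ n
  d n := indD hS K L n
  ε := (indε hS K L).restrictScalars k
  ε_smul s x := (map_smul (indε hS K L) s x).trans
    (congrArg (fun φ => φ s (indε hS K L x)) (ExtMod.envRep_id (k := k)))
  projective n := by
    have := K.projective
    have := L.projective
    have := fun p q => Ind.projective (A := A) (L := L.X p) (K := K.X q) hS
    exact Tot.projective n
  ε_surjective := indε_surjective hS K L
  exact_zero := exact_indε hS K L
  exact_succ := exact_indD hS K L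

end Resolution


/-! ### One-sided actions on a tensor product of bimodules -/

section BimoduleTensor

variable {k R M N : Type u} [Field k] [Ring R] [Algebra k R]
  [AddCommGroup M] [Module k M] [Module (Env k R) M] [IsScalarTower k (Env k R) M]
  [AddCommGroup N] [Module k N] [Module (Env k R) N] [IsScalarTower k (Env k R) N]

theorem leftAct_one (m : M) : leftAct k R M 1 m = m := one_smul (Env k R) m

theorem rightAct_one (m : M) : rightAct k R M m 1 = m := one_smul (Env k R) m

theorem RelTensor.leftAct_proj (r : R) (m : M) (n : N) :
    leftAct k R (RelTensor k R M N) r (proj k R M N (m ⊗ₜ n)) =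
      proj k R M N (leftAct k R M r m ⊗ₜ n) := by
  rw [leftAct_apply r (proj k R M N (m ⊗ₜ n)), env_smul_proj, outerAct_tmul, unop_one,
    rightAct_one]

theorem RelTensor.rightAct_proj (r : R) (m : M) (n : N) :
    rightAct k R (RelTensor k R M N) (proj k R M N (m ⊗ₜ n)) r =
      proj k R M N (m ⊗ₜ rightAct k R N n r) := by
  rw [rightAct_apply r (proj k R M N (m ⊗ₜ n)), env_smul_proj, outerAct_tmul, unop_op,
    leftAct_one]

end BimoduleTensor

/-! ### The space of families of generators and its functoriality -/

section GenMap

variable {k Γ A : Type u} [Field k] [Ring Γ] [HopfAlgebra k Γ] [Ring A] [Algebra k A]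
  [Module Γ A] [IsScalarTower k Γ A] [IsModuleAlgebra k Γ A]
  {L K M : Type u}
  [AddCommGroup L] [Module k L] [Module Γᵐᵒᵖ L] [IsScalarTower k Γᵐᵒᵖ L]
  [AddCommGroup K] [Module k K] [Module (Env k A) K] [IsScalarTower k (Env k A) K]
  [Module Γ K] [IsScalarTower k Γ K]
  [AddCommGroup M] [Module k M]
  [Module (Env k (SmashProduct k Γ A)) M] [IsScalarTower k (Env k (SmashProduct k Γ A)) M]

variable (k Γ A L K M) in
/-- The space of bilinear maps `L × K → M` that satisfy the relations of the generators of the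
induced bimodule. -/
def GenSub : Submodule k (L →ₗ[k] K →ₗ[k] M) where
  carrier := {F | IsGen Γ A F}
  add_mem' hF hG := IsGen.add hF hG
  zero_mem' := IsGen.zero
  smul_mem' c _ hF := IsGen.smul hF c

variable (k Γ A L K M) in
/-- The space of bilinear maps `L × K → M` that satisfy the relations of the generators of the
induced bimodule, as a type. -/
def GenMap : Type u := GenSub k Γ A L K M

namespace GenMap

instance : AddCommGroup (GenMap k Γ A L K M) :=
  Module.addCommMonoidToAddCommGroup (M := GenSub k Γ A L K M) k

instance : Module k (GenMap k Γ A L K M) := inferInstanceAs (Module k (GenSub k Γ A L K M))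

theorem ext {F G : GenMap k Γ A L K M} (h : ∀ l x, F.1 l x = G.1 l x) : F = G :=
  Subtype.ext (LinearMap.ext fun l => LinearMap.ext fun x => h l x)

theorem add_apply (F G : GenMap k Γ A L K M) (l : L) (x : K) :
    (F + G).1 l x = F.1 l x + G.1 l x := rfl

theorem smul_apply (c : k) (F : GenMap k Γ A L K M) (l : L) (x : K) :
    (c • F).1 l x = c • F.1 l x := rfl

section

variable {N : Type u}
  [AddCommGroup N] [Module k N]
  [Module (Env k (SmashProduct k Γ A)) N] [IsScalarTower k (Env k (SmashProduct k Γ A)) N]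

/-- Composition with a bimodule map. -/
def postcomp (g : M →ₗ[Env k (SmashProduct k Γ A)] N) :
    GenMap k Γ A L K M →ₗ[k] GenMap k Γ A L K N where
  toFun F := ⟨F.1.compr₂ (g.restrictScalars k), IsGen.comp F.2 g⟩
  map_add' _ _ := ext fun _ _ => map_add g _ _
  map_smul' c _ := ext fun _ _ => map_smul (g.restrictScalars k) c _

end

section

variable {L' : Type u}
  [AddCommGroup L'] [Module k L'] [Module Γᵐᵒᵖ L'] [IsScalarTower k Γᵐᵒᵖ L']

/-- Precomposition in the first variable. -/
def precompL (h : L' →ₗ[Γᵐᵒᵖ] L) : GenMap k Γ A L K M →ₗ[k] GenMap k Γ A L' K M where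
  toFun F := ⟨F.1 ∘ₗ h.restrictScalars k, IsGen.precompL F.2 h⟩
  map_add' _ _ := rfl
  map_smul' _ _ := rfl

@[simp] theorem precompL_apply (h : L' →ₗ[Γᵐᵒᵖ] L) (F : GenMap k Γ A L K M) (l : L') (x : K) :
    (precompL h F).1 l x = F.1 (h l) x := rfl

end

section

variable {K' : Type u}
  [AddCommGroup K'] [Module k K'] [Module (Env k A) K'] [IsScalarTower k (Env k A) K']
  [Module Γ K'] [IsScalarTower k Γ K']

/-- Precomposition in the second variable. -/
def precompK (h : K' →ₗ[Env k A] K) (hh : ∀ (γ : Γ) x, h (γ • x) = γ • h x) :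
    GenMap k Γ A L K M →ₗ[k] GenMap k Γ A L K' M where
  toFun F := ⟨F.1.compl₂ (h.restrictScalars k), IsGen.precompK F.2 h hh⟩
  map_add' _ _ := ext fun _ _ => rfl
  map_smul' _ _ := ext fun _ _ => rfl

@[simp] theorem precompK_apply (h : K' →ₗ[Env k A] K) (hh : ∀ (γ : Γ) x, h (γ • x) = γ • h x)
    (F : GenMap k Γ A L K M) (l : L) (x : K') : (precompK h hh F).1 l x = F.1 l (h x) := rfl

end

end GenMap

end GenMap

/-! ### The product of two families of generators -/

section Cup

variable {k Γ A : Type u} [Field k] [Ring Γ] [HopfAlgebra k Γ] [Ring A] [Algebra k A]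
  [Module Γ A] [IsScalarTower k Γ A] [IsModuleAlgebra k Γ A]
  {M₁ M₂ : Type u}
  [AddCommGroup M₁] [Module k M₁]
  [Module (Env k (SmashProduct k Γ A)) M₁] [IsScalarTower k (Env k (SmashProduct k Γ A)) M₁]
  [AddCommGroup M₂] [Module k M₂]
  [Module (Env k (SmashProduct k Γ A)) M₂] [IsScalarTower k (Env k (SmashProduct k Γ A)) M₂]

namespace GenMap

/-- An element of Γ travels through the tensor product: ∑ γ₁f₁(γ₂) ⊗ f₂(γ₃) = ∑ g₁(γ₁)γ₂ ⊗ f₂(γ₃) =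
∑ g₁(γ₁) ⊗ γ₂f₂(γ₃) = ∑ g₁(γ₁) ⊗ g₂(γ₂)γ₃. The middle step needs the tensor product to be taken over
A#Γ. -/
theorem sweedler_proj (f₁ : Γ →ₗ[k] M₁) (g₁ : Γ →ₗ[k] M₁) (f₂ g₂ : Γ →ₗ[k] M₂)
    (h₁ : leftTwist Γ A f₁ = sweedler (rightAct k (SmashProduct k Γ A) M₁) g₁
      (SmashProduct.inr (Γ := Γ) (A := A) k).toLinearMap)
    (h₂ : leftTwist Γ A f₂ = sweedler (rightAct k (SmashProduct k Γ A) M₂) g₂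
      (SmashProduct.inr (Γ := Γ) (A := A) k).toLinearMap) :
    leftTwist Γ A (sweedler ((TensorProduct.mk k M₁ M₂).compr₂
        (RelTensor.proj k (SmashProduct k Γ A) M₁ M₂)) f₁ f₂) =
      sweedler (rightAct k (SmashProduct k Γ A) (RelTensor k (SmashProduct k Γ A) M₁ M₂))
        (sweedler ((TensorProduct.mk k M₁ M₂).compr₂
          (RelTensor.proj k (SmashProduct k Γ A) M₁ M₂)) g₁ g₂)
        (SmashProduct.inr (Γ := Γ) (A := A) k).toLinearMap := by
  rw [leftTwist] at h₁ h₂ ⊢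
  let T := RelTensor k (SmashProduct k Γ A) M₁ M₂
  let β : M₁ →ₗ[k] M₂ →ₗ[k] T :=
    (TensorProduct.mk k M₁ M₂).compr₂ (RelTensor.proj k (SmashProduct k Γ A) M₁ M₂)
  have e1 := sweedler_assoc (leftAct k (SmashProduct k Γ A) M₁) β β
    (leftAct k (SmashProduct k Γ A) T) (fun r m n => (RelTensor.leftAct_proj r m n).symm)
    (SmashProduct.inr (Γ := Γ) (A := A) k).toLinearMap f₁ f₂
  have e2 := sweedler_assoc (rightAct k (SmashProduct k Γ A) M₁) β
    (leftAct k (SmashProduct k Γ A) M₂) β (fun m r n => RelTensor.proj_balanced m r n)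
    g₁ (SmashProduct.inr (Γ := Γ) (A := A) k).toLinearMap f₂
  have e3 := sweedler_assoc β (rightAct k (SmashProduct k Γ A) T)
    (rightAct k (SmashProduct k Γ A) M₂) β (fun m n r => RelTensor.rightAct_proj r m n)
    g₁ g₂ (SmashProduct.inr (Γ := Γ) (A := A) k).toLinearMap
  rw [h₁] at e1
  rw [h₂] at e2
  exact e1.symm.trans (e2.trans e3.symm)

variable {L₁ L₂ K₁ K₂ : Type u}
  [AddCommGroup L₁] [Module k L₁] [Module Γᵐᵒᵖ L₁] [IsScalarTower k Γᵐᵒᵖ L₁]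
  [AddCommGroup L₂] [Module k L₂] [Module Γᵐᵒᵖ L₂] [IsScalarTower k Γᵐᵒᵖ L₂]
  [AddCommGroup K₁] [Module k K₁] [Module (Env k A) K₁] [IsScalarTower k (Env k A) K₁]
  [Module Γ K₁] [IsScalarTower k Γ K₁] [IsEquivariant k Γ A K₁]
  [AddCommGroup K₂] [Module k K₂] [Module (Env k A) K₂] [IsScalarTower k (Env k A) K₂]
  [Module Γ K₂] [IsScalarTower k Γ K₂] [IsEquivariant k Γ A K₂]

/-- The map `x ⊗ y ↦ F(l)(x) ⊗ G(l')(y)`. -/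
def pair₀ (F : GenMap k Γ A L₁ K₁ M₁) (G : GenMap k Γ A L₂ K₂ M₂) (l : L₁) (l' : L₂) :
    RelTensor k A K₁ K₂ →ₗ[k] RelTensor k (SmashProduct k Γ A) M₁ M₂ :=
  RelTensor.lift (((TensorProduct.mk k M₁ M₂).compr₂
    (RelTensor.proj k (SmashProduct k Γ A) M₁ M₂)).compl₁₂ (F.1 l) (G.1 l')) (fun x a y => by
      change RelTensor.proj k (SmashProduct k Γ A) M₁ M₂ (F.1 l _ ⊗ₜ G.1 l' y) =
        RelTensor.proj k (SmashProduct k Γ A) M₁ M₂ (F.1 l x ⊗ₜ G.1 l' _)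
      rw [F.2.right, G.2.left, RelTensor.proj_balanced])

/-- The map `l ⊗ l' ↦ (x ⊗ y ↦ F(l)(x) ⊗ G(l')(y))`. -/
def pair (F : GenMap k Γ A L₁ K₁ M₁) (G : GenMap k Γ A L₂ K₂ M₂) :
    L₁ ⊗[k] L₂ →ₗ[k] RelTensor k A K₁ K₂ →ₗ[k] RelTensor k (SmashProduct k Γ A) M₁ M₂ :=
  TensorProduct.lift (LinearMap.mk₂ k (pair₀ F G)
    (fun l₁ l₂ l' => RelTensor.ext fun x y => by
      simp only [pair₀, RelTensor.lift_proj, LinearMap.compl₁₂_apply, LinearMap.add_apply, map_add])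
    (fun c l l' => RelTensor.ext fun x y => by
      simp only [pair₀, RelTensor.lift_proj, LinearMap.compl₁₂_apply, LinearMap.smul_apply,
        map_smul])
    (fun l l₁ l₂ => RelTensor.ext fun x y => by
      simp only [pair₀, RelTensor.lift_proj, LinearMap.compl₁₂_apply, LinearMap.add_apply, map_add])
    (fun c l l' => RelTensor.ext fun x y => by
      simp only [pair₀, RelTensor.lift_proj, LinearMap.compl₁₂_apply, LinearMap.smul_apply,
        map_smul]))

theorem pair_tmul_proj (F : GenMap k Γ A L₁ K₁ M₁) (G : GenMap k Γ A L₂ K₂ M₂) (l : L₁) (l' : L₂)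
    (x : K₁) (y : K₂) : pair F G (l ⊗ₜ l') (RelTensor.proj k A K₁ K₂ (x ⊗ₜ y)) =
      RelTensor.proj k (SmashProduct k Γ A) M₁ M₂ (F.1 l x ⊗ₜ G.1 l' y) := rfl

theorem pair_ext {V : Type u} [AddCommGroup V] [Module k V]
    {f g : L₁ ⊗[k] L₂ →ₗ[k] RelTensor k A K₁ K₂ →ₗ[k] V}
    (h : ∀ l l' x y, f (l ⊗ₜ l') (RelTensor.proj k A K₁ K₂ (x ⊗ₜ y)) =
      g (l ⊗ₜ l') (RelTensor.proj k A K₁ K₂ (x ⊗ₜ y))) : f = g :=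
  TensorProduct.ext' fun l l' => RelTensor.ext fun x y => h l l' x y

theorem pair_leftAct (F : GenMap k Γ A L₁ K₁ M₁) (G : GenMap k Γ A L₂ K₂ M₂) (t : L₁ ⊗[k] L₂)
    (a : A) (z : RelTensor k A K₁ K₂) : pair F G t (leftAct k A _ a z) =
      leftAct k (SmashProduct k Γ A) _ (SmashProduct.inl k a) (pair F G t z) := by
  have : (pair F G).compl₂ (leftAct k A (RelTensor k A K₁ K₂) a) = (pair F G).compr₂
      (leftAct k (SmashProduct k Γ A) (RelTensor k (SmashProduct k Γ A) M₁ M₂)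
        (SmashProduct.inl k a)) := pair_ext fun l l' x y => by
    rw [LinearMap.compl₂_apply, LinearMap.compr₂_apply, RelTensor.leftAct_proj, pair_tmul_proj,
      pair_tmul_proj, RelTensor.leftAct_proj, F.2.left]
  exact LinearMap.congr_fun (LinearMap.congr_fun this t) z

theorem pair_rightAct (F : GenMap k Γ A L₁ K₁ M₁) (G : GenMap k Γ A L₂ K₂ M₂) (t : L₁ ⊗[k] L₂)
    (a : A) (z : RelTensor k A K₁ K₂) : pair F G t (rightAct k A _ z a) =
      rightAct k (SmashProduct k Γ A) _ (pair F G t z) (SmashProduct.inl k a) := by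
  have : (pair F G).compl₂ ((rightAct k A (RelTensor k A K₁ K₂)).flip a) = (pair F G).compr₂
      ((rightAct k (SmashProduct k Γ A) (RelTensor k (SmashProduct k Γ A) M₁ M₂)).flip
        (SmashProduct.inl k a)) := pair_ext fun l l' x y => by
    rw [LinearMap.compl₂_apply, LinearMap.compr₂_apply, LinearMap.flip_apply,
      LinearMap.flip_apply, RelTensor.rightAct_proj, pair_tmul_proj, pair_tmul_proj,
      RelTensor.rightAct_proj, G.2.right]
  exact LinearMap.congr_fun (LinearMap.congr_fun this t) z

/-- The relation in `IsGen` for the external product, on L₁ ⊗ L₂ and K₁ ⊗_A K₂ with their diagonal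
actions. Equivariance of σ and ω then carries it to L and K. -/
theorem pair_rightDiag (F : GenMap k Γ A L₁ K₁ M₁) (G : GenMap k Γ A L₂ K₂ M₂) (t : L₁ ⊗[k] L₂)
    (z : RelTensor k A K₁ K₂) (γ : Γ) :
    leftTwist Γ A ((pair F G).flip z ∘ₗ (rightDiag k L₁ L₂).flip t) γ =
      rightTwist Γ A (pair F G t) z γ := by
  obtain ⟨s, rfl⟩ := RelTensor.proj_surjective z
  induction t with
  | zero => simp [leftTwist, rightTwist, sweedler_apply _ _ _ (ℛ k γ)]
  | add t t' ht ht' =>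
    simp only [leftTwist, rightTwist, sweedler_apply _ _ _ (ℛ k γ), map_add, LinearMap.add_comp,
      LinearMap.comp_add, LinearMap.add_apply, Finset.sum_add_distrib] at ht ht' ⊢
    rw [ht, ht']
  | tmul l l' =>
    induction s with
    | zero => simp [leftTwist, rightTwist, sweedler_apply _ _ _ (ℛ k γ)]
    | add t t' ht ht' =>
      simp only [leftTwist, rightTwist, sweedler_apply _ _ _ (ℛ k γ), map_add, LinearMap.add_comp,
        LinearMap.comp_apply, orbit_apply, smul_add,
        LinearMap.add_apply, Finset.sum_add_distrib] at ht ht' ⊢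
      rw [ht, ht']
    | tmul x y =>
      have h := sweedler_proj (A := A) (F.1.flip x ∘ₗ rightOrbit (Γ := Γ) k l) (F.1 l ∘ₗ orbit (Γ := Γ) k x)
        (G.1.flip y ∘ₗ rightOrbit (Γ := Γ) k l') (G.1 l' ∘ₗ orbit (Γ := Γ) k y)
        (LinearMap.ext fun γ => F.2.equiv l x γ) (LinearMap.ext fun γ => G.2.equiv l' y γ)
      have e1 : (pair F G).flip (RelTensor.proj k A K₁ K₂ (x ⊗ₜ y)) ∘ₗ
          (rightDiag k L₁ L₂).flip (l ⊗ₜ l') = sweedler ((TensorProduct.mk k M₁ M₂).compr₂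
          (RelTensor.proj k (SmashProduct k Γ A) M₁ M₂)) (F.1.flip x ∘ₗ rightOrbit (Γ := Γ) k l)
          (G.1.flip y ∘ₗ rightOrbit (Γ := Γ) k l') := LinearMap.ext fun γ => by
        rw [LinearMap.comp_apply, LinearMap.flip_apply, LinearMap.flip_apply, rightDiag_tmul,
          sweedler_apply _ _ _ (ℛ k γ), sweedler_apply _ _ _ (ℛ k γ), map_sum,
          LinearMap.sum_apply]
        rfl
      have e2 : pair F G (l ⊗ₜ l') ∘ₗ orbit (Γ := Γ) k (RelTensor.proj k A K₁ K₂ (x ⊗ₜ y)) =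
          sweedler ((TensorProduct.mk k M₁ M₂).compr₂
            (RelTensor.proj k (SmashProduct k Γ A) M₁ M₂)) (F.1 l ∘ₗ orbit (Γ := Γ) k x)
            (G.1 l' ∘ₗ orbit (Γ := Γ) k y) := LinearMap.ext fun γ => by
        rw [LinearMap.comp_apply, orbit_apply, RelTensor.diag_smul_proj, diagAct_tmul,
          sweedler_apply _ _ _ (ℛ k γ), sweedler_apply _ _ _ (ℛ k γ), map_sum, map_sum]
        rfl
      rw [e1, rightTwist, e2, h]

theorem pair_add_left (F F' : GenMap k Γ A L₁ K₁ M₁) (G : GenMap k Γ A L₂ K₂ M₂) :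
    pair (F + F') G = pair F G + pair F' G := pair_ext fun l l' x y => by
  simp only [LinearMap.add_apply, pair_tmul_proj, GenMap.add_apply, add_tmul, map_add]

theorem pair_add_right (F : GenMap k Γ A L₁ K₁ M₁) (G G' : GenMap k Γ A L₂ K₂ M₂) :
    pair F (G + G') = pair F G + pair F G' := pair_ext fun l l' x y => by
  simp only [LinearMap.add_apply, pair_tmul_proj, GenMap.add_apply, tmul_add, map_add]

theorem pair_smul_left (c : k) (F : GenMap k Γ A L₁ K₁ M₁) (G : GenMap k Γ A L₂ K₂ M₂) :
    pair (c • F) G = c • pair F G := pair_ext fun l l' x y => by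
  simp only [LinearMap.smul_apply, pair_tmul_proj, GenMap.smul_apply, ← smul_tmul', map_smul]

theorem pair_smul_right (c : k) (F : GenMap k Γ A L₁ K₁ M₁) (G : GenMap k Γ A L₂ K₂ M₂) :
    pair F (c • G) = c • pair F G := pair_ext fun l l' x y => by
  simp only [LinearMap.smul_apply, pair_tmul_proj, GenMap.smul_apply, tmul_smul, map_smul]

section

variable {L₁' L₂' : Type u}
  [AddCommGroup L₁'] [Module k L₁'] [Module Γᵐᵒᵖ L₁'] [IsScalarTower k Γᵐᵒᵖ L₁']
  [AddCommGroup L₂'] [Module k L₂'] [Module Γᵐᵒᵖ L₂'] [IsScalarTower k Γᵐᵒᵖ L₂']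

theorem pair_precompL_left (h : L₁' →ₗ[Γᵐᵒᵖ] L₁) (F : GenMap k Γ A L₁ K₁ M₁)
    (G : GenMap k Γ A L₂ K₂ M₂) (t : L₁' ⊗[k] L₂) :
    pair F G ((h.restrictScalars k).rTensor L₂ t) = pair (precompL h F) G t := by
  have : pair F G ∘ₗ (h.restrictScalars k).rTensor L₂ = pair (precompL h F) G :=
    pair_ext fun l l' x y => rfl
  exact LinearMap.congr_fun this t

theorem pair_precompL_right (h : L₂' →ₗ[Γᵐᵒᵖ] L₂) (F : GenMap k Γ A L₁ K₁ M₁)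
    (G : GenMap k Γ A L₂ K₂ M₂) (t : L₁ ⊗[k] L₂') :
    pair F G ((h.restrictScalars k).lTensor L₁ t) = pair F (precompL h G) t := by
  have : pair F G ∘ₗ (h.restrictScalars k).lTensor L₁ = pair F (precompL h G) :=
    pair_ext fun l l' x y => rfl
  exact LinearMap.congr_fun this t

end

section

variable {K₁' K₂' : Type u}
  [AddCommGroup K₁'] [Module k K₁'] [Module (Env k A) K₁'] [IsScalarTower k (Env k A) K₁']
  [Module Γ K₁'] [IsScalarTower k Γ K₁'] [IsEquivariant k Γ A K₁']
  [AddCommGroup K₂'] [Module k K₂'] [Module (Env k A) K₂'] [IsScalarTower k (Env k A) K₂']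
  [Module Γ K₂'] [IsScalarTower k Γ K₂'] [IsEquivariant k Γ A K₂']

theorem pair_precompK_left (h : K₁' →ₗ[Env k A] K₁) (hh : ∀ (γ : Γ) x, h (γ • x) = γ • h x)
    (F : GenMap k Γ A L₁ K₁ M₁) (G : GenMap k Γ A L₂ K₂ M₂) (t : L₁ ⊗[k] L₂)
    (z : RelTensor k A K₁' K₂) :
    pair F G t (RelTensor.map h LinearMap.id z) = pair (precompK h hh F) G t z := by
  have : (pair F G).compl₂ (RelTensor.map h LinearMap.id) = pair (precompK h hh F) G :=
    pair_ext fun l l' x y => rfl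
  exact LinearMap.congr_fun (LinearMap.congr_fun this t) z

theorem pair_precompK_right (h : K₂' →ₗ[Env k A] K₂) (hh : ∀ (γ : Γ) x, h (γ • x) = γ • h x)
    (F : GenMap k Γ A L₁ K₁ M₁) (G : GenMap k Γ A L₂ K₂ M₂) (t : L₁ ⊗[k] L₂)
    (z : RelTensor k A K₁ K₂') :
    pair F G t (RelTensor.map LinearMap.id h z) = pair F (precompK h hh G) t z := by
  have : (pair F G).compl₂ (RelTensor.map LinearMap.id h) = pair F (precompK h hh G) :=
    pair_ext fun l l' x y => rfl
  exact LinearMap.congr_fun (LinearMap.congr_fun this t) z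

end

variable {L K : Type u}
  [AddCommGroup L] [Module k L] [Module Γᵐᵒᵖ L] [IsScalarTower k Γᵐᵒᵖ L]
  [AddCommGroup K] [Module k K] [Module (Env k A) K] [IsScalarTower k (Env k A) K]
  [Module Γ K] [IsScalarTower k Γ K]

theorem isGen_pair (σ : L →ₗ[k] L₁ ⊗[k] L₂)
    (hσ : ∀ (γ : Γ) l, σ (op γ • l) = rightDiag k L₁ L₂ γ (σ l))
    (ω : K →ₗ[Env k A] RelTensor k A K₁ K₂) (hω : ∀ (γ : Γ) x, ω (γ • x) = γ • ω x)
    (F : GenMap k Γ A L₁ K₁ M₁) (G : GenMap k Γ A L₂ K₂ M₂) :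
    IsGen Γ A ((pair F G ∘ₗ σ).compl₂ (ω.restrictScalars k)) where
  left l a x := (congrArg (pair F G (σ l)) (map_leftAct ω a x)).trans (pair_leftAct F G _ _ _)
  right l a x := (congrArg (pair F G (σ l)) (map_rightAct ω a x)).trans (pair_rightAct F G _ _ _)
  equiv l x γ := by
    have h := pair_rightDiag F G (σ l) (ω x) γ
    rw [leftTwist, rightTwist] at h
    have e1 : ((pair F G ∘ₗ σ).compl₂ (ω.restrictScalars k)).flip x ∘ₗ rightOrbit k l =
        (pair F G).flip (ω x) ∘ₗ (rightDiag k L₁ L₂).flip (σ l) :=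
      LinearMap.ext fun γ => congrArg (fun t => pair F G t (ω x)) (hσ γ l)
    have e2 : (pair F G ∘ₗ σ).compl₂ (ω.restrictScalars k) l ∘ₗ orbit k x =
        pair F G (σ l) ∘ₗ orbit k (ω x) :=
      LinearMap.ext fun γ => congrArg (pair F G (σ l)) (hω γ x)
    rw [e1, e2]
    exact h

/-- The product of two families of generators along `σ` and `ω`, without sign. -/
def cup (σ : L →ₗ[k] L₁ ⊗[k] L₂) (hσ : ∀ (γ : Γ) l, σ (op γ • l) = rightDiag k L₁ L₂ γ (σ l))
    (ω : K →ₗ[Env k A] RelTensor k A K₁ K₂) (hω : ∀ (γ : Γ) x, ω (γ • x) = γ • ω x) :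
    GenMap k Γ A L₁ K₁ M₁ →ₗ[k] GenMap k Γ A L₂ K₂ M₂ →ₗ[k]
      GenMap k Γ A L K (RelTensor k (SmashProduct k Γ A) M₁ M₂) :=
  LinearMap.mk₂ k (fun F G => ⟨_, isGen_pair σ hσ ω hω F G⟩)
    (fun F F' G => ext fun l x =>
      LinearMap.congr_fun (LinearMap.congr_fun (pair_add_left F F' G) (σ l)) (ω x))
    (fun c F G => ext fun l x =>
      LinearMap.congr_fun (LinearMap.congr_fun (pair_smul_left c F G) (σ l)) (ω x))
    (fun F G G' => ext fun l x =>
      LinearMap.congr_fun (LinearMap.congr_fun (pair_add_right F G G') (σ l)) (ω x))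
    (fun c F G => ext fun l x =>
      LinearMap.congr_fun (LinearMap.congr_fun (pair_smul_right c F G) (σ l)) (ω x))

theorem cup_apply (σ : L →ₗ[k] L₁ ⊗[k] L₂)
    (hσ : ∀ (γ : Γ) l, σ (op γ • l) = rightDiag k L₁ L₂ γ (σ l))
    (ω : K →ₗ[Env k A] RelTensor k A K₁ K₂) (hω : ∀ (γ : Γ) x, ω (γ • x) = γ • ω x)
    (F : GenMap k Γ A L₁ K₁ M₁) (G : GenMap k Γ A L₂ K₂ M₂) (l : L) (x : K) :
    (cup σ hσ ω hω F G).1 l x = pair F G (σ l) (ω x) := rfl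

section

variable {N₁ N₂ : Type u}
  [AddCommGroup N₁] [Module k N₁]
  [Module (Env k (SmashProduct k Γ A)) N₁] [IsScalarTower k (Env k (SmashProduct k Γ A)) N₁]
  [AddCommGroup N₂] [Module k N₂]
  [Module (Env k (SmashProduct k Γ A)) N₂] [IsScalarTower k (Env k (SmashProduct k Γ A)) N₂]

theorem postcomp_cup (f : M₁ →ₗ[Env k (SmashProduct k Γ A)] N₁)
    (g : M₂ →ₗ[Env k (SmashProduct k Γ A)] N₂) (σ : L →ₗ[k] L₁ ⊗[k] L₂)
    (hσ : ∀ (γ : Γ) l, σ (op γ • l) = rightDiag k L₁ L₂ γ (σ l))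
    (ω : K →ₗ[Env k A] RelTensor k A K₁ K₂) (hω : ∀ (γ : Γ) x, ω (γ • x) = γ • ω x)
    (F : GenMap k Γ A L₁ K₁ M₁) (G : GenMap k Γ A L₂ K₂ M₂) :
    postcomp (RelTensor.mapEnv f g) (cup σ hσ ω hω F G) =
      cup σ hσ ω hω (postcomp f F) (postcomp g G) := by
  have : (pair F G).compr₂ (RelTensor.map f g) = pair (postcomp f F) (postcomp g G) :=
    pair_ext fun l l' x y => rfl
  exact ext fun l x => LinearMap.congr_fun (LinearMap.congr_fun this (σ l)) (ω x)

end

section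

variable {L' L₁' L₂' : Type u}
  [AddCommGroup L'] [Module k L'] [Module Γᵐᵒᵖ L'] [IsScalarTower k Γᵐᵒᵖ L']
  [AddCommGroup L₁'] [Module k L₁'] [Module Γᵐᵒᵖ L₁'] [IsScalarTower k Γᵐᵒᵖ L₁']
  [AddCommGroup L₂'] [Module k L₂'] [Module Γᵐᵒᵖ L₂'] [IsScalarTower k Γᵐᵒᵖ L₂']

theorem precompL_cup (h : L' →ₗ[Γᵐᵒᵖ] L) (h₁ : L₁' →ₗ[Γᵐᵒᵖ] L₁) (h₂ : L₂' →ₗ[Γᵐᵒᵖ] L₂)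
    (σ : L →ₗ[k] L₁ ⊗[k] L₂) (hσ : ∀ (γ : Γ) l, σ (op γ • l) = rightDiag k L₁ L₂ γ (σ l))
    (σ₁ : L' →ₗ[k] L₁' ⊗[k] L₂) (hσ₁ : ∀ (γ : Γ) l, σ₁ (op γ • l) = rightDiag k L₁' L₂ γ (σ₁ l))
    (σ₂ : L' →ₗ[k] L₁ ⊗[k] L₂') (hσ₂ : ∀ (γ : Γ) l, σ₂ (op γ • l) = rightDiag k L₁ L₂' γ (σ₂ l))
    (c : k) (hc : ∀ l, σ (h l) = (h₁.restrictScalars k).rTensor L₂ (σ₁ l) +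
      c • (h₂.restrictScalars k).lTensor L₁ (σ₂ l))
    (ω : K →ₗ[Env k A] RelTensor k A K₁ K₂) (hω : ∀ (γ : Γ) x, ω (γ • x) = γ • ω x)
    (F : GenMap k Γ A L₁ K₁ M₁) (G : GenMap k Γ A L₂ K₂ M₂) :
    precompL h (cup σ hσ ω hω F G) =
      cup σ₁ hσ₁ ω hω (precompL h₁ F) G + c • cup σ₂ hσ₂ ω hω F (precompL h₂ G) := by
  refine ext fun l x => ?_
  have e : pair F G (σ (h l)) = pair (precompL h₁ F) G (σ₁ l) +
      c • pair F (precompL h₂ G) (σ₂ l) := by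
    rw [hc, map_add, map_smul, pair_precompL_left, pair_precompL_right]
  rw [precompL_apply, cup_apply, e, add_apply, smul_apply, cup_apply, cup_apply]
  rfl

end

section

variable {K' K₁' K₂' : Type u}
  [AddCommGroup K'] [Module k K'] [Module (Env k A) K'] [IsScalarTower k (Env k A) K']
  [Module Γ K'] [IsScalarTower k Γ K']
  [AddCommGroup K₁'] [Module k K₁'] [Module (Env k A) K₁'] [IsScalarTower k (Env k A) K₁']
  [Module Γ K₁'] [IsScalarTower k Γ K₁'] [IsEquivariant k Γ A K₁']
  [AddCommGroup K₂'] [Module k K₂'] [Module (Env k A) K₂'] [IsScalarTower k (Env k A) K₂']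
  [Module Γ K₂'] [IsScalarTower k Γ K₂'] [IsEquivariant k Γ A K₂']

theorem precompK_cup (h : K' →ₗ[Env k A] K) (hh : ∀ (γ : Γ) x, h (γ • x) = γ • h x)
    (h₁ : K₁' →ₗ[Env k A] K₁) (hh₁ : ∀ (γ : Γ) x, h₁ (γ • x) = γ • h₁ x)
    (h₂ : K₂' →ₗ[Env k A] K₂) (hh₂ : ∀ (γ : Γ) x, h₂ (γ • x) = γ • h₂ x)
    (σ : L →ₗ[k] L₁ ⊗[k] L₂) (hσ : ∀ (γ : Γ) l, σ (op γ • l) = rightDiag k L₁ L₂ γ (σ l))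
    (ω : K →ₗ[Env k A] RelTensor k A K₁ K₂) (hω : ∀ (γ : Γ) x, ω (γ • x) = γ • ω x)
    (ω₁ : K' →ₗ[Env k A] RelTensor k A K₁' K₂) (hω₁ : ∀ (γ : Γ) x, ω₁ (γ • x) = γ • ω₁ x)
    (ω₂ : K' →ₗ[Env k A] RelTensor k A K₁ K₂') (hω₂ : ∀ (γ : Γ) x, ω₂ (γ • x) = γ • ω₂ x)
    (c : k) (hc : ∀ x, ω (h x) = RelTensor.map h₁ LinearMap.id (ω₁ x) +
      c • RelTensor.map LinearMap.id h₂ (ω₂ x))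
    (F : GenMap k Γ A L₁ K₁ M₁) (G : GenMap k Γ A L₂ K₂ M₂) :
    precompK h hh (cup σ hσ ω hω F G) =
      cup σ hσ ω₁ hω₁ (precompK h₁ hh₁ F) G + c • cup σ hσ ω₂ hω₂ F (precompK h₂ hh₂ G) := by
  refine ext fun l x => ?_
  have e : pair F G (σ l) (ω (h x)) = pair (precompK h₁ hh₁ F) G (σ l) (ω₁ x) +
      c • pair F (precompK h₂ hh₂ G) (σ l) (ω₂ x) := by
    rw [hc, map_add, map_smul, pair_precompK_left h₁ hh₁, pair_precompK_right h₂ hh₂]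
  rw [precompK_apply, cup_apply, e, add_apply, smul_apply, cup_apply, cup_apply]

end

end GenMap

end Cup


/-! ### Koszul signs and the Leibniz rule for products of families -/

section Diagonal

variable {k Γ A : Type u} [Field k] [Ring Γ] [HopfAlgebra k Γ] [Ring A] [Algebra k A]
  [Module Γ A] [IsScalarTower k Γ A] [IsModuleAlgebra k Γ A]
  {K : EquivRes k Γ A} {L : TrivRes k Γ} (ω : EquivDiagonal K) (σ : TrivDiagonal L)
  {M₁ M₂ : Type u} [AddCommGroup M₁] [Module k M₁]
  [Module (Env k (SmashProduct k Γ A)) M₁] [IsScalarTower k (Env k (SmashProduct k Γ A)) M₁]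
  [AddCommGroup M₂] [Module k M₂]
  [Module (Env k (SmashProduct k Γ A)) M₂] [IsScalarTower k (Env k (SmashProduct k Γ A)) M₂]

namespace GenMap

variable (K L) (M : Type u) [AddCommGroup M] [Module k M]
  [Module (Env k (SmashProduct k Γ A)) M] [IsScalarTower k (Env k (SmashProduct k Γ A)) M] in
/-- The families of generators with values in `M` in bidegree `(p, q)`. -/
abbrev Bi (p q : ℕ) : Type u :=
  GenMap k Γ A (L.X p) (K.X q) M

/-- The product of two families of generators along the components of `σ` and `ω`, with the
Koszul sign. -/
def term (p q p₁ p₂ q₁ q₂ : ℕ) :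
    Bi K L M₁ p₁ q₁ →ₗ[k] Bi K L M₂ p₂ q₂ →ₗ[k]
      Bi K L (RelTensor k (SmashProduct k Γ A) M₁ M₂) p q :=
  (-1 : k) ^ (p₂ * q₁) •
    cup (σ.σ p p₁ p₂) (σ.equivariant p p₁ p₂) (ω.ω q q₁ q₂) (ω.ω_smul q q₁ q₂)

theorem precompL_d_cup (p p₁ p₂ q q₁ q₂ : ℕ) (F : Bi K L M₁ p₁ q₁) (G : Bi K L M₂ p₂ q₂) :
    precompL (L.d p) (cup (σ.σ p p₁ p₂) (σ.equivariant p p₁ p₂) (ω.ω q q₁ q₂)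
        (ω.ω_smul q q₁ q₂) F G) =
      cup (σ.σ (p + 1) (p₁ + 1) p₂) (σ.equivariant (p + 1) (p₁ + 1) p₂) (ω.ω q q₁ q₂)
        (ω.ω_smul q q₁ q₂) (precompL (L.d p₁) F) G +
      (-1 : k) ^ p₁ • cup (σ.σ (p + 1) p₁ (p₂ + 1)) (σ.equivariant (p + 1) p₁ (p₂ + 1))
        (ω.ω q q₁ q₂) (ω.ω_smul q q₁ q₂) F (precompL (L.d p₂) G) := by
  exact precompL_cup (L.d p) (L.d p₁) (L.d p₂) _ _ _ _ _ _ _ (σ.comm p p₁ p₂) _ _ F G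

theorem precompK_d_cup (p p₁ p₂ q q₁ q₂ : ℕ) (F : Bi K L M₁ p₁ q₁) (G : Bi K L M₂ p₂ q₂) :
    precompK (K.d q) (K.d_smul q) (cup (σ.σ p p₁ p₂) (σ.equivariant p p₁ p₂) (ω.ω q q₁ q₂)
        (ω.ω_smul q q₁ q₂) F G) =
      cup (σ.σ p p₁ p₂) (σ.equivariant p p₁ p₂) (ω.ω (q + 1) (q₁ + 1) q₂)
        (ω.ω_smul (q + 1) (q₁ + 1) q₂) (precompK (K.d q₁) (K.d_smul q₁) F) G +
      (-1 : k) ^ q₁ • cup (σ.σ p p₁ p₂) (σ.equivariant p p₁ p₂) (ω.ω (q + 1) q₁ (q₂ + 1))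
        (ω.ω_smul (q + 1) q₁ (q₂ + 1)) F (precompK (K.d q₂) (K.d_smul q₂) G) := by
  exact precompK_cup _ _ _ _ _ _ _ _ _ _ _ _ _ _ _ (ω.comm q q₁ q₂) F G

/-- Raising p₂ by one changes the Koszul sign by (-1)^q₁, which combines with the sign (-1)^p₁ in
the chain map condition on σ to give the total degree of F. -/
theorem precompL_term (p p₁ p₂ q q₁ q₂ : ℕ) (F : Bi K L M₁ p₁ q₁) (G : Bi K L M₂ p₂ q₂) :
    precompL (L.d p) (term ω σ p q p₁ p₂ q₁ q₂ F G) =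
      term ω σ (p + 1) q (p₁ + 1) p₂ q₁ q₂ (precompL (L.d p₁) F) G +
      (-1 : k) ^ (p₁ + q₁) • term ω σ (p + 1) q p₁ (p₂ + 1) q₁ q₂ F (precompL (L.d p₂) G) := by
  rw [term, term, term, LinearMap.smul_apply, LinearMap.smul_apply, LinearMap.smul_apply,
    LinearMap.smul_apply, LinearMap.smul_apply, LinearMap.smul_apply, map_smul, precompL_d_cup,
    smul_add, smul_smul, smul_smul, ← pow_add, ← pow_add]
  congr 2
  rw [show p₁ + q₁ + (p₂ + 1) * q₁ = p₂ * q₁ + p₁ + (q₁ + q₁) by ring, pow_add _ _ (q₁ + q₁),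
    Even.neg_one_pow (n := q₁ + q₁) ⟨q₁, rfl⟩, mul_one]

/-- The sign (-1)^p of the total differential splits as (-1)^p₁ (-1)^p₂, and the second factor is
the change of the Koszul sign when q₁ grows by one. -/
theorem precompK_term (p p₁ p₂ q q₁ q₂ : ℕ) (hp : p₁ + p₂ = p) (F : Bi K L M₁ p₁ q₁)
    (G : Bi K L M₂ p₂ q₂) :
    (-1 : k) ^ p • precompK (K.d q) (K.d_smul q) (term ω σ p q p₁ p₂ q₁ q₂ F G) =
      (-1 : k) ^ p₁ • term ω σ p (q + 1) p₁ p₂ (q₁ + 1) q₂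
        (precompK (K.d q₁) (K.d_smul q₁) F) G +
      (-1 : k) ^ (p₁ + q₁) • (-1 : k) ^ p₂ • term ω σ p (q + 1) p₁ p₂ q₁ (q₂ + 1) F
        (precompK (K.d q₂) (K.d_smul q₂) G) := by
  subst hp
  rw [term, term, term, LinearMap.smul_apply, LinearMap.smul_apply, LinearMap.smul_apply,
    LinearMap.smul_apply, LinearMap.smul_apply, LinearMap.smul_apply, map_smul, precompK_d_cup,
    smul_add, smul_add, smul_smul, smul_smul, smul_smul, smul_smul, smul_smul, smul_smul]
  congr 2 <;> ring

/-- For a family concentrated in total degree m this replaces the sign read off from a bidegree by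
the uniform (-1)^m. -/
theorem smul_congr_of_homog {V : Type*} [AddCommGroup V] [Module k V] {m n : ℕ} (v : V)
    (h : n ≠ m → v = 0) : (-1 : k) ^ n • v = (-1 : k) ^ m • v := by
  by_cases hn : n = m
  · rw [hn]
  · rw [h hn, smul_zero, smul_zero]

/-- The composite of a family of generators with the differential of `L`. -/
def famH (F : ∀ p q, Bi K L M₁ p q) : ∀ p q, Bi K L M₁ p q
  | 0, _ => 0
  | p + 1, q => precompL (L.d p) (F p q)

/-- The composite of a family of generators with the differential of `K`. -/
def famV (F : ∀ p q, Bi K L M₁ p q) (p : ℕ) : ∀ q, Bi K L M₁ p q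
  | 0 => 0
  | q + 1 => precompK (K.d q) (K.d_smul q) (F p q)

/-- The product of two families of generators. -/
def famMul (F : ∀ p q, Bi K L M₁ p q) (G : ∀ p q, Bi K L M₂ p q) (p q : ℕ) :
    Bi K L (RelTensor k (SmashProduct k Γ A) M₁ M₂) p q :=
  ∑ a ∈ Finset.HasAntidiagonal.antidiagonal p, ∑ b ∈ Finset.HasAntidiagonal.antidiagonal q,
    term ω σ p q a.1 a.2 b.1 b.2 (F a.1 b.1) (G a.2 b.2)

theorem term_zero_left (p p₁ p₂ q q₁ q₂ : ℕ) (G : Bi K L M₂ p₂ q₂) :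
    term ω σ p q p₁ p₂ q₁ q₂ (0 : Bi K L M₁ p₁ q₁) G = 0 := by
  rw [map_zero, LinearMap.zero_apply]

theorem term_zero_right (p p₁ p₂ q q₁ q₂ : ℕ) (F : Bi K L M₁ p₁ q₁) :
    term ω σ p q p₁ p₂ q₁ q₂ F (0 : Bi K L M₂ p₂ q₂) = 0 := map_zero _

theorem famMul_eq_zero {m n : ℕ} (F : ∀ p q, Bi K L M₁ p q) (G : ∀ p q, Bi K L M₂ p q)
    (hF : ∀ p q, p + q ≠ m → F p q = 0) (hG : ∀ p q, p + q ≠ n → G p q = 0) (p q : ℕ)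
    (h : m + n ≠ p + q) : famMul ω σ F G p q = 0 := by
  refine Finset.sum_eq_zero fun a ha => Finset.sum_eq_zero fun b hb => ?_
  rw [Finset.HasAntidiagonal.mem_antidiagonal] at ha hb
  by_cases h1 : a.1 + b.1 = m
  · rw [hG a.2 b.2 (by omega), term_zero_right]
  · rw [hF a.1 b.1 h1, term_zero_left]

theorem famMul_famH_zero_left (F : ∀ p q, Bi K L M₁ p q) (G : ∀ p q, Bi K L M₂ p q) (q : ℕ) :
    famMul ω σ (famH F) G 0 q = 0 := by
  refine Finset.sum_eq_zero fun a ha => Finset.sum_eq_zero fun b _ => ?_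
  obtain ⟨a1, a2⟩ := a
  obtain ⟨rfl, rfl⟩ : a1 = 0 ∧ a2 = 0 := by simpa using ha
  exact term_zero_left ω σ _ _ _ _ _ _ _

theorem famMul_famH_zero_right (F : ∀ p q, Bi K L M₁ p q) (G : ∀ p q, Bi K L M₂ p q) (q : ℕ) :
    famMul ω σ F (famH G) 0 q = 0 := by
  refine Finset.sum_eq_zero fun a ha => Finset.sum_eq_zero fun b _ => ?_
  obtain ⟨a1, a2⟩ := a
  obtain ⟨rfl, rfl⟩ : a1 = 0 ∧ a2 = 0 := by simpa using ha
  exact term_zero_right ω σ _ _ _ _ _ _ _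

theorem famMul_famH_succ_left (F : ∀ p q, Bi K L M₁ p q) (G : ∀ p q, Bi K L M₂ p q) (p q : ℕ) :
    famMul ω σ (famH F) G (p + 1) q = ∑ a ∈ Finset.HasAntidiagonal.antidiagonal p,
      ∑ b ∈ Finset.HasAntidiagonal.antidiagonal q, term ω σ (p + 1) q (a.1 + 1) a.2 b.1 b.2
        (precompL (L.d a.1) (F a.1 b.1)) (G a.2 b.2) := by
  rw [famMul, Finset.Nat.sum_antidiagonal_succ]
  refine (congrArg (· + _) (Finset.sum_eq_zero fun b _ => ?_)).trans (zero_add _)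
  exact term_zero_left ω σ _ _ _ _ _ _ _

theorem famMul_famH_succ_right (F : ∀ p q, Bi K L M₁ p q) (G : ∀ p q, Bi K L M₂ p q) (p q : ℕ) :
    famMul ω σ F (famH G) (p + 1) q = ∑ a ∈ Finset.HasAntidiagonal.antidiagonal p,
      ∑ b ∈ Finset.HasAntidiagonal.antidiagonal q, term ω σ (p + 1) q a.1 (a.2 + 1) b.1 b.2
        (F a.1 b.1) (precompL (L.d a.2) (G a.2 b.2)) := by
  rw [famMul, Finset.Nat.sum_antidiagonal_succ']
  refine (congrArg (· + _) (Finset.sum_eq_zero fun b _ => ?_)).trans (zero_add _)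
  exact term_zero_right ω σ _ _ _ _ _ _ _

theorem famH_famMul {m : ℕ} (F : ∀ p q, Bi K L M₁ p q) (G : ∀ p q, Bi K L M₂ p q)
    (hF : ∀ p q, p + q ≠ m → F p q = 0) (p q : ℕ) : famH (famMul ω σ F G) p q =
      famMul ω σ (famH F) G p q + (-1 : k) ^ m • famMul ω σ F (famH G) p q := by
  cases p with
  | zero =>
    rw [famMul_famH_zero_left, famMul_famH_zero_right, smul_zero, add_zero]
    rfl
  | succ p =>
    rw [famMul_famH_succ_left, famMul_famH_succ_right, famH, famMul, map_sum, Finset.smul_sum,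
      ← Finset.sum_add_distrib]
    refine Finset.sum_congr rfl fun a _ => ?_
    rw [map_sum, Finset.smul_sum, ← Finset.sum_add_distrib]
    refine Finset.sum_congr rfl fun b _ => ?_
    rw [precompL_term]
    congr 1
    refine smul_congr_of_homog _ fun h => ?_
    rw [hF _ _ h, term_zero_left]

theorem famV_famMul {m : ℕ} (F : ∀ p q, Bi K L M₁ p q) (G : ∀ p q, Bi K L M₂ p q)
    (hF : ∀ p q, p + q ≠ m → F p q = 0) (p q : ℕ) : (-1 : k) ^ p • famV (famMul ω σ F G) p q =
      famMul ω σ (fun p q => (-1 : k) ^ p • famV F p q) G p q +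
        (-1 : k) ^ m • famMul ω σ F (fun p q => (-1 : k) ^ p • famV G p q) p q := by
  rw [famMul, famMul, Finset.smul_sum, ← Finset.sum_add_distrib]
  cases q with
  | zero =>
    rw [Finset.sum_eq_zero, famV, smul_zero]
    intro a _
    rw [Finset.sum_eq_zero, Finset.sum_eq_zero, smul_zero, add_zero]
    · intro b hb
      obtain ⟨b1, b2⟩ := b
      obtain ⟨rfl, rfl⟩ : b1 = 0 ∧ b2 = 0 := by simpa using hb
      rw [famV, smul_zero, term_zero_right]
    · intro b hb
      obtain ⟨b1, b2⟩ := b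
      obtain ⟨rfl, rfl⟩ : b1 = 0 ∧ b2 = 0 := by simpa using hb
      rw [famV, smul_zero, term_zero_left]
  | succ q =>
    rw [famV, famMul, map_sum, Finset.smul_sum]
    refine Finset.sum_congr rfl fun a ha => ?_
    rw [Finset.HasAntidiagonal.mem_antidiagonal] at ha
    -- The antidiagonal of q + 1 has one term more than that of q, at b₁ = 0 and b₂ = 0
    -- respectively, and there `famV` vanishes.
    rw [Finset.Nat.sum_antidiagonal_succ, Finset.Nat.sum_antidiagonal_succ', famV, famV,
      smul_zero, smul_zero, term_zero_left, term_zero_right, zero_add,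
      zero_add, map_sum, Finset.smul_sum, Finset.smul_sum, ← Finset.sum_add_distrib]
    refine Finset.sum_congr rfl fun b _ => ?_
    rw [precompK_term ω σ p a.1 a.2 q b.1 b.2 ha, famV, famV, map_smul, map_smul,
      LinearMap.smul_apply]
    congr 1
    refine smul_congr_of_homog _ fun h => ?_
    rw [hF _ _ h, term_zero_left, smul_zero]

theorem famMul_add_left (F F' : ∀ p q, Bi K L M₁ p q) (G : ∀ p q, Bi K L M₂ p q) (p q : ℕ) :
    famMul ω σ (fun p q => F p q + F' p q) G p q =
      famMul ω σ F G p q + famMul ω σ F' G p q := by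
  simp only [famMul, ← Finset.sum_add_distrib]
  exact Finset.sum_congr rfl fun a _ => Finset.sum_congr rfl fun b _ =>
    LinearMap.map_add₂ (term ω σ p q a.1 a.2 b.1 b.2) _ _ _

theorem famMul_add_right (F : ∀ p q, Bi K L M₁ p q) (G G' : ∀ p q, Bi K L M₂ p q) (p q : ℕ) :
    famMul ω σ F (fun p q => G p q + G' p q) p q =
      famMul ω σ F G p q + famMul ω σ F G' p q := by
  simp only [famMul, ← Finset.sum_add_distrib]
  exact Finset.sum_congr rfl fun a _ => Finset.sum_congr rfl fun b _ =>
    map_add (term ω σ p q a.1 a.2 b.1 b.2 _) _ _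

theorem postcomp_famMul {N₁ N₂ : Type u} [AddCommGroup N₁] [Module k N₁]
    [Module (Env k (SmashProduct k Γ A)) N₁] [IsScalarTower k (Env k (SmashProduct k Γ A)) N₁]
    [AddCommGroup N₂] [Module k N₂]
    [Module (Env k (SmashProduct k Γ A)) N₂] [IsScalarTower k (Env k (SmashProduct k Γ A)) N₂]
    (f : M₁ →ₗ[Env k (SmashProduct k Γ A)] N₁) (g : M₂ →ₗ[Env k (SmashProduct k Γ A)] N₂)
    (F : ∀ p q, Bi K L M₁ p q) (G : ∀ p q, Bi K L M₂ p q) (p q : ℕ) :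
    postcomp (RelTensor.mapEnv f g) (famMul ω σ F G p q) =
      famMul ω σ (fun p q => postcomp f (F p q)) (fun p q => postcomp g (G p q)) p q := by
  rw [famMul, map_sum]
  refine Finset.sum_congr rfl fun a _ => ?_
  rw [map_sum]
  refine Finset.sum_congr rfl fun b _ => ?_
  rw [term, term, LinearMap.smul_apply, LinearMap.smul_apply, LinearMap.smul_apply,
    LinearMap.smul_apply, map_smul, postcomp_cup]

end GenMap

end Diagonal


/-! ### Products of families with values in complexes -/

section Diagonal

namespace GenMap

variable {k Γ A : Type u} [Field k] [Ring Γ] [HopfAlgebra k Γ] [Ring A] [Algebra k A]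
  [Module Γ A] [IsScalarTower k Γ A] [IsModuleAlgebra k Γ A]
  {K : EquivRes k Γ A} {L : TrivRes k Γ} (ω : EquivDiagonal K) (σ : TrivDiagonal L)
  {M₁ M₂ N₁ N₂ : Type u} [AddCommGroup M₁] [Module k M₁]
  [Module (Env k (SmashProduct k Γ A)) M₁] [IsScalarTower k (Env k (SmashProduct k Γ A)) M₁]
  [AddCommGroup M₂] [Module k M₂]
  [Module (Env k (SmashProduct k Γ A)) M₂] [IsScalarTower k (Env k (SmashProduct k Γ A)) M₂]
  [AddCommGroup N₁] [Module k N₁]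
  [Module (Env k (SmashProduct k Γ A)) N₁] [IsScalarTower k (Env k (SmashProduct k Γ A)) N₁]
  [AddCommGroup N₂] [Module k N₂]
  [Module (Env k (SmashProduct k Γ A)) N₂] [IsScalarTower k (Env k (SmashProduct k Γ A)) N₂]

/-- The product of families of generators is compatible with the differentials, when the values of
the families are taken in complexes. -/
theorem famMul_comm {m : ℕ} (f : N₁ →ₗ[Env k (SmashProduct k Γ A)] M₁)
    (g : N₂ →ₗ[Env k (SmashProduct k Γ A)] M₂)
    (F : ∀ p q, Bi K L M₁ p q) (F' : ∀ p q, Bi K L N₁ p q)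
    (G : ∀ p q, Bi K L M₂ p q) (G' : ∀ p q, Bi K L N₂ p q)
    (h0 : ∀ p q, p + q ≠ m → F p q = 0)
    (hF : ∀ p q, postcomp f (F' p q) = famH F p q + (-1 : k) ^ p • famV F p q)
    (hG : ∀ p q, postcomp g (G' p q) = famH G p q + (-1 : k) ^ p • famV G p q) (p q : ℕ) :
    famH (famMul ω σ F G) p q + (-1 : k) ^ p • famV (famMul ω σ F G) p q =
      postcomp (RelTensor.mapEnv f
        (LinearMap.id : M₂ →ₗ[Env k (SmashProduct k Γ A)] M₂)) (famMul ω σ F' G p q) +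
        (-1 : k) ^ m • postcomp (RelTensor.mapEnv
        (LinearMap.id : M₁ →ₗ[Env k (SmashProduct k Γ A)] M₁) g) (famMul ω σ F G' p q) := by
  have e1 : postcomp (RelTensor.mapEnv f
        (LinearMap.id : M₂ →ₗ[Env k (SmashProduct k Γ A)] M₂)) (famMul ω σ F' G p q) =
      famMul ω σ (famH F) G p q +
        famMul ω σ (fun p q => (-1 : k) ^ p • famV F p q) G p q := by
    rw [postcomp_famMul, ← famMul_add_left]
    exact congrArg (fun F : ∀ p q, Bi K L M₁ p q => famMul ω σ F G p q)
      (funext fun p => funext fun q => hF p q)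
  have e2 : postcomp (RelTensor.mapEnv
        (LinearMap.id : M₁ →ₗ[Env k (SmashProduct k Γ A)] M₁) g) (famMul ω σ F G' p q) =
      famMul ω σ F (famH G) p q +
        famMul ω σ F (fun p q => (-1 : k) ^ p • famV G p q) p q := by
    rw [postcomp_famMul, ← famMul_add_right]
    exact congrArg (fun G : ∀ p q, Bi K L M₂ p q => famMul ω σ F G p q)
      (funext fun p => funext fun q => hG p q)
  rw [e1, e2, smul_add, famH_famMul ω σ F G h0, famV_famMul ω σ F G h0]
  exact add_add_add_comm _ _ _ _

end GenMap

end Diagonal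

/-! ### The diagonal map of the resolution -/

section Diagonal

variable {k Γ A : Type u} [Field k] [Ring Γ] [HopfAlgebra k Γ] [Ring A] [Algebra k A]
  [Module Γ A] [IsScalarTower k Γ A] [IsModuleAlgebra k Γ A]
  (hS : Function.Bijective (HopfAlgebra.antipode k (A := Γ)))
  {K : EquivRes k Γ A} {L : TrivRes k Γ} (ω : EquivDiagonal K) (σ : TrivDiagonal L)

variable (K L) in
/-- The terms of the resolution. -/
abbrev IndTot (n : ℕ) : Type u := Tot (Env k (SmashProduct k Γ A)) (IndCx hS K L) n

instance (n : ℕ) : AddCommGroup (IndTot hS K L n) := inferInstance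

instance (n : ℕ) : Module k (IndTot hS K L n) := inferInstance

instance (n : ℕ) : Module (Env k (SmashProduct k Γ A)) (IndTot hS K L n) := inferInstance

instance (n : ℕ) : IsScalarTower k (Env k (SmashProduct k Γ A)) (IndTot hS K L n) :=
  inferInstance

variable (K L) in
/-- The generators in bidegree `(p, q)` of the resolution, in degree `n`. -/
def indGen (n p q : ℕ) : GenMap.Bi K L (IndTot hS K L n) p q :=
  GenMap.postcomp (N := IndTot hS K L n)
    (Tot.single (S := Env k (SmashProduct k Γ A)) (T := IndCx hS K L) n p q)
    ⟨Ind.gen (L.X p) (K.X q) hS, Ind.isGen_gen hS⟩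

theorem indGen_apply (n p q : ℕ) (l : L.X p) (x : K.X q) : (indGen hS K L n p q).1 l x =
    Tot.single (S := Env k (SmashProduct k Γ A)) (T := IndCx hS K L) n p q
      (Ind.gen (L.X p) (K.X q) hS l x) := rfl

theorem indGen_of_ne {n p q : ℕ} (h : p + q ≠ n) : indGen hS K L n p q = 0 := by
  refine GenMap.ext fun l x => ?_
  rw [indGen_apply, Tot.single_of_ne h]
  rfl

theorem singleH_gen (n p q : ℕ) (l : L.X p) (x : K.X q) :
    Tot.singleH (indH hS K L) n p q (Ind.gen (L.X p) (K.X q) hS l x) =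
      (GenMap.famH (indGen hS K L n) p q).1 l x := by
  cases p with
  | zero => rfl
  | succ p =>
    refine congrArg (Tot.single (S := Env k (SmashProduct k Γ A)) (T := IndCx hS K L) n p q) ?_
    exact Ind.mapL_gen hS (L.d p) l x

theorem singleV_gen (n p q : ℕ) (l : L.X p) (x : K.X q) :
    Tot.singleV (indV hS K L) n p q (Ind.gen (L.X p) (K.X q) hS l x) =
      (GenMap.famV (indGen hS K L n) p q).1 l x := by
  cases q with
  | zero => cases p <;> rfl
  | succ q =>
    have : Tot.singleV (indV hS K L) n p (q + 1) =
        Tot.single (S := Env k (SmashProduct k Γ A)) (T := IndCx hS K L) n p q ∘ₗ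
          indV hS K L p q := by
      cases p <;> rfl
    rw [this, LinearMap.comp_apply]
    refine congrArg (Tot.single (S := Env k (SmashProduct k Γ A)) (T := IndCx hS K L) n p q) ?_
    exact Ind.mapK_gen hS (K.d q) (K.d_smul q) l x

theorem d_indGen (n p q : ℕ) (l : L.X p) (x : K.X q) :
    indD hS K L n ((indGen hS K L (n + 1) p q).1 l x) =
      (GenMap.famH (indGen hS K L n) p q).1 l x +
        (-1 : k) ^ p • (GenMap.famV (indGen hS K L n) p q).1 l x := by
  have h := Tot.d_single (S := Env k (SmashProduct k Γ A)) (T := IndCx hS K L) (indH hS K L)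
    (indV hS K L) n p q (Ind.gen (L.X p) (K.X q) hS l x)
  rw [singleH_gen, singleV_gen] at h
  exact h.trans (congrArg (_ + ·) (neg_one_pow_smul_eq (k := k) p _).symm)

/-- On the tautological family the differential of the resolution becomes precomposition with the
differentials of L and K. This is the hypothesis under which `GenMap.famMul_comm` applies. -/
theorem postcomp_indD (n p q : ℕ) :
    GenMap.postcomp (indD hS K L n) (indGen hS K L (n + 1) p q) =
      GenMap.famH (indGen hS K L n) p q + (-1 : k) ^ p • GenMap.famV (indGen hS K L n) p q :=
  GenMap.ext fun l x => d_indGen hS n p q l x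

variable (K L) in
/-- The map on the resolution given by families of generators. -/
def indDesc {M : Type u} [AddCommGroup M] [Module k M]
    [Module (Env k (SmashProduct k Γ A)) M] [IsScalarTower k (Env k (SmashProduct k Γ A)) M]
    (n : ℕ) (F : ∀ p q, GenMap.Bi K L M p q) :
    IndTot hS K L n →ₗ[Env k (SmashProduct k Γ A)] M :=
  Tot.desc n fun p q => Ind.lift hS (F p q).1 (F p q).2

theorem indDesc_gen {M : Type u} [AddCommGroup M] [Module k M]
    [Module (Env k (SmashProduct k Γ A)) M] [IsScalarTower k (Env k (SmashProduct k Γ A)) M]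
    {n p q : ℕ} (h : p + q = n) (F : ∀ p q, GenMap.Bi K L M p q) (l : L.X p) (x : K.X q) :
    indDesc hS K L n F ((indGen hS K L n p q).1 l x) = (F p q).1 l x :=
  (Tot.desc_single h _ _).trans (Ind.lift_gen hS _ _ l x)

theorem indRes_hom_ext {M : Type u} [AddCommGroup M] [Module k M]
    [Module (Env k (SmashProduct k Γ A)) M] [IsScalarTower k (Env k (SmashProduct k Γ A)) M]
    {n : ℕ} {f g : IndTot hS K L n →ₗ[Env k (SmashProduct k Γ A)] M}
    (h : ∀ p q, p + q = n → ∀ l x, f ((indGen hS K L n p q).1 l x) =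
      g ((indGen hS K L n p q).1 l x)) : f = g := by
  refine LinearMap.ext fun z => ?_
  refine Tot.hom_ext (S := Env k (SmashProduct k Γ A)) (T := IndCx hS K L) (f := f) (g := g)
    (fun p q hpq x => ?_) z
  have : (f : Tot (Env k (SmashProduct k Γ A)) (IndCx hS K L) n →ₗ[Env k (SmashProduct k Γ A)] M)
      ∘ₗ Tot.single n p q = g ∘ₗ Tot.single n p q := Ind.hom_ext hS fun l x => h p q hpq l x
  exact LinearMap.congr_fun this x

theorem famH_indDesc {M : Type u} [AddCommGroup M] [Module k M]
    [Module (Env k (SmashProduct k Γ A)) M] [IsScalarTower k (Env k (SmashProduct k Γ A)) M]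
    {n p q : ℕ} (h : p + q = n + 1) (F : ∀ p q, GenMap.Bi K L M p q) (l : L.X p) (x : K.X q) :
    indDesc hS K L n F ((GenMap.famH (indGen hS K L n) p q).1 l x) =
      (GenMap.famH F p q).1 l x := by
  cases p with
  | zero => exact map_zero (indDesc hS K L n F)
  | succ p => exact indDesc_gen hS (by omega) F _ x

theorem famV_indDesc {M : Type u} [AddCommGroup M] [Module k M]
    [Module (Env k (SmashProduct k Γ A)) M] [IsScalarTower k (Env k (SmashProduct k Γ A)) M]
    {n p q : ℕ} (h : p + q = n + 1) (F : ∀ p q, GenMap.Bi K L M p q) (l : L.X p) (x : K.X q) :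
    indDesc hS K L n F ((GenMap.famV (indGen hS K L n) p q).1 l x) =
      (GenMap.famV F p q).1 l x := by
  cases q with
  | zero => exact map_zero (indDesc hS K L n F)
  | succ q => exact indDesc_gen hS (by omega) F l _

/-- The dual reading: for a map out of the resolution, composition with the differential acts on the
family describing it. Identities between chain maps thus become identities between families. -/
theorem indDesc_indD {M : Type u} [AddCommGroup M] [Module k M]
    [Module (Env k (SmashProduct k Γ A)) M] [IsScalarTower k (Env k (SmashProduct k Γ A)) M]
    {n p q : ℕ} (h : p + q = n + 1) (F : ∀ p q, GenMap.Bi K L M p q) (l : L.X p) (x : K.X q) :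
    indDesc hS K L n F (indD hS K L n ((indGen hS K L (n + 1) p q).1 l x)) =
      (GenMap.famH F p q + (-1 : k) ^ p • GenMap.famV F p q).1 l x := by
  have e : ∀ y : IndTot hS K L n, indDesc hS K L n F ((-1 : k) ^ p • y) =
      (-1 : k) ^ p • indDesc hS K L n F y := fun y =>
    map_smul ((indDesc hS K L n F).restrictScalars k) _ y
  rw [d_indGen, map_add, e, famH_indDesc hS h, famV_indDesc hS h]
  rfl

/-- The diagonal map on the generators. -/
def indDiagGen (m n p q : ℕ) : GenMap.Bi K L
    (RelTensor k (SmashProduct k Γ A) (IndTot hS K L m) (IndTot hS K L n)) p q :=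
  GenMap.famMul ω σ (indGen hS K L m) (indGen hS K L n) p q

theorem indDiagGen_eq_zero {m n p q : ℕ} (h : m + n ≠ p + q) :
    indDiagGen hS ω σ m n p q = 0 :=
  GenMap.famMul_eq_zero ω σ _ _ (fun _ _ => indGen_of_ne hS) (fun _ _ => indGen_of_ne hS) p q h

/-- The diagonal map of the resolution. -/
def indDiag (r m n : ℕ) : IndTot hS K L r →ₗ[Env k (SmashProduct k Γ A)]
    RelTensor k (SmashProduct k Γ A) (IndTot hS K L m) (IndTot hS K L n) :=
  indDesc hS K L r (indDiagGen hS ω σ m n)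

theorem indDiag_of_ne {r m n : ℕ} (h : m + n ≠ r) : indDiag hS ω σ r m n = 0 :=
  indRes_hom_ext hS fun p q hpq l x => by
    rw [indDiag, indDesc_gen hS hpq, indDiagGen_eq_zero hS ω σ (by omega)]
    rfl

/-- The Leibniz rule for the tautological family multiplied with itself is the chain map condition
on generators. -/
theorem indDiagGen_comm (m n p q : ℕ) :
    GenMap.famH (indDiagGen hS ω σ m n) p q +
        (-1 : k) ^ p • GenMap.famV (indDiagGen hS ω σ m n) p q =
      GenMap.postcomp (RelTensor.mapEnv (indD hS K L m)
          (LinearMap.id : IndTot hS K L n →ₗ[Env k (SmashProduct k Γ A)] IndTot hS K L n))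
        (indDiagGen hS ω σ (m + 1) n p q) +
      (-1 : k) ^ m • GenMap.postcomp (RelTensor.mapEnv
          (LinearMap.id : IndTot hS K L m →ₗ[Env k (SmashProduct k Γ A)] IndTot hS K L m)
          (indD hS K L n)) (indDiagGen hS ω σ m (n + 1) p q) :=
  GenMap.famMul_comm ω σ (indD hS K L m) (indD hS K L n) (indGen hS K L m)
    (indGen hS K L (m + 1)) (indGen hS K L n) (indGen hS K L (n + 1))
    (fun _ _ => indGen_of_ne hS) (postcomp_indD hS m) (postcomp_indD hS n) p q

theorem indDiag_comm_gen (r m n p q : ℕ) (h : p + q = r + 1) (l : L.X p) (x : K.X q) :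
    indDiag hS ω σ r m n (indD hS K L r ((indGen hS K L (r + 1) p q).1 l x)) =
      RelTensor.map (indD hS K L m)
        (LinearMap.id : IndTot hS K L n →ₗ[Env k (SmashProduct k Γ A)] IndTot hS K L n)
        (indDiag hS ω σ (r + 1) (m + 1) n ((indGen hS K L (r + 1) p q).1 l x)) +
      (-1 : k) ^ m • RelTensor.map
        (LinearMap.id : IndTot hS K L m →ₗ[Env k (SmashProduct k Γ A)] IndTot hS K L m)
        (indD hS K L n)
        (indDiag hS ω σ (r + 1) m (n + 1) ((indGen hS K L (r + 1) p q).1 l x)) := by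
  have h1 := indDesc_indD hS h (indDiagGen hS ω σ m n) l x
  have h2 : indDiag hS ω σ (r + 1) (m + 1) n ((indGen hS K L (r + 1) p q).1 l x) =
      (indDiagGen hS ω σ (m + 1) n p q).1 l x := indDesc_gen hS h _ l x
  have h3 : indDiag hS ω σ (r + 1) m (n + 1) ((indGen hS K L (r + 1) p q).1 l x) =
      (indDiagGen hS ω σ m (n + 1) p q).1 l x := indDesc_gen hS h _ l x
  have h4 := congrArg (fun F : GenMap.Bi K L
    (RelTensor k (SmashProduct k Γ A) (IndTot hS K L m) (IndTot hS K L n)) p q => F.1 l x)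
    (indDiagGen_comm hS ω σ m n p q)
  have h5 := congrArg (RelTensor.map (indD hS K L m)
    (LinearMap.id : IndTot hS K L n →ₗ[Env k (SmashProduct k Γ A)] IndTot hS K L n)) h2
  have h6 := congrArg (fun y => (-1 : k) ^ m • RelTensor.map
    (LinearMap.id : IndTot hS K L m →ₗ[Env k (SmashProduct k Γ A)] IndTot hS K L m)
    (indD hS K L n) y) h3
  exact (h1.trans h4).trans (congrArg₂ (· + ·) h5 h6).symm

theorem indDiag_comm (r m n : ℕ) (z : IndTot hS K L (r + 1)) :
    indDiag hS ω σ r m n (indD hS K L r z) =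
      RelTensor.map (indD hS K L m)
        (LinearMap.id : IndTot hS K L n →ₗ[Env k (SmashProduct k Γ A)] IndTot hS K L n)
        (indDiag hS ω σ (r + 1) (m + 1) n z) +
      (-1 : k) ^ m • RelTensor.map
        (LinearMap.id : IndTot hS K L m →ₗ[Env k (SmashProduct k Γ A)] IndTot hS K L m)
        (indD hS K L n) (indDiag hS ω σ (r + 1) m (n + 1) z) := by
  -- With an integer sign both sides are linear over the enveloping algebra, so they may be compared
  -- on generators.
  have e : indDiag hS ω σ r m n ∘ₗ indD hS K L r =
      RelTensor.mapEnv (indD hS K L m)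
        (LinearMap.id : IndTot hS K L n →ₗ[Env k (SmashProduct k Γ A)] IndTot hS K L n) ∘ₗ
          indDiag hS ω σ (r + 1) (m + 1) n +
      (-1 : ℤ) ^ m • (RelTensor.mapEnv
        (LinearMap.id : IndTot hS K L m →ₗ[Env k (SmashProduct k Γ A)] IndTot hS K L m)
        (indD hS K L n) ∘ₗ indDiag hS ω σ (r + 1) m (n + 1)) := by
    refine indRes_hom_ext hS fun p q hpq l x => ?_
    refine (indDiag_comm_gen hS ω σ r m n p q hpq l x).trans ?_
    rw [neg_one_pow_smul_eq]
    rfl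
  refine (LinearMap.congr_fun e z).trans ?_
  rw [neg_one_pow_smul_eq]
  rfl

end Diagonal


/-! ### Families with values in an algebra extension -/

section Comparison

variable {k Γ A B : Type u} [Field k] [Ring Γ] [HopfAlgebra k Γ] [Ring A] [Algebra k A]
  [Module Γ A] [IsScalarTower k Γ A] [IsModuleAlgebra k Γ A] [Ring B] [Algebra k B]
  {j : SmashProduct k Γ A →ₐ[k] B}
  {L K : Type u}
  [AddCommGroup L] [Module k L] [Module Γᵐᵒᵖ L] [IsScalarTower k Γᵐᵒᵖ L]
  [AddCommGroup K] [Module k K] [Module (Env k A) K] [IsScalarTower k (Env k A) K]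
  [Module Γ K] [IsScalarTower k Γ K]

theorem ExtMod.leftTwist_eq (u : Γ →ₗ[k] ExtMod j) : leftTwist Γ A u =
    sweedler (LinearMap.mul k B) (j.comp (SmashProduct.inr k)).toLinearMap u := by
  ext γ
  exact (sweedler_apply _ _ _ (ℛ k γ)).trans ((Finset.sum_congr rfl fun i _ =>
    ExtMod.leftAct_eq (j := j) _ _).trans (sweedler_apply (k := k) (LinearMap.mul k B)
      (j.comp (SmashProduct.inr k)).toLinearMap (u : Γ →ₗ[k] B) (ℛ k γ)).symm)

theorem ExtMod.rightTwist_eq (f : K →ₗ[k] ExtMod j) (x : K) :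
    rightTwist Γ A f x = twist (M := K) (B := B) j f x := by
  ext γ
  exact (sweedler_apply _ _ _ (ℛ k γ)).trans ((Finset.sum_congr rfl fun i _ =>
    ExtMod.rightAct_eq (j := j) _ _).trans (sweedler_apply (k := k) (LinearMap.mul k B)
      ((f : K →ₗ[k] B) ∘ₗ orbit (Γ := Γ) k x) (j.comp (SmashProduct.inr k)).toLinearMap (ℛ k γ)).symm)

/-- For M = B the abstract conjugation is the right Γ-action on linear maps K → B. With
`IsGen.conj_eq` this identifies families of generators in B with Γ-linear maps L → Hom_{A^e}(K, B).
-/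
theorem ExtMod.conj_eq (f : K →ₗ[k] ExtMod j) (x : K) (γ : Γ) :
    conj Γ A f γ x = rightHomAct (M := K) (B := B) j f x γ := by
  refine (congrArg (fun u : Γ →ₗ[k] ExtMod j => antipodeTwist Γ A u γ)
    (ExtMod.rightTwist_eq f x)).trans ?_
  exact (sweedler_apply _ _ _ (ℛ k γ)).trans ((Finset.sum_congr rfl fun i _ =>
    ExtMod.leftAct_eq (j := j) _ _).trans (sweedler_apply (k := k) (LinearMap.mul k B)
      ((j.comp (SmashProduct.inr k)).toLinearMap ∘ₗ HopfAlgebra.antipode k)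
      (twist (M := K) (B := B) j f x) (ℛ k γ)).symm)

namespace GenMap

/-- The bimodule map `x ↦ F(l)(x)` into an algebra extension of the smash product. -/
def toBimodHom (F : GenMap k Γ A L K (ExtMod j)) (l : L) :
    BimodHom (j.comp (SmashProduct.inl k)) K :=
  ⟨(F.1 l : K →ₗ[k] ExtMod j), fun r s x => by
    have h : F.1 l ((r ⊗ₜ[k] op s) • x) =
        ExtMod.of j (SmashProduct.inl k r) * (F.1 l x * ExtMod.of j (SmashProduct.inl k s)) := by
      rw [left_right_act, F.2.left, F.2.right, ExtMod.leftAct_eq, ExtMod.rightAct_eq]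
    exact h.trans (mul_assoc _ _ _).symm⟩

/-- Generators with values in an algebra extension of the smash product as elements of
`Hom_Γ(L, Hom_{A^e}(K, B))`. -/
def toDHom : GenMap k Γ A L K (ExtMod j) →ₗ[k] DHom j L K where
  toFun F := ⟨
    { toFun := toBimodHom F
      map_add' := fun l l' => Subtype.ext (map_add F.1 l l')
      map_smul' := fun c l => Subtype.ext (map_smul F.1 c l) },
    fun γ l x => (LinearMap.congr_fun (F.2.conj_eq l γ) x).symm.trans
      (ExtMod.conj_eq (F.1 l) x γ)⟩
  map_add' _ _ := rfl
  map_smul' _ _ := rfl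

/-- Elements of `Hom_Γ(L, Hom_{A^e}(K, B))` as generators with values in `B`. -/
def ofDHom (F : DHom j L K) : GenMap k Γ A L K (ExtMod j) :=
  ⟨((BimodHom (j.comp (SmashProduct.inl k)) K).subtype ∘ₗ F.1 : L →ₗ[k] K →ₗ[k] B),
    { left := fun l a x => (BimodHom.map_leftAct (F.1 l) a x).trans (ExtMod.leftAct_eq _ _).symm
      right := fun l a x => (BimodHom.map_rightAct (F.1 l) a x).trans (ExtMod.rightAct_eq _ _).symm
      equiv := fun l x γ => by
        -- Multiplying the formula for the action by γ on the left cancels its antipode and restores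
        -- the relation between generators.
        have h := LinearMap.congr_fun (sweedler_rightHomAct j (F.1 l).1 x) γ
        have e : rightHomAct j (F.1 l).1 x =
            (((BimodHom (j.comp (SmashProduct.inl k)) K).subtype ∘ₗ F.1).flip x ∘ₗ
              rightOrbit k l : Γ →ₗ[k] B) := LinearMap.ext fun γ => (F.2 γ l x).symm
        rw [e] at h
        exact (LinearMap.congr_fun (ExtMod.leftTwist_eq (j := j) _) γ).trans (h.trans
          (LinearMap.congr_fun (ExtMod.rightTwist_eq (j := j) (F.1 l).1 x) γ).symm) }⟩

end GenMap

end Comparison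

/-! ### Agreement of the two products, without signs -/

section Pairing

variable {k Γ A B : Type u} [Field k] [Ring Γ] [HopfAlgebra k Γ] [Ring A] [Algebra k A]
  [Module Γ A] [IsScalarTower k Γ A] [IsModuleAlgebra k Γ A] [Ring B] [Algebra k B]
  {j : SmashProduct k Γ A →ₐ[k] B}
  {M₁ M₂ : Type u}
  [AddCommGroup M₁] [Module k M₁]
  [Module (Env k (SmashProduct k Γ A)) M₁] [IsScalarTower k (Env k (SmashProduct k Γ A)) M₁]
  [AddCommGroup M₂] [Module k M₂]
  [Module (Env k (SmashProduct k Γ A)) M₂] [IsScalarTower k (Env k (SmashProduct k Γ A)) M₂]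
  {L₁ L₂ K₁ K₂ L K : Type u}
  [AddCommGroup L₁] [Module k L₁] [Module Γᵐᵒᵖ L₁] [IsScalarTower k Γᵐᵒᵖ L₁]
  [AddCommGroup L₂] [Module k L₂] [Module Γᵐᵒᵖ L₂] [IsScalarTower k Γᵐᵒᵖ L₂]
  [AddCommGroup K₁] [Module k K₁] [Module (Env k A) K₁] [IsScalarTower k (Env k A) K₁]
  [Module Γ K₁] [IsScalarTower k Γ K₁] [IsEquivariant k Γ A K₁]
  [AddCommGroup K₂] [Module k K₂] [Module (Env k A) K₂] [IsScalarTower k (Env k A) K₂]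
  [Module Γ K₂] [IsScalarTower k Γ K₂] [IsEquivariant k Γ A K₂]
  [AddCommGroup L] [Module k L] [Module Γᵐᵒᵖ L] [IsScalarTower k Γᵐᵒᵖ L]
  [AddCommGroup K] [Module k K] [Module (Env k A) K] [IsScalarTower k (Env k A) K]
  [Module Γ K] [IsScalarTower k Γ K]

/-- The map `m ⊗ n ↦ f(m) g(n)` as a bimodule map. -/
def BimodHom.pairHom (f : BimodHom j M₁) (g : BimodHom j M₂) :
    BimodHom j (RelTensor k (SmashProduct k Γ A) M₁ M₂) :=
  ⟨BimodHom.pair f g, BimodHom.pair_smul f g⟩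

/-- On pure tensors both sides are f(F(l₁)(x₁)) g(G(l₂)(x₂)). The auxiliary T keeps l₁ ⊗ l₂ and x₁ ⊗
x₂ as free arguments, so that σ(l) and ω(x) can be substituted afterwards. -/
theorem GenMap.toDHom_cup (f : BimodHom j M₁) (g : BimodHom j M₂) (σ : L →ₗ[k] L₁ ⊗[k] L₂)
    (hσ : ∀ (γ : Γ) l, σ (op γ • l) = rightDiag k L₁ L₂ γ (σ l))
    (ω : K →ₗ[Env k A] RelTensor k A K₁ K₂) (hω : ∀ (γ : Γ) x, ω (γ • x) = γ • ω x)
    (F : GenMap k Γ A L₁ K₁ M₁) (G : GenMap k Γ A L₂ K₂ M₂) :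
    toDHom (postcomp (ExtMod.ofBimodHom (BimodHom.pairHom f g)) (cup σ hσ ω hω F G)) =
      DHom.cup σ hσ ω hω (toDHom (postcomp (ExtMod.ofBimodHom f) F))
        (toDHom (postcomp (ExtMod.ofBimodHom g) G)) := by
  let T : L₁ ⊗[k] L₂ →ₗ[k] RelTensor k A K₁ K₂ →ₗ[k] B :=
    TensorProduct.lift (BimodHom.pair.compl₁₂ (toDHom (postcomp (ExtMod.ofBimodHom f) F)).1
      (toDHom (postcomp (ExtMod.ofBimodHom g) G)).1)
  have e1 : (pair F G).compr₂ (BimodHom.pair f g) = T := pair_ext fun l l' x y => rfl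
  have e2 : ∀ x, ((LinearMap.applyₗ x ∘ₗ
      (BimodHom (j.comp (SmashProduct.inl k)) K).subtype) ∘ₗ
      DHom.pair ω (toDHom (postcomp (ExtMod.ofBimodHom f) F))
        (toDHom (postcomp (ExtMod.ofBimodHom g) G)) : L₁ ⊗[k] L₂ →ₗ[k] B) = T.flip (ω x) :=
    fun x => TensorProduct.ext' fun l l' => rfl
  exact DHom.ext fun l x => (LinearMap.congr_fun (LinearMap.congr_fun e1 (σ l)) (ω x)).trans
    (LinearMap.congr_fun (e2 x) (σ l)).symm

end Pairing

/-! ### Cochains on the resolution and the double complex -/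

section Families

variable {k Γ A B : Type u} [Field k] [Ring Γ] [HopfAlgebra k Γ] [Ring A] [Algebra k A]
  [Module Γ A] [IsScalarTower k Γ A] [IsModuleAlgebra k Γ A] [Ring B] [Algebra k B]
  {j : SmashProduct k Γ A →ₐ[k] B}
  {K : EquivRes k Γ A} {L : TrivRes k Γ} (ω : EquivDiagonal K) (σ : TrivDiagonal L)
  {M₁ M₂ : Type u}
  [AddCommGroup M₁] [Module k M₁]
  [Module (Env k (SmashProduct k Γ A)) M₁] [IsScalarTower k (Env k (SmashProduct k Γ A)) M₁]
  [AddCommGroup M₂] [Module k M₂]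
  [Module (Env k (SmashProduct k Γ A)) M₂] [IsScalarTower k (Env k (SmashProduct k Γ A)) M₂]

namespace GenMap

/-- The family of elements of `Hom_Γ(L, Hom_{A^e}(K, B))` that is the composite of a family of
generators with a bimodule map. -/
def toDouble (F : ∀ p q, Bi K L M₁ p q) : BimodHom j M₁ →ₗ[k] Double j K L where
  toFun f := fun p q => toDHom (postcomp (ExtMod.ofBimodHom f) (F p q))
  map_add' _ _ := rfl
  map_smul' _ _ := rfl

theorem toDouble_apply (F : ∀ p q, Bi K L M₁ p q) (f : BimodHom j M₁) (p q : ℕ) :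
    toDouble F f p q = toDHom (postcomp (ExtMod.ofBimodHom f) (F p q)) := rfl

theorem toDouble_homog {n : ℕ} (F : ∀ p q, Bi K L M₁ p q) (hF : ∀ p q, p + q ≠ n → F p q = 0)
    (f : BimodHom j M₁) : toDouble F f ∈ Double.homog j K L n := fun p q h => by
  rw [toDouble_apply, hF p q h, map_zero, map_zero]

/-- The signs match: with m = p₁ + q₁ and n = p₂ + q₂, the cup product sign (-1)^(mn) times the sign
(-1)^(p₂q₁) of the diagonal map is (-1)^((p₂ + q₂)p₁ + q₂q₁), the sign in the double complex. -/
theorem toDouble_famMul {m n : ℕ} (F : ∀ p q, Bi K L M₁ p q) (G : ∀ p q, Bi K L M₂ p q)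
    (hF : ∀ p q, p + q ≠ m → F p q = 0) (hG : ∀ p q, p + q ≠ n → G p q = 0)
    (f : BimodHom j M₁) (g : BimodHom j M₂) :
    (-1 : k) ^ (m * n) • toDouble (famMul ω σ F G) (BimodHom.pairHom f g) =
      Double.mul j ω σ (toDouble F f) (toDouble G g) := by
  funext p q
  change (-1 : k) ^ (m * n) • toDHom (postcomp (ExtMod.ofBimodHom (BimodHom.pairHom f g))
    (famMul ω σ F G p q)) = _
  rw [famMul, Double.mul_apply, map_sum, map_sum, Finset.smul_sum]
  refine Finset.sum_congr rfl fun a _ => ?_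
  rw [map_sum, map_sum, Finset.smul_sum]
  refine Finset.sum_congr rfl fun b _ => ?_
  by_cases h1 : a.1 + b.1 = m
  · by_cases h2 : a.2 + b.2 = n
    · subst h1 h2
      rw [term, Double.term, LinearMap.smul_apply, LinearMap.smul_apply, map_smul, map_smul,
        toDHom_cup, smul_smul]
      have e : (-1 : k) ^ ((a.1 + b.1) * (a.2 + b.2)) * (-1) ^ (a.2 * b.1) =
          (-1) ^ ((a.2 + b.2) * a.1 + b.2 * b.1) := by
        rw [← pow_add, show (a.1 + b.1) * (a.2 + b.2) + a.2 * b.1 =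
          (a.2 + b.2) * a.1 + b.2 * b.1 + (a.2 * b.1 + a.2 * b.1) by ring, pow_add,
          Even.neg_one_pow (n := a.2 * b.1 + a.2 * b.1) ⟨_, rfl⟩, mul_one]
      rw [e]
      rfl
    · rw [hG _ _ h2, term_zero_right, map_zero, map_zero, smul_zero, toDouble_apply, toDouble_apply,
        hG _ _ h2, map_zero, map_zero, Double.term_zero_right]
  · rw [hF _ _ h1, term_zero_left, map_zero, map_zero, smul_zero, toDouble_apply, toDouble_apply,
      hF _ _ h1, map_zero, map_zero, Double.term_zero_left]

/-- In the direction of L the sign -(-1)^n is that of `Double.eL`. In the direction of K the factor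
(-1)^p of the total differential reduces it to -(-1)^q, that of `Double.eK`. -/
theorem dTot_toDouble {n : ℕ} (d : M₂ →ₗ[Env k (SmashProduct k Γ A)] M₁)
    (F : ∀ p q, Bi K L M₁ p q) (F' : ∀ p q, Bi K L M₂ p q)
    (h0 : ∀ p q, p + q ≠ n → F p q = 0)
    (hF : ∀ p q, postcomp d (F' p q) = famH F p q + (-1 : k) ^ p • famV F p q)
    (f : BimodHom j M₁) :
    (-(-1 : k) ^ n) • toDouble F' (BimodHom.precomp d f) =
      Double.dTot j K L (toDouble F f) := by
  funext p q
  have e : toDouble F' (BimodHom.precomp d f) p q =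
      toDHom (postcomp (ExtMod.ofBimodHom f) (postcomp d (F' p q))) := rfl
  have eH : (-(-1 : k) ^ n) • toDHom (postcomp (ExtMod.ofBimodHom f) (famH F p q)) =
      Double.dL j K L (toDouble F f) p q := by
    cases p with
    | zero =>
      have h : toDHom (postcomp (ExtMod.ofBimodHom f) (famH F 0 q)) = 0 :=
        (congrArg toDHom (map_zero (postcomp (ExtMod.ofBimodHom f)))).trans (map_zero toDHom)
      rw [h, smul_zero]
      rfl
    | succ p =>
      rw [Double.dL_succ, Double.eL, LinearMap.smul_apply]
      by_cases h : p + q = n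
      · rw [h]
        rfl
      · rw [toDouble_apply, famH, h0 p q h]
        simp only [map_zero, smul_zero]
  have eV : (-(-1 : k) ^ n) • (-1 : k) ^ p • toDHom (postcomp (ExtMod.ofBimodHom f)
      (famV F p q)) = Double.dK j K L (toDouble F f) p q := by
    cases q with
    | zero =>
      have h : toDHom (postcomp (ExtMod.ofBimodHom f) (famV F p 0)) = 0 :=
        (congrArg toDHom (map_zero (postcomp (ExtMod.ofBimodHom f)))).trans (map_zero toDHom)
      rw [h, smul_zero, smul_zero]
      rfl
    | succ q =>
      rw [Double.dK_succ, Double.eK, LinearMap.smul_apply]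
      by_cases h : p + q = n
      · subst h
        rw [smul_smul, show -(-1 : k) ^ (p + q) * (-1) ^ p = -(-1) ^ q by
          rw [neg_mul, ← pow_add, show p + q + p = q + (p + p) by ring, pow_add,
            Even.neg_one_pow (n := p + p) ⟨_, rfl⟩, mul_one]]
        rfl
      · rw [toDouble_apply, famV, h0 p q h]
        simp only [map_zero, smul_zero]
  change (-(-1 : k) ^ n) • toDouble F' (BimodHom.precomp d f) p q =
    Double.dK j K L (toDouble F f) p q + Double.dL j K L (toDouble F f) p q
  rw [e, hF, map_add, map_add, map_smul, map_smul, smul_add, eH, eV, add_comm]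

end GenMap

end Families


theorem DGAlg.CohIso.of_bijective {k : Type u} [Field k] {D D' : DGAlg k}
    (α : ∀ n, D.C n →ₗ[k] D'.C n) (hα : ∀ n x, α (n + 1) (D.d n x) = D'.d n (α n x))
    (hbij : ∀ n, Function.Bijective (α n))
    (hmul : ∀ m n r (h : m + n = r) x y,
      α r (D.mul m n r h x y) = D'.mul m n r h (α m x) (α n y))
    (hone : α 0 D.one = D'.one) : DGAlg.CohIso D D' := by
  let e := fun n => LinearEquiv.ofBijective (α n) (hbij n)
  have he : ∀ n x, α n ((e n).symm x) = x := fun n x => (e n).apply_symm_apply x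
  have he' : ∀ n x, (e n).symm (α n x) = x := fun n x => (e n).symm_apply_apply x
  refine DGAlg.CohIso.of_chainMaps α hα (fun n => (e n).symm.toLinearMap) (fun n x => ?_)
    (fun n x _ => ?_) (fun n x _ => ?_) (fun m n r h x y _ _ => ?_) ?_
  · refine (hbij (n + 1)).1 ((he _ _).trans ?_)
    rw [hα]
    exact congrArg (D'.d n) (he n x).symm
  · rw [LinearEquiv.coe_coe, he', sub_self]
    exact zero_mem _
  · rw [LinearEquiv.coe_coe, he, sub_self]
    exact zero_mem _
  · rw [hmul, sub_self]
    exact zero_mem _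
  · rw [hone, sub_self]
    exact zero_mem _

/-! ### The unit -/

section Unit

variable {k Γ A B : Type u} [Field k] [Ring Γ] [HopfAlgebra k Γ] [Ring A] [Algebra k A]
  [Module Γ A] [IsScalarTower k Γ A] [IsModuleAlgebra k Γ A] [Ring B] [Algebra k B]
  (j : SmashProduct k Γ A →ₐ[k] B)
  {K : EquivRes k Γ A} {L : TrivRes k Γ} (ω : EquivDiagonal K) (σ : TrivDiagonal L)

theorem pair_aug {R : Type u} [Ring R] [Algebra k R] (j : R →ₐ[k] B) (P : BimodRes k R)
    (z : RelTensor k R (P.X 0) (P.X 0)) : BimodHom.pair (P.aug j) (P.aug j) z =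
      j (BimodHom.pair (P.aug (AlgHom.id k R)) (P.aug (AlgHom.id k R)) z) := by
  have e : BimodHom.pair (P.aug j) (P.aug j) = j.toLinearMap ∘ₗ
      BimodHom.pair (P.aug (AlgHom.id k R)) (P.aug (AlgHom.id k R)) :=
    RelTensor.ext fun x y => (map_mul j (P.ε x) (P.ε y)).symm
  exact LinearMap.congr_fun e z

/-- Idempotence of the unit cochain is the conjunction of the augmentation conditions on σ and ω. It
is needed to show that the diagonal map of the resolution respects augmentations. -/
theorem mul_oneFamily : Double.mul j ω σ (Double.oneFamily j K L) (Double.oneFamily j K L) 0 0 =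
    Double.oneEntry j K L := by
  have e0 : Double.mul j ω σ (Double.oneFamily j K L) (Double.oneFamily j K L) 0 0 =
      DHom.cup (σ.σ 0 0 0) (σ.equivariant 0 0 0) (ω.ω 0 0 0) (ω.ω_smul 0 0 0)
        (Double.oneEntry j K L) (Double.oneEntry j K L) := by
    rw [Double.mul_apply, Finset.HasAntidiagonal.antidiagonal_zero, Finset.sum_singleton,
      Finset.sum_singleton, Double.term]
    have h : (-1 : k) ^ ((0 + 0) * 0 + 0 * 0) = 1 := by simp
    exact (congrArg (· • DHom.cup (σ.σ 0 0 0) (σ.equivariant 0 0 0) (ω.ω 0 0 0)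
      (ω.ω_smul 0 0 0) (Double.oneEntry j K L) (Double.oneEntry j K L)) h).trans (one_smul k _)
  rw [e0]
  refine DHom.ext fun l x => ?_
  let a := BimodRes.aug K.toProjRes (j.comp (SmashProduct.inl k))
  have e1 : ((LinearMap.applyₗ x ∘ₗ
      (BimodHom (j.comp (SmashProduct.inl k)) (K.X 0)).subtype) ∘ₗ
      DHom.pair (ω.ω 0 0 0) (Double.oneEntry j K L) (Double.oneEntry j K L) :
        L.X 0 ⊗[k] L.X 0 →ₗ[k] B) =
      (LinearMap.mul' k k ∘ₗ TensorProduct.map L.ε L.ε).smulRight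
        (BimodHom.pair a a (ω.ω 0 0 0 x)) := TensorProduct.ext' fun l l' => by
    change BimodHom.pair (L.ε l • a) (L.ε l' • a) (ω.ω 0 0 0 x) =
      (L.ε l * L.ε l') • BimodHom.pair a a (ω.ω 0 0 0 x)
    rw [map_smul, map_smul, LinearMap.smul_apply, LinearMap.smul_apply, LinearMap.smul_apply,
      smul_smul, mul_comm]
  refine (LinearMap.congr_fun e1 (σ.σ 0 0 0 l)).trans ?_
  have e2 := (pair_aug (j.comp (SmashProduct.inl k)) K.toProjRes (ω.ω 0 0 0 x)).trans
    (congrArg (j.comp (SmashProduct.inl k)) (ω.aug x))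
  exact congrArg₂ (· • ·) (σ.aug l) e2

namespace GenMap

variable {j} {M₁ M₂ : Type u}
  [AddCommGroup M₁] [Module k M₁]
  [Module (Env k (SmashProduct k Γ A)) M₁] [IsScalarTower k (Env k (SmashProduct k Γ A)) M₁]
  [AddCommGroup M₂] [Module k M₂]
  [Module (Env k (SmashProduct k Γ A)) M₂] [IsScalarTower k (Env k (SmashProduct k Γ A)) M₂]

theorem toDouble_eq_zero (F : ∀ p q, Bi K L M₁ p q) {p q : ℕ} (h : F p q = 0)
    (f : BimodHom j M₁) : toDouble F f p q = 0 := by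
  rw [toDouble_apply, h, map_zero, map_zero]

theorem toDouble_famMul_one (F : ∀ p q, Bi K L M₁ p q) (G : ∀ p q, Bi K L M₂ p q)
    (hF : ∀ p q, p + q ≠ 0 → F p q = 0) (hG : ∀ p q, p + q ≠ 0 → G p q = 0)
    (f : BimodHom j M₁) (g : BimodHom j M₂) (hf : toDouble F f = Double.oneFamily j K L)
    (hg : toDouble G g = Double.oneFamily j K L) :
    toDouble (famMul ω σ F G) (BimodHom.pairHom f g) 0 0 = Double.oneEntry j K L := by
  have h := toDouble_famMul ω σ F G hF hG f g
  rw [hf, hg, Nat.mul_zero, pow_zero, one_smul] at h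
  rw [h, mul_oneFamily]

end GenMap

end Unit

/-! ### The isomorphism of differential graded algebras -/

section Main

variable {k Γ A B : Type u} [Field k] [Ring Γ] [HopfAlgebra k Γ] [Ring A] [Algebra k A]
  [Module Γ A] [IsScalarTower k Γ A] [IsModuleAlgebra k Γ A] [Ring B] [Algebra k B]
  (hS : Function.Bijective (HopfAlgebra.antipode k (A := Γ)))
  (j : SmashProduct k Γ A →ₐ[k] B)
  {K : EquivRes k Γ A} {L : TrivRes k Γ} (ω : EquivDiagonal K) (σ : TrivDiagonal L)

variable (K L) in
/-- The augmentation of the resolution, composed with an algebra map. -/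
def indAugHom : BimodHom j (IndTot hS K L 0) := BimodRes.aug (indRes hS K L) j

theorem indε_gen (l : L.X 0) (x : K.X 0) :
    indε hS K L ((indGen hS K L 0 0 0).1 l x) = augGen K L l x := by
  have h : (Tot.comp 0 0 0 : IndTot hS K L 0 →ₗ[Env k (SmashProduct k Γ A)] IndCx hS K L 0 0)
      ((indGen hS K L 0 0 0).1 l x) = Ind.gen (L.X 0) (K.X 0) hS l x :=
    Tot.single_val_same (S := Env k (SmashProduct k Γ A)) (T := IndCx hS K L) (n := 0) (p := 0) (q := 0) rfl _
  exact (congrArg (indAug hS K L) h).trans (Ind.lift_gen hS _ _ l x)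

theorem indAugHom_gen (l : L.X 0) (x : K.X 0) :
    (indAugHom hS j K L).1 ((indGen hS K L 0 0 0).1 l x) =
      L.ε l • j (SmashProduct.inl k (K.ε x)) :=
  (congrArg j (indε_gen hS l x)).trans (map_smul j (L.ε l) (SmashProduct.inl k (K.ε x)))

theorem toDouble_indAugHom : GenMap.toDouble (indGen hS K L 0) (indAugHom hS j K L) =
    Double.oneFamily j K L := by
  funext p q
  by_cases h : p + q = 0
  · obtain ⟨rfl, rfl⟩ : p = 0 ∧ q = 0 := by omega
    exact DHom.ext fun l x => indAugHom_gen hS j l x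
  · exact (GenMap.toDouble_homog (indGen hS K L 0) (fun _ _ => indGen_of_ne hS)
      (indAugHom hS j K L) p q h).trans (Double.oneFamily_homog j K L p q h).symm

/-- Take B = A#Γ and j the identity. The augmentation of the resolution then corresponds to the unit
of the double complex, whose square is itself in bidegree (0, 0). -/
theorem indDiag_aug (z : IndTot hS K L 0) :
    BimodHom.pair (indAugHom hS (AlgHom.id k (SmashProduct k Γ A)) K L)
      (indAugHom hS (AlgHom.id k (SmashProduct k Γ A)) K L) (indDiag hS ω σ 0 0 0 z) =
      indε hS K L z := by
  let a := indAugHom hS (AlgHom.id k (SmashProduct k Γ A)) K L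
  have h1 := GenMap.toDouble_famMul_one ω σ (indGen hS K L 0) (indGen hS K L 0)
    (fun _ _ => indGen_of_ne hS) (fun _ _ => indGen_of_ne hS) a a
    (toDouble_indAugHom hS _) (toDouble_indAugHom hS _)
  have e : ExtMod.ofBimodHom (BimodHom.pairHom a a) ∘ₗ indDiag hS ω σ 0 0 0 = indε hS K L := by
    refine indRes_hom_ext hS fun p q hpq l x => ?_
    obtain ⟨rfl, rfl⟩ : p = 0 ∧ q = 0 := by omega
    have h2 : indDiag hS ω σ 0 0 0 ((indGen hS K L 0 0 0).1 l x) =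
      (indDiagGen hS ω σ 0 0 0 0).1 l x := indDesc_gen hS rfl _ l x
    have h3 : ExtMod.ofBimodHom (BimodHom.pairHom a a)
        ((indDiagGen hS ω σ 0 0 0 0).1 l x) = augGen K L l x :=
      congrArg (fun F : DHom (AlgHom.id k (SmashProduct k Γ A)) (L.X 0) (K.X 0) => (F.1 l).1 x) h1
    exact ((congrArg (ExtMod.ofBimodHom (BimodHom.pairHom a a)) h2).trans h3).trans
      (indε_gen hS l x).symm
  exact LinearMap.congr_fun e z

/-- The diagonal map of the resolution that is given by `ω` and `σ`. -/
def indDiagonal : BimodDiagonal (indRes hS K L) where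
  ω n p q := indDiag hS ω σ n p q
  shape _ _ _ h := indDiag_of_ne hS ω σ h
  comm n p q z := indDiag_comm hS ω σ n p q z
  aug z := indDiag_aug hS ω σ z

variable (K L) in
/-- The comparison of `Hom(X, B)`, for the resolution `X`, with the double complex. -/
def indCompare (n : ℕ) : BimodHom j (IndTot hS K L n) →ₗ[k] Double.homog j K L n :=
  LinearMap.codRestrict _ (GenMap.toDouble (indGen hS K L n))
    (GenMap.toDouble_homog (indGen hS K L n) (fun _ _ => indGen_of_ne hS))

theorem indCompare_injective (n : ℕ) : Function.Injective (indCompare hS j K L n) := by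
  intro f g h
  have e : ExtMod.ofBimodHom f = ExtMod.ofBimodHom g := indRes_hom_ext hS fun p q _ l x =>
    congrArg (fun F : Double.homog j K L n => ((F.1 p q).1 l).1 x) h
  exact Subtype.ext (LinearMap.ext fun z => LinearMap.congr_fun e z)

/-- Each entry of the double complex is a family of generators with values in B, and the universal
property integrates these families to a bimodule map on the resolution. -/
theorem indCompare_surjective (n : ℕ) : Function.Surjective (indCompare hS j K L n) := by
  intro F
  refine ⟨ExtMod.toBimodHom (j := j) (indDesc hS K L n fun p q =>
    (GenMap.ofDHom (F.1 p q) : GenMap.Bi K L (ExtMod j) p q)),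
    Subtype.ext (funext fun p => funext fun q => ?_)⟩
  by_cases h : p + q = n
  · exact DHom.ext fun l x => indDesc_gen (M := ExtMod j) hS h
      (fun p q => GenMap.ofDHom (F.1 p q)) l x
  · exact ((indCompare hS j K L n _).2 p q h).trans (F.2 p q h).symm

theorem indCompare_d (n : ℕ) (f : BimodHom j (IndTot hS K L n)) :
    (indCompare hS j K L (n + 1) ((-(-1 : k) ^ n) • BimodHom.precomp (indD hS K L n) f)).1 =
      Double.dTot j K L (indCompare hS j K L n f).1 := by
  rw [map_smul]
  exact GenMap.dTot_toDouble (indD hS K L n) (indGen hS K L n) (indGen hS K L (n + 1))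
    (fun _ _ => indGen_of_ne hS) (postcomp_indD hS n) f

theorem toDouble_indGen_pair (m n r : ℕ) (h : m + n = r) (f : BimodHom j (IndTot hS K L m))
    (g : BimodHom j (IndTot hS K L n)) :
    GenMap.toDouble (indGen hS K L r) (BimodHom.cup (indDiag hS ω σ r m n) f g) =
      GenMap.toDouble (indDiagGen hS ω σ m n) (BimodHom.pairHom f g) := by
  funext p q
  by_cases hpq : p + q = r
  · refine DHom.ext fun l x => ?_
    have h1 : indDiag hS ω σ r m n ((indGen hS K L r p q).1 l x) =
      (indDiagGen hS ω σ m n p q).1 l x := indDesc_gen hS hpq _ l x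
    exact congrArg (BimodHom.pair f g) h1
  · exact (GenMap.toDouble_eq_zero (indGen hS K L r) (indGen_of_ne hS hpq) _).trans
      (GenMap.toDouble_eq_zero (indDiagGen hS ω σ m n) (indDiagGen_eq_zero hS ω σ (by omega)) _).symm

theorem indCompare_mul (m n r : ℕ) (h : m + n = r) (f : BimodHom j (IndTot hS K L m))
    (g : BimodHom j (IndTot hS K L n)) :
    (indCompare hS j K L r ((-1 : k) ^ (m * n) • BimodHom.cup (indDiag hS ω σ r m n) f g)).1 =
      Double.mul j ω σ (indCompare hS j K L m f).1 (indCompare hS j K L n g).1 := by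
  rw [map_smul]
  exact (congrArg ((-1 : k) ^ (m * n) • ·) (toDouble_indGen_pair hS j ω σ m n r h f g)).trans
    (GenMap.toDouble_famMul ω σ (indGen hS K L m) (indGen hS K L n)
      (fun _ _ => indGen_of_ne hS) (fun _ _ => indGen_of_ne hS) f g)

/-- For this resolution and diagonal the comparison is an isomorphism of cochain complexes that
respects products and units strictly, so no homotopies intervene. -/
theorem cohIso_derivedInvariants : DGAlg.CohIso
    (hochschild j (indRes hS K L) (indDiagonal hS ω σ)) (derivedInvariants j ω σ) :=
  DGAlg.CohIso.of_bijective (D := hochschild j (indRes hS K L) (indDiagonal hS ω σ))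
    (D' := derivedInvariants j ω σ) (fun n => indCompare hS j K L n)
    (fun n f => Subtype.ext (indCompare_d hS j n f))
    (fun n => ⟨indCompare_injective hS j n, indCompare_surjective hS j n⟩)
    (fun m n r h f g => Subtype.ext (indCompare_mul hS j ω σ m n r h f g))
    (Subtype.ext (toDouble_indAugHom hS j))

end Main

end SmashHH

end

theorem mainTheorem8 {k Γ A B : Type u} [Field k] [Ring Γ] [HopfAlgebra k Γ]
    (hS : Function.Bijective (HopfAlgebra.antipode k (A := Γ)))
    [Ring A] [Algebra k A] [Module Γ A] [IsScalarTower k Γ A] [SmashHH.IsModuleAlgebra k Γ A]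
    [Ring B] [Algebra k B] (j : SmashHH.SmashProduct k Γ A →ₐ[k] B)
    (K : SmashHH.EquivRes k Γ A) (ω : SmashHH.EquivDiagonal K)
    (L : SmashHH.TrivRes k Γ) (σ : SmashHH.TrivDiagonal L)
    (P : SmashHH.BimodRes k (SmashHH.SmashProduct k Γ A)) (Δ : SmashHH.BimodDiagonal P) :
    ∃ e : ∀ n, (SmashHH.hochschild j P Δ).H n ≃ₗ[k] (SmashHH.derivedInvariants j ω σ).H n,
      (∀ m n r (h : m + n = r) (x : (SmashHH.hochschild j P Δ).H m)
          (y : (SmashHH.hochschild j P Δ).H n),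
        e r ((SmashHH.hochschild j P Δ).HMul m n r h x y) =
          (SmashHH.derivedInvariants j ω σ).HMul m n r h (e m x) (e n y)) ∧
      e 0 (SmashHH.hochschild j P Δ).HOne = (SmashHH.derivedInvariants j ω σ).HOne :=
  (SmashHH.hochschild_cohIso j Δ (SmashHH.indDiagonal hS ω σ)).trans
    (SmashHH.cohIso_derivedInvariants hS j ω σ)
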